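/- **Setting.** Let $\mathbb K$ be a field, $b\ge 2$, $r\ge 1$, $d\ge 1$, $N\ge 1$ integers with $\gcd(N,b)=1$, and let $\ell_0,\dots,\ell_r\in\mathbb K[x]$ have degree at most $d$, with $\ell_0\ne0$ and $\ell_r\neq 0$. Let $M$ be the Mahler operator $y(x)\mapsto y(x^b)$ on Puiseux series, and $L=\ell_rM^r+\dots+\ell_0$; the Mahler equation is $Ly=0$. Let $v_k$ be the valuation of $\ell_k$. The lower Newton polygon of $L$ is the lower boundary of the convex hull of the points $(b^k,j)$ for all monomials $x^jM^k$ of $L$; an edge is admissible if the coefficients of the monomials of $L$ on it add up to $0$. Operations (ops) are additions, subtractions, multiplications, divisions and zero tests in $\mathbb K$; multiplying two polynomials of degree at most $n$ costs $\mathsf M(n)$ ops, where $n\mapsto \mathsf M(n)/n$ is nondecreasing on the positive integers and $\mathsf M(1)\ge1$. Polynomials are given in dense form. **Algorithm.** Input: $L$, $d$, $N$, and an integer $T\ge 0$. 1. Compute the slope $s$ and $V$-intercept $c$ of the rightmost admissible edge of the lower Newton polygon of $L$ with slope in $N^{-1}\mathbb Z$. If there is none, return the empty vector. 2. Put $\alpha=-Ns$,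 $\beta=N$, $\gamma=Nc$ and $\tilde L=\sum_k\tilde\ell_k(t)M^k$, where $\tilde\ell_k(t)=t^{\alpha b^k-\gamma}\ell_k(t^\beta)$, with valuations $\tilde v_k=\alpha b^k+\beta v_k-\gamma$. Put $\tilde\nu=\max_{k\ge1}(\tilde v_0-\tilde v_k)/(b^k-1)$ and $\tilde\mu=\tilde v_0+\tilde\nu$. Let $R=(R_{m,j})$ be the infinite matrix in which $R_{m,j}$ is the coefficient of $y_jt^m$ in $\tilde L\sum_j y_jt^j$. 3. Let $h=\lfloor\tilde\mu\rfloor+1$, $w=\lfloor\tilde\nu\rfloor+1$, $m_i=\min_k(\tilde v_k+ib^k)$ for $0\le i<w$. Compute the lower triangular submatrix $(R_{m_i,j})_{0\le i,j<w}$ in sparse form and, by forward substitution, a basis $g_1,\dots,g_\rho$ of its kernel, seen as polynomials of degree less than $w$. Compute the $\tilde Lg_j\bmod t^h$ by fast multiplication, in blocks of degree at most $Nd$; compute a basis of the linear relations between these $\rho$ truncated series by an LSP decomposition with classical matrix arithmetic; recombine the $g_j$ accordingly into $f_1,\dots,f_\sigma$. 4. Extend each $f_i$ by $\max(0,\,Ns+T-1-\lfloor\tilde\nu\rfloor)$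 further coefficients, by forward substitution in the rows $\lfloor\tilde\mu\rfloor+1,\lfloor\tilde\mu\rfloor+2,\dots$ of $R$, into $\hat z_i=\sum_j z_{i,j}t^j$. 5. Return $\hat y_1,\dots,\hat y_\sigma$, where $\hat y_i=\sum_{0\le j\le Ns+T-1}z_{i,j}\,x^{-s+j/N}$. **Theorem.** 1. The algorithm computes the truncation to order $O(x^{T/N})$ of a basis of the solutions of $Ly=0$ in $\mathbb K((x^{1/N}))$: there is a basis $(y_1,\dots,y_\sigma)$ of this solution space such that each $\hat y_i$ consists exactly of the terms of $y_i$ of exponent less than $T/N$. In particular, with $T=N(n+1)$ it computes the truncation to order $O(x^{n+1})$ of a basis; with $T=Nn+1$ it computes the terms of exponent at most $n$. 2. For all integers $n\ge0$ and all $T\le N(n+1)$ it runs in $$O\bigl(r^2\,\mathsf M(Nd)+rN(d^2+(r+d)n)\bigr)$$ ops, where the constant in $O(\cdot)$ is absolute (independent of $\mathbb K$, $\mathsf M$, $b$, $r$, $d$, $N$, $n$, $T$ and $L$). 3. If moreover $\mathsf M$ is softly linear, that is $\mathsf M(k)\le c\,k\log^e(k+2)$ for all $k\ge1$, then the algorithm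 runs in $\tilde O(r^2Nd(d+n))$ ops for all $n\ge 0$ and $T\le N(n+1)$: at most $C\,G\log^{e'}(G+2)$ ops with $G=r^2Nd(d+n)$, where $C,e'$ depend only on $c,e$. -/

import Mathlib

open Polynomial

/-! ## Operation counting

An algorithm is written for an arbitrary coefficient type `R` and an arbitrary monad `m`; it
can reach coefficients only through the operations collected in `Arith m R`. Computations with
integer exponents, indices and list positions are free, as are copies and the constants `0`, `1`.
-/

/-- The operations on coefficients that an algorithm may perform. `polyMul n p q` multiplies two
polynomials of degree at most `n`, given by their lists of coefficients in increasing order. -/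
structure Arith (m : Type → Type) (R : Type) where
  zero : R
  one : R
  add : R → R → m R
  sub : R → R → m R
  mul : R → R → m R
  div : R → R → m R
  isZero : R → m Bool
  polyMul : ℕ → List R → List R → m (List R)

/-- A value together with the number of operations spent to obtain it. -/
structure Counted (α : Type) where
  val : α
  ops : ℕ

instance : Monad Counted where
  pure a := ⟨a, 0⟩
  bind x f := ⟨(f x.val).val, x.ops + (f x.val).ops⟩

/-- Arithmetic of the field `K`: additions, subtractions, multiplications, divisions and zero tests
cost one operation each, the product of two polynomials of degree at most `n` costs `M n`. -/
def fieldArith (K : Type) [Field K] [DecidableEq K] (M : ℕ → ℕ) : Arith Counted K where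
  zero := 0
  one := 1
  add x y := ⟨x + y, 1⟩
  sub x y := ⟨x - y, 1⟩
  mul x y := ⟨x * y, 1⟩
  div x y := ⟨x / y, 1⟩
  isZero x := ⟨decide (x = 0), 1⟩
  polyMul n p q :=
    ⟨(List.range (2 * n + 1)).map fun i =>
      ((List.range (i + 1)).map fun j =>
        (p.take (n + 1)).getD j 0 * (q.take (n + 1)).getD (i - j) 0).sum, M n⟩

/-- Assumptions on the cost `M` of polynomial multiplication: `n ↦ M n / n` is nondecreasing
on positive integers (written without division), and a product is not free. -/
def IsMulCost (M : ℕ → ℕ) : Prop :=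
  1 ≤ M 1 ∧ ∀ i j : ℕ, 1 ≤ i → i ≤ j → M i * j ≤ M j * i

/-! ## Linear Mahler operators given by dense coefficients

Throughout, `a k j` is the coefficient of `x ^ j` in `ℓ_k`, for `k ≤ r` and `j ≤ d`. -/

/-- Index, valuation and degree of a nonzero coefficient `ℓ_k` of the operator. -/
structure MahlerTerm where
  k : ℕ
  v : ℕ
  deg : ℕ

/-- A change of variables `x ^ j M ^ k ↦ x ^ (α b ^ k + β j - γ) M ^ k`. -/
structure ChangeVar where
  α : ℤ
  β : ℕ
  γ : ℤ

section Algorithms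

variable {m : Type → Type} [Monad m] {R : Type} (A : Arith m R)

/-- The nonzero coefficients `ℓ_k`, by increasing `k`, with their valuations and degrees. -/
def mahlerTerms (r d : ℕ) (a : ℕ → ℕ → R) : m (List MahlerTerm) := do
  let flags ← (List.range (r + 1)).mapM fun k =>
    (List.range (d + 1)).mapM fun j => A.isZero (a k j)
  pure <| (List.range (r + 1)).filterMap fun k =>
    let S := (List.range (d + 1)).filter fun j => !((flags.getD k []).getD j true)
    match S.head?, S.getLast? with
    | some v, some e => some ⟨k, v, e⟩
    | _, _ => none

/-! ### Lower Newton polygon -/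

/-- The `V`-intercept of the line of slope `s` through the point `(b ^ k, v_k)`. -/
def MahlerTerm.intercept (b : ℕ) (s : ℚ) (T : MahlerTerm) : ℚ := T.v - s * (b : ℚ) ^ T.k

/-- The edges of the lower Newton polygon, as pairs (slope, `V`-intercept): the lines through two
points `(b ^ k, v_k)` such that no point lies below. -/
def newtonEdges (b : ℕ) (ts : List MahlerTerm) : List (ℚ × ℚ) :=
  (ts.flatMap fun T₁ => ts.filterMap fun T₂ =>
    let s : ℚ := ((T₂.v : ℚ) - T₁.v) / ((b : ℚ) ^ T₂.k - (b : ℚ) ^ T₁.k)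
    if T₁.k < T₂.k ∧ ∀ T ∈ ts, T₁.intercept b s ≤ T.intercept b s then
      some (s, T₁.intercept b s) else none).dedup

/-- The first edge of a list whose monomials have coefficients that add up to zero. -/
def firstAdmissible (b : ℕ) (a : ℕ → ℕ → R) (ts : List MahlerTerm) :
    List (ℚ × ℚ) → m (Option (ℚ × ℚ))
  | [] => pure none
  | (s, c) :: es => do
    let t ← (ts.filter fun T => T.intercept b s = c).foldlM
      (fun acc T => A.add acc (a T.k T.v)) A.zero
    if ← A.isZero t then pure (some (s, c)) else firstAdmissible b a ts es

/-- Slope and intercept of the rightmost (that is, of greatest slope) admissible edge of the lower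
Newton polygon with slope in `N⁻¹ ℤ`. -/
def rightmostAdmissibleEdge (b N : ℕ) (a : ℕ → ℕ → R) (ts : List MahlerTerm) :
    m (Option (ℚ × ℚ)) :=
  firstAdmissible A b a ts
    (((newtonEdges b ts).filter fun e => ((N : ℚ) * e.1).den = 1).mergeSort
      fun e e' => decide (e'.1 ≤ e.1))

/-! ### Parameters of the transformed operator -/

/-- The valuation of the coefficient of `M ^ k` in the transformed operator. -/
def MahlerTerm.tval (b : ℕ) (φ : ChangeVar) (T : MahlerTerm) : ℤ :=
  φ.α * (b : ℤ) ^ T.k + φ.β * T.v - φ.γ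

/-- The valuation of the coefficient of `M ^ 0` in the transformed operator. -/
def tval₀ (b : ℕ) (φ : ChangeVar) (ts : List MahlerTerm) : ℤ :=
  (((ts.filter fun T => T.k = 0).map (MahlerTerm.tval b φ)).head?).getD 0

/-- `ν = max_{k ≥ 1} (v_0 - v_k) / (b ^ k - 1)` for the transformed operator. -/
def nuT (b : ℕ) (φ : ChangeVar) (ts : List MahlerTerm) : ℚ :=
  (((ts.filter fun T => 1 ≤ T.k).map fun T =>
    ((tval₀ b φ ts : ℚ) - T.tval b φ) / ((b : ℚ) ^ T.k - 1)).max?).getD 0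

/-- `μ = v_0 + ν` for the transformed operator. -/
def muT (b : ℕ) (φ : ChangeVar) (ts : List MahlerTerm) : ℚ := tval₀ b φ ts + nuT b φ ts

/-- `min_k (v_k + n b ^ k)` for the transformed operator. -/
def profileRow (b : ℕ) (φ : ChangeVar) (ts : List MahlerTerm) (n : ℕ) : ℤ :=
  ((ts.map fun T => T.tval b φ + n * (b : ℤ) ^ T.k).min?).getD 0

/-! ### Rows of the infinite matrix -/

/-- Adds `x` to the entry of index `c` of a sparse row. -/
def addEntry (c : ℕ) (x : R) : List (ℕ × R) → m (List (ℕ × R))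
  | [] => pure [(c, x)]
  | (c', y) :: t =>
    if c' = c then do
      let z ← A.add y x
      pure ((c, z) :: t)
    else do
      let t' ← addEntry c x t
      pure ((c', y) :: t')

/-- The entries of index `< w` of the row `i` of the infinite matrix of the transformed operator,
in sparse form. -/
def buildRow (b : ℕ) (a : ℕ → ℕ → R) (φ : ChangeVar) (ts : List MahlerTerm) (w : ℕ) (i : ℤ) :
    m (List (ℕ × R)) :=
  (ts.flatMap fun T =>
    let q : ℕ := b ^ T.k
    let B : ℤ := i + φ.γ - φ.α * q
    -- inverse of `β` times `B`, modulo `b ^ k`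
    let j₀ : ℕ := ((Nat.gcdA φ.β q * B) % (q : ℤ)).toNat
    (((List.range (T.deg / q + 1)).map fun u => j₀ + u * q).filter fun j : ℕ =>
      j ≤ T.deg ∧ (φ.β * j : ℤ) ≤ B ∧ B - q * w < φ.β * j).map fun j : ℕ =>
        (((B - φ.β * j) / q).toNat, a T.k j)).foldlM
    (fun row e => addEntry A e.1 e.2 row) []

/-- The entry of index `n` of a sparse row. -/
def entryAt (row : List (ℕ × R)) (n : ℕ) : R :=
  ((row.find? fun e => e.1 = n).map Prod.snd).getD A.zero

/-- The sum of `row_c * g_c` over `c < n`. -/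
def dotBelow (row : List (ℕ × R)) (n : ℕ) (g : List R) : m R :=
  (row.filter fun e => e.1 < n).foldlM (fun acc e => do
    let p ← A.mul e.2 (g.getD e.1 A.zero)
    A.add acc p) A.zero

/-! ### Dense linear algebra -/

/-- `u + v` for lists of the same length. -/
def addVec (u v : List R) : m (List R) :=
  (u.zip v).mapM fun e => A.add e.1 e.2

/-- `u - f v` for lists of the same length. -/
def subMulVec (u : List R) (f : R) (v : List R) : m (List R) :=
  (u.zip v).mapM fun e => do
    let p ← A.mul f e.2
    A.sub e.1 p

/-- `u + f v` for lists of the same length. -/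
def addMulVec (u : List R) (f : R) (v : List R) : m (List R) :=
  (u.zip v).mapM fun e => do
    let p ← A.mul f e.2
    A.add e.1 p

/-- Given vectors `g` paired with the values `t` on them of a linear form, a basis of the
subspace of their span where the form vanishes (`done` holds vectors already known to qualify). -/
def eliminate (done : List (List R)) : List (List R × R) → m (List (List R))
  | [] => pure done
  | (g, t) :: rest => do
    if ← A.isZero t then
      eliminate (done ++ [g]) rest
    else do
      let rest' ← rest.mapM fun e => do
        let f ← A.div e.2 t
        subMulVec A e.1 f g
      pure (done ++ rest')

/-- One step of forward substitution: from a basis `G` of the kernel of the leading `n × n` block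
of a lower triangular matrix to a basis of the kernel of the leading `(n + 1) × (n + 1)` block,
where `row` is the row of index `n`. -/
def kerStep (G : List (List R)) (n : ℕ) (row : List (ℕ × R)) : m (List (List R)) := do
  let δ := entryAt A row n
  let forms ← G.mapM fun g => dotBelow A row n g
  if ← A.isZero δ then do
    let G' ← eliminate A [] (G.zip forms)
    pure (G'.map (fun g => g ++ [A.zero]) ++ [List.replicate n A.zero ++ [A.one]])
  else
    (G.zip forms).mapM fun e => do
      let u ← A.sub A.zero e.2
      let y ← A.div u δ
      pure (e.1 ++ [y])

/-- A basis of the kernel of a lower triangular matrix given by its sparse rows. -/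
def kerLowerTriangular (rows : List (List (ℕ × R))) : m (List (List R)) :=
  (List.range rows.length).foldlM (fun G n => kerStep A G n (rows.getD n [])) []

/-- A basis of the linear relations between the vectors `S` (the kernel of the matrix with columns
`S`), read off an LSP decomposition of the matrix with rows `S`, computed row by row. Each row is
reduced by the previous pivot rows; `piv` holds the pivot rows with their pivot positions and
their expressions in terms of `S`, and `ker` the expressions of the rows that reduce to zero. -/
def lspKernel (S : List (List R)) : m (List (List R)) := do
  let res ← (List.range S.length).foldlM
    (fun (st : List (ℕ × List R × List R) × List (List R)) i => do
      let unit := (List.range S.length).map fun j => if j = i then A.one else A.zero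
      let rc ← st.1.foldlM (fun (rc : List R × List R) p => do
        let f ← A.div (rc.1.getD p.1 A.zero) (p.2.1.getD p.1 A.zero)
        let row ← subMulVec A rc.1 f p.2.1
        let comb ← subMulVec A rc.2 f p.2.2
        pure (row, comb)) (S.getD i [], unit)
      let flags ← rc.1.mapM A.isZero
      match flags.findIdx? (fun z => !z) with
      | none => pure (st.1, st.2 ++ [rc.2])
      | some c => pure (st.1 ++ [(c, rc.1, rc.2)], st.2))
    (([], []) : List (ℕ × List R × List R) × List (List R))
  pure res.2

/-! ### Truncated products -/

/-- `acc + x ^ o * p`, truncated to the length of `acc`. -/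
def addShifted (acc : List R) (o : ℕ) (p : List R) : m (List R) :=
  (List.range acc.length).mapM fun i =>
    if o ≤ i ∧ i - o < p.length then A.add (acc.getD i A.zero) (p.getD (i - o) A.zero)
    else pure (acc.getD i A.zero)

/-- The product `p q` modulo `x ^ h`, for lists `p`, `q` of length `h`, obtained by multiplying
blocks of degree at most `D`. -/
def mulTrunc (D h : ℕ) (p q : List R) : m (List R) :=
  let cnt := h / (D + 1) + 1
  let block : List R → ℕ → List R := fun l i => (l.drop (i * (D + 1))).take (D + 1)
  ((List.range cnt).flatMap fun i => (List.range cnt).map fun j => (i, j)).foldlM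
    (fun acc e => do
      let z ← A.polyMul D (block p e.1) (block q e.2)
      addShifted A acc ((e.1 + e.2) * (D + 1)) z)
    (List.replicate h A.zero)

/-- The coefficient of `M ^ k` in the transformed operator, modulo `x ^ h`. -/
def transformedCoeff (b : ℕ) (a : ℕ → ℕ → R) (φ : ChangeVar) (h : ℕ) (T : MahlerTerm) :
    List R :=
  (List.range h).map fun i =>
    let u : ℤ := i + φ.γ - φ.α * (b : ℤ) ^ T.k
    if (φ.β : ℤ) ∣ u ∧ 0 ≤ u ∧ u / φ.β ≤ T.deg then a T.k (u / φ.β).toNat else A.zero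

/-- `g (x ^ (b ^ k))` modulo `x ^ h`. -/
def mahlerSubst (b k h : ℕ) (g : List R) : List R :=
  (List.range h).map fun i => if b ^ k ∣ i then g.getD (i / b ^ k) A.zero else A.zero

/-- The image of the polynomial `g` under the transformed operator, modulo `x ^ h`. -/
def applyTransformed (b : ℕ) (a : ℕ → ℕ → R) (φ : ChangeVar) (ts : List MahlerTerm)
    (D h : ℕ) (g : List R) : m (List R) :=
  ts.foldlM (fun acc T => do
    let p ← mulTrunc A D h (transformedCoeff A b a φ h T) (mahlerSubst A b T.k h g)
    addVec A acc p) (List.replicate h A.zero)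

/-! ### The solvers -/

/-- Solutions over prescribed monomial support, lower triangular case: the polynomials of degree
`< w` that the transformed operator sends to `O (x ^ h)`. The list `E` (of length `w`) of row
indices selects a lower triangular submatrix, which provides candidate solutions. -/
def solvePrescribed (b : ℕ) (a : ℕ → ℕ → R) (φ : ChangeVar) (ts : List MahlerTerm)
    (D h w : ℕ) (E : List ℤ) : m (List (List R)) := do
  let rows ← E.mapM fun i => buildRow A b a φ ts w i
  let G ← kerLowerTriangular A rows
  let S ← G.mapM fun g => applyTransformed A b a φ ts D h g
  let Z ← lspKernel A S
  Z.mapM fun κ => (G.zip κ).foldlM (fun acc e => addMulVec A acc e.2 e.1)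
    (List.replicate w A.zero)

/-- Prolongs an approximate series solution `f` (of length `ν + 1`) of the transformed operator by
`n'` more terms, where `ν` and `μ` are the integer parts of the parameters of that operator. -/
def prolong (b : ℕ) (a : ℕ → ℕ → R) (φ : ChangeVar) (ts : List MahlerTerm)
    (ν : ℕ) (μ : ℤ) (n' : ℕ) (f : List R) : m (List R) := do
  let rows ← (List.range n').mapM fun i => buildRow A b a φ ts (ν + n' + 1) (μ + 1 + i)
  (List.range n').foldlM (fun y i => do
    let row := rows.getD i []
    let t ← dotBelow A row (ν + 1 + i) y
    let u ← A.sub A.zero t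
    let z ← A.div u (entryAt A row (ν + 1 + i))
    pure (y ++ [z])) f

/-- Solving a Mahler equation in `K((x ^ (1 / N)))` up to `O (x ^ (T / N))`. The result
`(α, [z₁, …, z_σ])` represents the truncated Puiseux series `∑ j, z_{i, j} x ^ ((α + j) / N)`. -/
def puiseuxSolve (b r d N T : ℕ) (a : ℕ → ℕ → R) : m (ℤ × List (List R)) := do
  let ts ← mahlerTerms A r d a
  match ← rightmostAdmissibleEdge A b N a ts with
  | none => pure (0, [])
  | some (s, c) => do
    let Ns : ℤ := ((N : ℚ) * s).num
    let φ : ChangeVar := ⟨-Ns, N, ((N : ℚ) * c).num⟩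
    let ν : ℕ := ⌊nuT b φ ts⌋.toNat
    let μ : ℤ := ⌊muT b φ ts⌋
    let F ← solvePrescribed A b a φ ts (N * d) (μ + 1).toNat (ν + 1)
      ((List.range (ν + 1)).map (profileRow b φ ts))
    -- index of the last coefficient to compute
    let last : ℤ := Ns + T - 1
    let Z ← F.mapM fun f => prolong A b a φ ts ν μ (last - ν).toNat f
    pure (-Ns, Z.map fun z => z.take (last + 1).toNat)

end Algorithms

/-! ## Puiseux series

Puiseux series are Hahn series with rational exponents, those of `K((x ^ (1 / N)))` being supported
in `N⁻¹ ℤ`. -/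

noncomputable section

/-- The field `K((x ^ (1 / N)))`, as a `K`-vector space. A well-ordered subset of `N⁻¹ ℤ` is
bounded below, so that its elements are Laurent series in `x ^ (1 / N)`. -/
def ramifiedSeries (K : Type) [Field K] (N : ℕ) : Submodule K (HahnSeries ℚ K) where
  carrier := {y | ∀ q : ℚ, y.coeff q ≠ 0 → ∃ i : ℤ, q = i / N}
  zero_mem' q hq := absurd HahnSeries.coeff_zero hq
  add_mem' {y z} hy hz q hq := by
    by_cases h : y.coeff q = 0
    · exact hz q fun h' => hq (by rw [HahnSeries.coeff_add, h, h', add_zero])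
    · exact hy q h
  smul_mem' c y hy q hq := hy q fun h => hq (by rw [HahnSeries.coeff_smul, h, smul_zero])

/-- The Mahler operator `y (x) ↦ y (x ^ b)`. -/
def mahlerMap (K : Type) [Field K] (b : ℕ) (hb : 2 ≤ b) : HahnSeries ℚ K →ₗ[K] HahnSeries ℚ K :=
  HahnSeries.embDomainLinearMap <| OrderEmbedding.ofStrictMono (fun q : ℚ => (b : ℚ) * q)
    fun _ _ h => mul_lt_mul_of_pos_left h (by exact_mod_cast (by omega : 0 < b))

/-- A polynomial in `x`, as a Puiseux series. -/
def polyToSeries {K : Type} [Field K] (p : K[X]) : HahnSeries ℚ K :=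
  p.eval₂ HahnSeries.C (HahnSeries.single (1 : ℚ) (1 : K))

/-- The Mahler operator `L = ℓ_r M ^ r + ⋯ + ℓ_0`, acting on Puiseux series. -/
def mahlerOperator {K : Type} [Field K] (b : ℕ) (hb : 2 ≤ b) (r : ℕ) (ℓ : ℕ → K[X]) :
    HahnSeries ℚ K →ₗ[K] HahnSeries ℚ K where
  toFun y := ∑ k ∈ Finset.range (r + 1), polyToSeries (ℓ k) * (mahlerMap K b hb ^ k) y
  map_add' y z := by simp only [map_add, mul_add, Finset.sum_add_distrib]
  map_smul' c y := by
    rw [RingHom.id_apply, Finset.smul_sum]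
    refine Finset.sum_congr rfl fun k _ => ?_
    rw [LinearMap.map_smul, ← HahnSeries.C_mul_eq_smul, ← HahnSeries.C_mul_eq_smul]
    exact mul_left_comm _ _ _

/-- The space of solutions of `L y = 0` in `K((x ^ (1 / N)))`. -/
def solutionSpace {K : Type} [Field K] (b : ℕ) (hb : 2 ≤ b) (r N : ℕ) (ℓ : ℕ → K[X]) :
    Submodule K (HahnSeries ℚ K) :=
  LinearMap.ker (mahlerOperator b hb r ℓ) ⊓ ramifiedSeries K N

/-- The finite Puiseux series `∑ j, z_j x ^ ((α + j) / N)`. -/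
def toPuiseux {K : Type} [Field K] (N : ℕ) (α : ℤ) (z : List K) : HahnSeries ℚ K :=
  ∑ j ∈ Finset.range z.length,
    HahnSeries.single (((α : ℚ) + j) / N) (z.getD j 0)

/-- `p` is the truncation of `y` to order `O (x ^ q)`. -/
def IsTruncation {K : Type} [Field K] (q : ℚ) (p y : HahnSeries ℚ K) : Prop :=
  ∀ i : ℚ, p.coeff i = if i < q then y.coeff i else 0

/-- The run of the algorithm on the equation with coefficients `ℓ_0, …, ℓ_r` of degree at
most `d`, with result and operation count. -/
def puiseuxRun {K : Type} [Field K] [DecidableEq K] (M : ℕ → ℕ) (b r d N T : ℕ) (ℓ : ℕ → K[X]) :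
    Counted (ℤ × List (List K)) :=
  puiseuxSolve (fieldArith K M) b r d N T fun k j => (ℓ k).coeff j

/-- The output `(α, [z₁, …, z_σ])` consists of the truncations to order `O (x ^ q)` of the elements
`y₁, …, y_σ` of a basis of `V`. -/
def IsTruncatedBasis {K : Type} [Field K] (N : ℕ) (q : ℚ) (V : Submodule K (HahnSeries ℚ K))
    (out : ℤ × List (List K)) : Prop :=
  ∃ B : Module.Basis (Fin out.2.length) K V,
    ∀ i, IsTruncation q (toPuiseux N out.1 (out.2.get i)) (B i : HahnSeries ℚ K)

end

/-!
# Solving linear Mahler equations in Puiseux series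

**Reduction to power series.** If `y ≠ 0` satisfies `L y = 0`, the terms of least exponent of the
`ℓ_k M ^ k y` cancel, which says that the valuation of `y` is the opposite of the slope of an
admissible edge of the lower Newton polygon (`exists_admissible_edge`). Hence, with `s` the slope
of the rightmost admissible edge, every solution is of the form `∑ n, z n x ^ (-s + n / N)`, and
there is none but `0` without such an edge. The change of variables moves the chosen edge to the
horizontal axis (`IsEdgeChange`), and `L y = 0` becomes the vanishing of all rows of an infinite
matrix `R` applied to `z` (`rmat`, `mahlerOperator_seqSeries_eq_zero_iff`).

**Reduction to finite linear algebra.** Let `v₀` be the valuation of the transformed coefficient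
of `M ^ 0`, let `w = ⌊ν⌋ + 1` and `h = v₀ + w`, where `ν` and `μ = v₀ + ν` are the parameters of
the transformed operator, so that `h = ⌊μ⌋ + 1`. For `n > ν` the coefficient of `M ^ 0` dominates:
column `n` of `R` starts in row `v₀ + n`, with a nonzero entry (`IsEdgeChange.lt_of_floor_lt`). So
the first `h` rows involve only the first `w` unknowns, and each later row determines one further
unknown. Therefore the solution space is the image, under prolongation by forward substitution, of
the space of vectors of length `w` annihilated by the first `h` rows (`solutionSpace_eq_map`).

The algorithm computes that space in two steps (`solvePrescribed_spec`). The rows `m_i`, in which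
the columns `i < w` start, form a lower triangular matrix, whose kernel is found by forward
substitution (`kerLowerTriangular_spec`). The other conditions are imposed by computing the first
`h` coefficients of the images of a basis of this kernel (`applyTransformed_spec`) and the linear
relations between them (`lspKernel_spec`, `recombine_spec`). Bases are treated as lists of
vectors, by `IsListBasis`, and coefficient lists as sequences, by `vec`.

**Number of operations.** An edge is determined by its left end, so there are at most `r + 1`
edges to test. A diagonal entry of the triangular matrix can vanish only if two monomials attain
the minimum `m_i`; then `-i` is the slope of an edge of the Newton polygon of the transformed
operator, so there are at most `r + 1` such entries (`IsEdgeChange.card_zero_diag_le`) and the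
kernel has dimension at most `r + 1`. A row of `R` has at most `2 d + r + 1` nonzero entries, by a
geometric sum (`length_buildRow_le`). Finally `ν ≤ 2 N d` and `μ ≤ 3 N d`
(`IsEdgeChange.floor_nuT_le`, `IsEdgeChange.floor_muT_le`), so a truncated product costs a bounded
number of multiplications in degree `N d`. Summing up gives the bound of `cost_bound`; for softly
linear multiplication each of its terms is at most `G = r ^ 2 N d (d + n)` times a power of
`log (G + 2)` (`soft_bound`).
-/

/-! ### Values and operation counts of monadic programs -/

namespace Counted

@[simp] theorem val_pure {α : Type} (a : α) : (pure a : Counted α).val = a := rfl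

@[simp] theorem ops_pure {α : Type} (a : α) : (pure a : Counted α).ops = 0 := rfl

@[simp] theorem val_bind {α β : Type} (x : Counted α) (f : α → Counted β) :
    (x >>= f).val = (f x.val).val := rfl

@[simp] theorem ops_bind {α β : Type} (x : Counted α) (f : α → Counted β) :
    (x >>= f).ops = x.ops + (f x.val).ops := rfl

instance : LawfulMonad Counted := LawfulMonad.mk'
  (id_map := fun x => by
    cases x; rfl)
  (pure_bind := fun a f => by
    change (⟨(f a).val, 0 + (f a).ops⟩ : Counted _) = f a
    rw [Nat.zero_add])
  (bind_assoc := fun x f g => by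
    change (⟨_, x.ops + (f x.val).ops + (g (f x.val).val).ops⟩ : Counted _) =
      ⟨_, x.ops + ((f x.val).ops + (g (f x.val).val).ops)⟩
    rw [Nat.add_assoc]
    rfl)

@[simp] theorem val_map {α β : Type} (f : α → β) (x : Counted α) : (f <$> x).val = f x.val := rfl

@[simp] theorem ops_map {α β : Type} (f : α → β) (x : Counted α) : (f <$> x).ops = x.ops := rfl

@[simp] theorem val_mapM {α β : Type} (f : α → Counted β) (l : List α) :
    (l.mapM f).val = l.map fun x => (f x).val := by
  induction l with
  | nil => rfl
  | cons x l ih => simp [ih]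

@[simp] theorem ops_mapM {α β : Type} (f : α → Counted β) (l : List α) :
    (l.mapM f).ops = (l.map fun x => (f x).ops).sum := by
  induction l with
  | nil => rfl
  | cons x l ih => simp [ih]

theorem ops_mapM_le {α β : Type} (f : α → Counted β) (l : List α) (c : ℕ)
    (h : ∀ x ∈ l, (f x).ops ≤ c) : (l.mapM f).ops ≤ l.length * c := by
  rw [ops_mapM]
  induction l with
  | nil => simp
  | cons x l ih =>
    have h1 := h x (by simp)
    have h2 := ih fun y hy => h y (by simp [hy])
    simp only [List.map_cons, List.sum_cons, List.length_cons]
    linarith [Nat.succ_mul l.length c]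

@[simp] theorem val_foldlM {α β : Type} (f : β → α → Counted β) (l : List α) (b : β) :
    (l.foldlM f b).val = l.foldl (fun acc x => (f acc x).val) b := by
  induction l generalizing b with
  | nil => rfl
  | cons x l ih => simp [ih]

/-- A loop whose body preserves `P` and costs at most `c` on states satisfying `P`. -/
theorem foldlM_spec {α β : Type} (f : β → α → Counted β) (l : List α) (b : β) (P : β → Prop)
    (c : ℕ) (hb : P b) (h : ∀ b, P b → ∀ x ∈ l, P (f b x).val ∧ (f b x).ops ≤ c) :
    P (l.foldlM f b).val ∧ (l.foldlM f b).ops ≤ l.length * c := by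
  induction l generalizing b with
  | nil => exact ⟨hb, Nat.zero_le _⟩
  | cons x l ih =>
    have h1 := h b hb x (by simp)
    have h2 := ih (f b x).val h1.1 fun b hb y hy => h b hb y (by simp [hy])
    rw [List.foldlM_cons]
    refine ⟨h2.1, ?_⟩
    rw [ops_bind, List.length_cons, Nat.succ_mul]
    linarith [h1.2, h2.2]

end Counted

/-! ### Coefficient lists as vectors -/

section Vec

variable {K : Type} [Field K]

/-- The sequence of entries of a list, continued by zeros. -/
def vec (g : List K) : ℕ → K := fun n => g.getD n 0

theorem vec_eq_zero_of_le {g : List K} {n : ℕ} (h : g.length ≤ n) : vec g n = 0 := by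
  simp [vec, List.getElem?_eq_none h]

@[simp] theorem vec_nil : vec ([] : List K) = 0 := by
  funext n; simp [vec]

@[simp] theorem vec_cons_zero (x : K) (g : List K) : vec (x :: g) 0 = x := rfl

@[simp] theorem vec_cons_succ (x : K) (g : List K) (n : ℕ) : vec (x :: g) (n + 1) = vec g n := by
  simp [vec]

@[simp] theorem vec_replicate_zero (n : ℕ) : vec (List.replicate n (0 : K)) = 0 := by
  funext i
  by_cases h : i < n <;> simp [vec, h]

theorem vec_map_range (f : ℕ → K) (h i : ℕ) :
    vec ((List.range h).map f) i = if i < h then f i else 0 := by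
  by_cases hi : i < h <;> simp [vec, hi]

theorem vec_append (g g' : List K) (i : ℕ) :
    vec (g ++ g') i = if i < g.length then vec g i else vec g' (i - g.length) := by
  by_cases hi : i < g.length
  · simp [vec, hi, List.getElem?_append_left hi]
  · simp [vec, hi, List.getElem?_append_right (not_lt.mp hi)]

theorem vec_append_singleton (g : List K) (y : K) (n : ℕ) (hg : g.length = n) :
    vec (g ++ [y]) = Function.update (vec g) n y := by
  funext i
  rw [vec_append, hg]
  rcases lt_trichotomy i n with h | h | h
  · rw [if_pos h, Function.update_of_ne h.ne]
  · subst h; simp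
  · rw [if_neg h.not_gt, Function.update_of_ne h.ne', vec_eq_zero_of_le, vec_eq_zero_of_le]
    · omega
    · rw [List.length_singleton]; omega

theorem vec_take (g : List K) (n i : ℕ) : vec (g.take n) i = if i < n then vec g i else 0 := by
  by_cases hi : i < n <;> simp [vec, hi]

theorem vec_drop (g : List K) (n i : ℕ) : vec (g.drop n) i = vec g (n + i) := by
  simp [vec]

theorem vec_zip_map₂ (F : K → K → K) (h0 : F 0 0 = 0) (u v : List K)
    (h : u.length = v.length) (i : ℕ) :
    vec ((u.zip v).map fun e => F e.1 e.2) i = F (vec u i) (vec v i) := by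
  induction u generalizing v i with
  | nil =>
    obtain rfl : v = [] := List.length_eq_zero_iff.mp h.symm
    simp [h0]
  | cons x u ih =>
    cases v with
    | nil => simp at h
    | cons y v =>
      cases i with
      | zero => simp
      | succ i => simpa using ih v (by simpa using h) i

end Vec

/-! ### Cost and value of the elementary operations -/

section FieldArith

variable {K : Type} [Field K] [DecidableEq K] (M : ℕ → ℕ)

@[simp] theorem fieldArith_zero : (fieldArith K M).zero = 0 := rfl
@[simp] theorem fieldArith_one : (fieldArith K M).one = 1 := rfl
@[simp] theorem val_add (x y : K) : ((fieldArith K M).add x y).val = x + y := rfl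
@[simp] theorem val_sub (x y : K) : ((fieldArith K M).sub x y).val = x - y := rfl
@[simp] theorem val_mul (x y : K) : ((fieldArith K M).mul x y).val = x * y := rfl
@[simp] theorem val_div (x y : K) : ((fieldArith K M).div x y).val = x / y := rfl
@[simp] theorem val_isZero (x : K) : ((fieldArith K M).isZero x).val = decide (x = 0) := rfl
@[simp] theorem ops_add (x y : K) : ((fieldArith K M).add x y).ops = 1 := rfl
@[simp] theorem ops_sub (x y : K) : ((fieldArith K M).sub x y).ops = 1 := rfl
@[simp] theorem ops_mul (x y : K) : ((fieldArith K M).mul x y).ops = 1 := rfl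
@[simp] theorem ops_div (x y : K) : ((fieldArith K M).div x y).ops = 1 := rfl
@[simp] theorem ops_isZero (x : K) : ((fieldArith K M).isZero x).ops = 1 := rfl
@[simp] theorem ops_polyMul (n : ℕ) (p q : List K) :
    ((fieldArith K M).polyMul n p q).ops = M n := rfl

@[simp] theorem length_addVec (u v : List K) (h : u.length = v.length) :
    (addVec (fieldArith K M) u v).val.length = u.length := by
  simp [addVec, h]

theorem vec_addVec (u v : List K) (h : u.length = v.length) :
    vec (addVec (fieldArith K M) u v).val = vec u + vec v := by
  funext i
  simpa [addVec] using vec_zip_map₂ (fun x y => x + y) (by simp) u v h i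

theorem vec_subMulVec (u v : List K) (f : K) (h : u.length = v.length) :
    vec (subMulVec (fieldArith K M) u f v).val = vec u - f • vec v := by
  funext i
  simpa [subMulVec] using vec_zip_map₂ (fun x y => x - f * y) (by simp) u v h i

theorem vec_addMulVec (u v : List K) (f : K) (h : u.length = v.length) :
    vec (addMulVec (fieldArith K M) u f v).val = vec u + f • vec v := by
  funext i
  simpa [addMulVec] using vec_zip_map₂ (fun x y => x + f * y) (by simp) u v h i

@[simp] theorem length_subMulVec (u v : List K) (f : K) :
    (subMulVec (fieldArith K M) u f v).val.length = min u.length v.length := by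
  simp [subMulVec]

@[simp] theorem length_addMulVec (u v : List K) (f : K) :
    (addMulVec (fieldArith K M) u f v).val.length = min u.length v.length := by
  simp [addMulVec]

theorem ops_addVec (u v : List K) :
    (addVec (fieldArith K M) u v).ops = min u.length v.length := by
  simp [addVec]

theorem ops_subMulVec (u v : List K) (f : K) :
    (subMulVec (fieldArith K M) u f v).ops = min u.length v.length * 2 := by
  simp [subMulVec]

theorem ops_addMulVec (u v : List K) (f : K) :
    (addMulVec (fieldArith K M) u f v).ops = min u.length v.length * 2 := by
  simp [addMulVec]

end FieldArith

/-! ### Bases given by lists of vectors -/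

section ListBasis

variable {K : Type} [Field K] {E F : Type} [AddCommGroup E] [Module K E] [AddCommGroup F]
  [Module K F]

/-- The linear combination `∑ i, c i • G[i]` of the vectors of a list; the values of `c` beyond the
length of `G` play no role. -/
def comb (c : ℕ → K) (G : List E) : E := ∑ i ∈ Finset.range G.length, c i • G.getD i 0

@[simp] theorem comb_nil (c : ℕ → K) : comb c ([] : List E) = 0 := rfl

theorem comb_cons (c : ℕ → K) (g : E) (G : List E) :
    comb c (g :: G) = c 0 • g + comb (fun i => c (i + 1)) G := by
  rw [comb, List.length_cons, Finset.sum_range_succ', add_comm]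
  rfl

theorem comb_append (c : ℕ → K) (G H : List E) :
    comb c (G ++ H) = comb c G + comb (fun i => c (G.length + i)) H := by
  induction G generalizing c with
  | nil => simp
  | cons g G ih =>
    rw [List.cons_append, comb_cons, ih, comb_cons, add_assoc, List.length_cons]
    simp only [add_assoc, add_comm 1]

theorem comb_congr {c c' : ℕ → K} (G : List E) (h : ∀ i < G.length, c i = c' i) :
    comb c G = comb c' G :=
  Finset.sum_congr rfl fun i hi => by rw [h i (Finset.mem_range.mp hi)]

theorem comb_map (f : E →ₗ[K] F) (c : ℕ → K) (G : List E) :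
    comb c (G.map f) = f (comb c G) := by
  induction G generalizing c with
  | nil => simp
  | cons g G ih => simp [comb_cons, ih]

theorem comb_eq_zero {c : ℕ → K} {G : List E} (h : ∀ i < G.length, c i = 0) : comb c G = 0 :=
  Finset.sum_eq_zero fun i hi => by rw [h i (Finset.mem_range.mp hi), zero_smul]

/-- Linear combinations of a list depend linearly on the coefficients. -/
def combHom (G : List E) : (ℕ → K) →ₗ[K] E where
  toFun c := comb c G
  map_add' c c' := by simp [comb, add_smul, Finset.sum_add_distrib]
  map_smul' x c := by simp [comb, mul_smul, Finset.smul_sum]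

theorem combHom_apply (G : List E) (c : ℕ → K) : combHom G c = comb c G := rfl

theorem exists_comb_append {G H : List E} {v : E} :
    (∃ c : ℕ → K, comb c (G ++ H) = v) ↔ ∃ a b : ℕ → K, comb a G + comb b H = v := by
  constructor
  · rintro ⟨c, rfl⟩
    exact ⟨c, fun i => c (G.length + i), (comb_append c G H).symm⟩
  · rintro ⟨a, b, rfl⟩
    refine ⟨fun i => if i < G.length then a i else b (i - G.length), ?_⟩
    rw [comb_append]
    congr 1
    · exact comb_congr G fun i hi => if_pos hi
    · simp

theorem exists_comb_cons {g : E} {G : List E} {v : E} :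
    (∃ c : ℕ → K, comb c (g :: G) = v) ↔ ∃ (x : K) (b : ℕ → K), x • g + comb b G = v := by
  constructor
  · rintro ⟨c, rfl⟩
    exact ⟨c 0, fun i => c (i + 1), (comb_cons c g G).symm⟩
  · rintro ⟨x, b, rfl⟩
    exact ⟨fun i => if i = 0 then x else b (i - 1), by simp [comb_cons]⟩

/-- Linear independence of a list of vectors (as a family). -/
def ListIndep (K : Type) [Field K] {E : Type} [AddCommGroup E] [Module K E] (G : List E) : Prop :=
  ∀ c : ℕ → K, comb c G = 0 → ∀ i < G.length, c i = 0

theorem listIndep_append {G H : List E} :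
    ListIndep K (G ++ H) ↔ ∀ a b : ℕ → K, comb a G + comb b H = 0 →
      (∀ i < G.length, a i = 0) ∧ ∀ i < H.length, b i = 0 := by
  constructor
  · intro h a b hab
    have key := h (fun i => if i < G.length then a i else b (i - G.length)) (by
      rw [comb_append, ← hab]
      congr 1
      · exact comb_congr G fun i hi => if_pos hi
      · simp)
    constructor
    · intro i hi
      simpa [hi] using key i (by rw [List.length_append]; omega)
    · intro i hi
      simpa using key (G.length + i) (by rw [List.length_append]; omega)
  · intro h c hc i hi
    rw [comb_append] at hc
    obtain ⟨h1, h2⟩ := h _ _ hc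
    rcases lt_or_ge i G.length with hl | hl
    · exact h1 i hl
    · have := h2 (i - G.length) (by rw [List.length_append] at hi; omega)
      rwa [Nat.add_sub_cancel' hl] at this

theorem listIndep_cons {g : E} {G : List E} :
    ListIndep K (g :: G) ↔ ∀ (x : K) (b : ℕ → K), x • g + comb b G = 0 →
      x = 0 ∧ ∀ i < G.length, b i = 0 := by
  have := listIndep_append (K := K) (G := [g]) (H := G)
  rw [List.singleton_append] at this
  rw [this]
  constructor
  · intro h x b hx
    have := h (fun _ => x) b (by simpa [comb_cons] using hx)
    exact ⟨this.1 0 (by simp), this.2⟩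
  · intro h a b hab
    have := h (a 0) b (by simpa [comb_cons] using hab)
    refine ⟨fun i hi => ?_, this.2⟩
    obtain rfl : i = 0 := by simpa using hi
    exact this.1

/-- The list `G` is a basis of the subspace `V`. -/
structure IsListBasis (G : List E) (V : Submodule K E) : Prop where
  indep : ListIndep K G
  mem_iff : ∀ v, v ∈ V ↔ ∃ c : ℕ → K, comb c G = v

theorem isListBasis_nil : IsListBasis ([] : List E) (⊥ : Submodule K E) :=
  ⟨fun _ _ i hi => absurd hi (by simp), fun v => by
    simp [eq_comm]⟩

/-- Adding to a basis of `V` a vector that spans a complement of `V` in `W`. -/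
theorem IsListBasis.insert {G H : List E} {V W : Submodule K E} (hb : IsListBasis (G ++ H) V)
    (u : E) (hu : u ∉ V) (hW : ∀ v, v ∈ W ↔ ∃ x : K, v - x • u ∈ V) :
    IsListBasis (G ++ u :: H) W := by
  have hm := fun v => (hb.mem_iff v).trans exists_comb_append
  refine ⟨listIndep_append.mpr fun a b hab => ?_, fun v => ?_⟩
  · rw [comb_cons] at hab
    have hx : b 0 = 0 := by
      by_contra hx
      refine hu ?_
      have h1 : comb a G + comb (fun i => b (i + 1)) H ∈ V := (hm _).mpr ⟨_, _, rfl⟩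
      have h2 : u = (-(b 0)⁻¹) • (comb a G + comb (fun i => b (i + 1)) H) := by
        have : comb a G + comb (fun i => b (i + 1)) H = -(b 0 • u) := by
          rw [eq_neg_iff_add_eq_zero, ← hab]; abel
        rw [this, smul_neg, neg_smul, neg_neg, smul_smul, inv_mul_cancel₀ hx, one_smul]
      rw [h2]
      exact V.smul_mem _ h1
    rw [hx, zero_smul, zero_add] at hab
    obtain ⟨h1, h2⟩ := listIndep_append.mp hb.indep _ _ hab
    refine ⟨h1, fun i hi => ?_⟩
    cases i with
    | zero => exact hx
    | succ i => exact h2 i (by simpa using hi)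
  · rw [hW, exists_comb_append]
    constructor
    · rintro ⟨x, hx⟩
      obtain ⟨a, b, h⟩ := (hm _).mp hx
      obtain ⟨b', hb'⟩ := (exists_comb_cons (K := K) (g := u) (G := H)).mpr ⟨x, b, rfl⟩
      refine ⟨a, b', ?_⟩
      rw [hb', ← add_assoc, add_right_comm, h, sub_add_cancel]
    · rintro ⟨a, b, rfl⟩
      refine ⟨b 0, (hm _).mpr ⟨a, fun i => b (i + 1), ?_⟩⟩
      rw [comb_cons]
      abel

/-- The image of a basis under a map that is injective on the subspace. -/
theorem IsListBasis.map {G : List E} {V : Submodule K E} (hb : IsListBasis G V) (f : E →ₗ[K] F)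
    (hf : ∀ v ∈ V, f v = 0 → v = 0) : IsListBasis (G.map f) (V.map f) := by
  refine ⟨fun c hc i hi => ?_, fun v => ?_⟩
  · rw [comb_map] at hc
    exact hb.indep c (hf _ ((hb.mem_iff _).mpr ⟨c, rfl⟩) hc) i (by simpa using hi)
  · simp only [Submodule.mem_map, hb.mem_iff, comb_map]
    constructor
    · rintro ⟨_, ⟨c, rfl⟩, rfl⟩
      exact ⟨c, rfl⟩
    · rintro ⟨c, rfl⟩
      exact ⟨_, ⟨c, rfl⟩, rfl⟩

theorem comb_eq_sum_fin (c : ℕ → K) (G : List E) :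
    comb c G = ∑ i : Fin G.length, c i • G.get i := by
  rw [comb, Finset.sum_range]
  exact Finset.sum_congr rfl fun i _ => by simp

/-- A basis in the sense of lists provides one in the sense of Mathlib. -/
theorem IsListBasis.exists_basis {G : List E} {V : Submodule K E} (hb : IsListBasis G V) :
    ∃ B : Module.Basis (Fin G.length) K V, ∀ i, (B i : E) = G.get i := by
  have hmem : ∀ i : Fin G.length, G.get i ∈ V := fun i => by
    refine (hb.mem_iff _).mpr ⟨fun j => if j = i then 1 else 0, ?_⟩
    rw [comb_eq_sum_fin, Finset.sum_eq_single i] <;> simp +contextual [Fin.val_inj]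
  let v : Fin G.length → V := fun i => ⟨G.get i, hmem i⟩
  have hext : ∀ f : Fin G.length → K,
      comb (fun j => if h : j < G.length then f ⟨j, h⟩ else 0) G = ∑ i, f i • G.get i := fun f => by
    rw [comb_eq_sum_fin]
    exact Finset.sum_congr rfl fun i _ => by simp
  have hli : LinearIndependent K v := Fintype.linearIndependent_iff.mpr fun f hf i => by
    have h1 : ∑ i, f i • G.get i = 0 := by simpa [v] using congrArg (Submodule.subtype V) hf
    have := hb.indep _ ((hext f).trans h1) i i.2
    simpa using this
  have hsp : ⊤ ≤ Submodule.span K (Set.range v) := by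
    rintro ⟨x, hx⟩ -
    obtain ⟨c, hc⟩ := (hb.mem_iff x).mp hx
    have : (⟨x, hx⟩ : V) = ∑ i : Fin G.length, c i • v i := by
      apply Subtype.ext
      simp [v, ← hc, comb_eq_sum_fin]
    rw [this]
    exact Submodule.sum_mem _ fun i _ =>
      Submodule.smul_mem _ _ (Submodule.subset_span ⟨i, rfl⟩)
  exact ⟨Module.Basis.mk hli hsp, fun i => by simp [v]⟩

end ListBasis

/-! ### Intersection of a span with a hyperplane -/

section Eliminate

variable {K : Type} [Field K] [DecidableEq K] (M : ℕ → ℕ)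

/-- Elimination turns a basis of `V` into a basis of `V ⊓ ker ψ`: the first vector `g` with
`ψ g ≠ 0` is subtracted from the later ones with the multiple that annihilates their values. -/
theorem eliminate_spec (n : ℕ) (ψ : (ℕ → K) →ₗ[K] K) (V : Submodule K (ℕ → K))
    (l : List (List K × K)) (done : List (List K))
    (hdone : ∀ g ∈ done, g.length = n ∧ ψ (vec g) = 0)
    (hl : ∀ e ∈ l, e.1.length = n ∧ e.2 = ψ (vec e.1))
    (hV : IsListBasis ((done ++ l.map Prod.fst).map vec) V) :
    (∀ g ∈ (eliminate (fieldArith K M) done l).val, g.length = n) ∧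
    IsListBasis ((eliminate (fieldArith K M) done l).val.map vec) (V ⊓ LinearMap.ker ψ) := by
  have hcomb : ∀ (done : List (List K)), (∀ g ∈ done, g.length = n ∧ ψ (vec g) = 0) →
      ∀ a, ψ (comb a (done.map vec)) = 0 := fun done hdone a => by
    rw [← comb_map]
    have : List.map ψ (done.map vec) = done.map fun _ => (0 : K) := by
      rw [List.map_map]
      exact List.map_congr_left fun g hg => (hdone g hg).2
    rw [this]
    refine Finset.sum_eq_zero fun i hi => ?_
    have hi' : i < done.length := by simpa using hi
    simp [hi']
  induction l generalizing done with
  | nil =>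
    simp only [List.map_nil, List.append_nil] at hV
    refine ⟨fun g hg => (hdone g hg).1, ?_⟩
    have : V ⊓ LinearMap.ker ψ = V := by
      refine inf_eq_left.mpr fun v hv => ?_
      obtain ⟨c, rfl⟩ := (hV.mem_iff v).mp hv
      exact hcomb done hdone c
    rw [this]
    exact hV
  | cons e l ih =>
    obtain ⟨g, t⟩ := e
    obtain ⟨hg, ht⟩ := hl (g, t) (by simp)
    simp only at hg ht
    by_cases h0 : t = 0
    · have hval : (eliminate (fieldArith K M) done ((g, t) :: l)).val =
          (eliminate (fieldArith K M) (done ++ [g]) l).val := by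
        simp [eliminate, h0]
      rw [hval]
      refine ih (done ++ [g]) ?_ (fun e he => hl e (by simp [he])) (by simpa using hV)
      intro x hx
      rcases List.mem_append.mp hx with hx | hx
      · exact hdone x hx
      · obtain rfl := List.mem_singleton.mp hx
        exact ⟨hg, by rw [← ht, h0]⟩
    · have hval : (eliminate (fieldArith K M) done ((g, t) :: l)).val =
          done ++ l.map fun e => (subMulVec (fieldArith K M) e.1 (e.2 / t) g).val := by
        simp [eliminate, h0]
      rw [hval]
      -- the reduced vectors are the images of the pairs `(v, ψ v)` under the linear map
      -- `(v, y) ↦ v - (y / t) g`, so that combinations of them can be computed on pairs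
      let p : List ((ℕ → K) × K) := l.map fun e => (vec e.1, e.2)
      let φ : ((ℕ → K) × K) →ₗ[K] (ℕ → K) :=
        LinearMap.fst K _ _ - ((t⁻¹ • LinearMap.snd K (ℕ → K) K).smulRight (vec g))
      have hφ : (l.map fun e => (subMulVec (fieldArith K M) e.1 (e.2 / t) g).val).map vec =
          p.map φ := by
        simp only [p, List.map_map]
        refine List.map_congr_left fun e he => ?_
        have := hl e (by simp [he])
        simp [φ, vec_subMulVec, this.1, hg, div_eq_inv_mul]
      have hfst : (l.map Prod.fst).map vec = p.map (LinearMap.fst K (ℕ → K) K) := by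
        simp [p, Function.comp_def]
      have hsnd : ∀ a : ℕ → K, (comb a p).2 = ψ (comb a p).1 := fun a => by
        have h1 : (comb a p).2 = comb a (p.map (LinearMap.snd K (ℕ → K) K)) := by
          rw [comb_map]; rfl
        have h2 : (comb a p).1 = comb a (p.map (LinearMap.fst K (ℕ → K) K)) := by
          rw [comb_map]; rfl
        rw [h1, h2, ← comb_map]
        congr 1
        simp only [p, List.map_map]
        exact List.map_congr_left fun e he => (hl e (by simp [he])).2
      have hlen : p.length = l.length := by simp [p]
      rw [List.map_append, List.map_cons, List.map_cons, hfst] at hV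
      refine ⟨fun x hx => ?_, ?_⟩
      · rcases List.mem_append.mp hx with hx | hx
        · exact (hdone x hx).1
        · obtain ⟨e, he, rfl⟩ := List.mem_map.mp hx
          simp [(hl e (by simp [he])).1, hg]
      rw [List.map_append, hφ]
      refine ⟨listIndep_append.mpr fun a b hab => ?_, fun v => ?_⟩
      · rw [comb_map] at hab
        obtain ⟨b', hb'⟩ : ∃ b', b' = fun i => if i = 0 then -(t⁻¹ * (comb b p).2) else b (i - 1) :=
          ⟨_, rfl⟩
        have := listIndep_append.mp hV.indep a b' (by
          rw [comb_cons, comb_map, ← hab, hb']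
          simp [φ]
          abel)
        refine ⟨this.1, fun i hi => ?_⟩
        have := this.2 (i + 1) (by simpa using hi)
        simpa [hb'] using this
      · rw [exists_comb_append, Submodule.mem_inf, hV.mem_iff, exists_comb_append]
        constructor
        · rintro ⟨⟨a, b, rfl⟩, hv⟩
          refine ⟨a, fun i => b (i + 1), ?_⟩
          rw [LinearMap.mem_ker, map_add, hcomb done hdone, zero_add, comb_cons, comb_map, map_add,
            map_smul, ← ht, LinearMap.fst_apply, ← hsnd] at hv
          rw [comb_map, comb_cons, comb_map]
          have : b 0 = -(t⁻¹ * (comb (fun i => b (i + 1)) p).2) := by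
            rw [eq_neg_iff_add_eq_zero]
            field_simp
            simpa [mul_comm] using hv
          rw [this]
          simp [φ]
          abel
        · rintro ⟨a, b, rfl⟩
          refine ⟨?_, ?_⟩
          · obtain ⟨b', hb'⟩ := (exists_comb_cons (g := vec g)
              (G := p.map (LinearMap.fst K (ℕ → K) K))).mpr
              ⟨-(t⁻¹ * (comb b p).2), b, rfl⟩
            refine ⟨a, b', ?_⟩
            rw [hb', comb_map, comb_map]
            simp [φ]
            abel
          · rw [LinearMap.mem_ker, map_add, hcomb done hdone, zero_add, comb_map]
            simp [φ, hsnd, ← ht]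
            field_simp
            simp

theorem length_eliminate_le (l : List (List K × K)) (done : List (List K)) :
    (eliminate (fieldArith K M) done l).val.length ≤ done.length + l.length := by
  induction l generalizing done with
  | nil => simp [eliminate]
  | cons e l ih =>
    obtain ⟨g, t⟩ := e
    by_cases h0 : t = 0
    · have := ih (done ++ [g])
      simp [eliminate, h0] at this ⊢
      omega
    · simp [eliminate, h0]

theorem ops_eliminate_le (n : ℕ) (l : List (List K × K)) (done : List (List K))
    (hl : ∀ e ∈ l, e.1.length = n) :
    (eliminate (fieldArith K M) done l).ops ≤ l.length * (2 * n + 2) := by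
  induction l generalizing done with
  | nil => simp [eliminate]
  | cons e l ih =>
    obtain ⟨g, t⟩ := e
    have hl' : ∀ e ∈ l, e.1.length = n := fun e he => hl e (by simp [he])
    by_cases h0 : t = 0
    · have := ih (done ++ [g]) hl'
      simp [eliminate, h0, Nat.succ_mul] at this ⊢
      omega
    · have h1 := Counted.ops_mapM_le (fun e : List K × K => (fieldArith K M).div e.2 t >>= fun f =>
        subMulVec (fieldArith K M) e.1 f g) l (2 * n + 1) (fun e he => by
          rw [Counted.ops_bind, ops_subMulVec, hl' e he]
          have := min_le_left n g.length
          simp only [ops_div]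
          omega)
      have h2 : (eliminate (fieldArith K M) done ((g, t) :: l)).ops =
          1 + ((l.mapM fun e : List K × K => (fieldArith K M).div e.2 t >>= fun f =>
            subMulVec (fieldArith K M) e.1 f g).ops + 0) := by
        simp [eliminate, h0]
      rw [h2, List.length_cons]
      nlinarith

end Eliminate

/-! ### Kernels of lower triangular matrices -/

section Kernel

variable {K : Type} [Field K] [DecidableEq K] (M : ℕ → ℕ)

/-- The sparse row `row` represents the vector `ρ` of length `w`: its indices are distinct, and it
defines the same linear form. -/
structure RepresentsRow (w : ℕ) (row : List (ℕ × K)) (ρ : ℕ → K) : Prop where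
  nodup : (row.map Prod.fst).Nodup
  sum_eq : ∀ f : ℕ → K, (row.map fun e => e.2 * f e.1).sum = ∑ j ∈ Finset.range w, ρ j * f j

theorem entryAt_eq_sum {row : List (ℕ × K)} (h : (row.map Prod.fst).Nodup) (n : ℕ) :
    entryAt (fieldArith K M) row n = (row.map fun e => e.2 * if e.1 = n then 1 else 0).sum := by
  induction row with
  | nil => rfl
  | cons e row ih =>
    rw [List.map_cons, List.nodup_cons] at h
    rw [List.map_cons, List.sum_cons, ← ih h.2]
    by_cases he : e.1 = n
    · have : row.find? (fun e => decide (e.1 = n)) = none := by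
        refine List.find?_eq_none.mpr fun x hx hxn => h.1 ?_
        rw [he, ← of_decide_eq_true hxn]
        exact List.mem_map_of_mem hx
      simp [entryAt, he, this]
    · simp [entryAt, he]

theorem RepresentsRow.entryAt_eq {w : ℕ} {row : List (ℕ × K)} {ρ : ℕ → K}
    (h : RepresentsRow w row ρ) {n : ℕ} (hn : n < w) : entryAt (fieldArith K M) row n = ρ n := by
  rw [entryAt_eq_sum M h.nodup, h.sum_eq fun j => if j = n then 1 else 0]
  simp [hn]

theorem val_dotBelow (row : List (ℕ × K)) (n : ℕ) (g : List K) :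
    (dotBelow (fieldArith K M) row n g).val =
      (row.map fun e => e.2 * if e.1 < n then vec g e.1 else 0).sum := by
  have key : ∀ (l : List (ℕ × K)) (x : K),
      (l.foldl (fun acc e => acc + e.2 * g.getD e.1 0) x) =
        x + (l.map fun e => e.2 * vec g e.1).sum := by
    intro l
    induction l with
    | nil => simp
    | cons e l ih =>
      intro x
      rw [List.foldl_cons, ih, List.map_cons, List.sum_cons, add_assoc]
      rfl
  have h1 : (dotBelow (fieldArith K M) row n g).val =
      ((row.filter fun e => e.1 < n).foldl (fun acc e => acc + e.2 * g.getD e.1 0) 0) := by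
    simp [dotBelow]
  rw [h1, key, zero_add]
  clear h1
  induction row with
  | nil => rfl
  | cons e row ih =>
    by_cases he : e.1 < n <;> simp [he, ih]

theorem RepresentsRow.val_dotBelow {w : ℕ} {row : List (ℕ × K)} {ρ : ℕ → K}
    (h : RepresentsRow w row ρ) {n : ℕ} (hn : n ≤ w) (g : List K) :
    (dotBelow (fieldArith K M) row n g).val = ∑ j ∈ Finset.range n, ρ j * vec g j := by
  rw [_root_.val_dotBelow, h.sum_eq fun j => if j < n then vec g j else 0]
  rw [← Finset.sum_subset (Finset.range_mono hn)]
  · exact Finset.sum_congr rfl fun j hj => by rw [if_pos (Finset.mem_range.mp hj)]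
  · intro j _ hj
    rw [if_neg (by simpa using hj), mul_zero]

theorem ops_dotBelow_le (row : List (ℕ × K)) (n : ℕ) (g : List K) :
    (dotBelow (fieldArith K M) row n g).ops ≤ row.length * 2 := by
  refine ((Counted.foldlM_spec _ _ _ (fun _ => True) 2 trivial
    fun _ _ _ _ => ⟨trivial, ?_⟩).2).trans (Nat.mul_le_mul_right _ (List.length_filter_le _ _))
  simp

/-- The linear form `f ↦ ∑_{j < n} ρ j * f j`. -/
def rowForm (ρ : ℕ → K) (n : ℕ) : (ℕ → K) →ₗ[K] K where
  toFun f := ∑ j ∈ Finset.range n, ρ j * f j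
  map_add' f g := by simp [mul_add, Finset.sum_add_distrib]
  map_smul' x f := by simp [Finset.mul_sum, mul_left_comm]

omit [DecidableEq K] in
theorem rowForm_apply (ρ : ℕ → K) (n : ℕ) (f : ℕ → K) :
    rowForm ρ n f = ∑ j ∈ Finset.range n, ρ j * f j := rfl

/-- The vectors of length `w`, as sequences that vanish from index `w` on. -/
def supportedBelow (K : Type) [Field K] (w : ℕ) : Submodule K (ℕ → K) where
  carrier := {f | ∀ i, w ≤ i → f i = 0}
  zero_mem' _ _ := rfl
  add_mem' hf hg i hi := by simp [hf i hi, hg i hi]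
  smul_mem' c f hf i hi := by simp [hf i hi]

omit [DecidableEq K] in
theorem mem_supportedBelow {w : ℕ} {f : ℕ → K} :
    f ∈ supportedBelow K w ↔ ∀ i, w ≤ i → f i = 0 := Iff.rfl

omit [DecidableEq K] in
/-- The kernel of the leading `n × n` block of the infinite matrix `ρ`. -/
def blockKernel (ρ : ℕ → ℕ → K) (n : ℕ) : Submodule K (ℕ → K) :=
  supportedBelow K n ⊓ ⨅ i : Fin n, LinearMap.ker (rowForm (ρ i) n)

omit [DecidableEq K] in
theorem mem_blockKernel {ρ : ℕ → ℕ → K} {n : ℕ} {f : ℕ → K} :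
    f ∈ blockKernel ρ n ↔ (∀ i, n ≤ i → f i = 0) ∧ ∀ i < n, rowForm (ρ i) n f = 0 := by
  simp [blockKernel, mem_supportedBelow, Fin.forall_iff]

omit [DecidableEq K] in
/-- Truncation of a sequence to its terms of index different from `n` preserves the equations of
index below `n` of a lower triangular matrix. -/
theorem mem_blockKernel_succ {ρ : ℕ → ℕ → K} (hρ : ∀ i j, i < j → ρ i j = 0) {n : ℕ}
    {f : ℕ → K} : f ∈ blockKernel ρ (n + 1) ↔
      Function.update f n 0 ∈ blockKernel ρ n ∧ rowForm (ρ n) n f + ρ n n * f n = 0 := by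
  have hlow : ∀ i, i < n → rowForm (ρ i) (n + 1) f = rowForm (ρ i) n (Function.update f n 0) := by
    intro i hi
    rw [rowForm_apply, rowForm_apply, Finset.sum_range_succ, hρ i n hi, zero_mul, add_zero]
    refine Finset.sum_congr rfl fun j hj => ?_
    rw [Function.update_of_ne (Finset.mem_range.mp hj).ne]
  have hlast : rowForm (ρ n) (n + 1) f = rowForm (ρ n) n f + ρ n n * f n := by
    rw [rowForm_apply, rowForm_apply, Finset.sum_range_succ]
  rw [mem_blockKernel, mem_blockKernel, ← hlast]
  constructor
  · rintro ⟨h1, h2⟩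
    refine ⟨⟨fun i hi => ?_, fun i hi => ?_⟩, h2 n (Nat.lt_succ_self n)⟩
    · rcases hi.eq_or_lt with rfl | hi
      · simp
      · rw [Function.update_of_ne hi.ne', h1 i hi]
    · rw [← hlow i hi, h2 i (hi.trans (Nat.lt_succ_self n))]
  · rintro ⟨⟨h1, h2⟩, h3⟩
    refine ⟨fun i hi => ?_, fun i hi => ?_⟩
    · have := h1 i (Nat.le_of_succ_le hi)
      rwa [Function.update_of_ne (by omega)] at this
    · rcases Nat.lt_succ_iff_lt_or_eq.mp hi with hi | rfl
      · rw [hlow i hi, h2 i hi]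
      · exact h3

/-- One step of forward substitution extends the kernel of the leading block by one row and one
column. If the diagonal entry is nonzero, the new row determines the new unknown; if it is zero, the
new unknown is free and the new row cuts out a hyperplane in the old kernel. -/
theorem kerStep_spec {ρ : ℕ → ℕ → K} (hρ : ∀ i j, i < j → ρ i j = 0) {w n : ℕ} (hn : n < w)
    {row : List (ℕ × K)} (hrow : RepresentsRow w row (ρ n)) {G : List (List K)}
    (hlen : ∀ g ∈ G, g.length = n) (hG : IsListBasis (G.map vec) (blockKernel ρ n)) :
    (∀ g ∈ (kerStep (fieldArith K M) G n row).val, g.length = n + 1) ∧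
    IsListBasis ((kerStep (fieldArith K M) G n row).val.map vec) (blockKernel ρ (n + 1)) := by
  have hform : ∀ g, (dotBelow (fieldArith K M) row n g).val = rowForm (ρ n) n (vec g) :=
    fun g => hrow.val_dotBelow M hn.le g
  have hzip : ∀ f : List K → K, G.zip (G.map f) = G.map fun g => (g, f g) := fun f => by
    clear hlen hG
    induction G with
    | nil => rfl
    | cons g G ih => rw [List.map_cons, List.zip_cons_cons, ih, List.map_cons]
  have hupd : ∀ f : ℕ → K, rowForm (ρ n) n (Function.update f n 0) = rowForm (ρ n) n f := by
    intro f
    rw [rowForm_apply, rowForm_apply]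
    refine Finset.sum_congr rfl fun j hj => ?_
    rw [Function.update_of_ne (Finset.mem_range.mp hj).ne]
  by_cases h0 : ρ n n = 0
  · -- the last unknown is free and the last equation constrains the others
    have hval : (kerStep (fieldArith K M) G n row).val =
        (eliminate (fieldArith K M) [] (G.map fun g => (g, rowForm (ρ n) n (vec g)))).val.map
          (fun g => g ++ [0]) ++ [List.replicate n 0 ++ [1]] := by
      simp [kerStep, hrow.entryAt_eq M hn, h0, hform, hzip]
    have hel := eliminate_spec M n (rowForm (ρ n) n) (blockKernel ρ n)
      (G.map fun g => (g, rowForm (ρ n) n (vec g))) [] (by simp) (by simpa using hlen)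
      (by simpa [Function.comp_def] using hG)
    rw [hval]
    obtain ⟨hl', hb'⟩ := hel
    set G' := (eliminate (fieldArith K M) [] (G.map fun g => (g, rowForm (ρ n) n (vec g)))).val
    refine ⟨fun g hg => ?_, ?_⟩
    · rcases List.mem_append.mp hg with hg | hg
      · obtain ⟨g', hg', rfl⟩ := List.mem_map.mp hg
        simp [hl' g' hg']
      · obtain rfl := List.mem_singleton.mp hg
        simp
    · have hvec : (G'.map fun g => g ++ [0]).map vec = G'.map vec := by
        rw [List.map_map]
        refine List.map_congr_left fun g hg => ?_
        rw [Function.comp_apply, vec_append_singleton _ _ _ (hl' g hg)]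
        rw [← vec_eq_zero_of_le (hl' g hg).le, Function.update_eq_self]
      have hunit : vec (List.replicate n (0 : K) ++ [1]) = Pi.single n 1 := by
        rw [vec_append_singleton _ _ n (by simp), vec_replicate_zero]
        rfl
      rw [List.map_append, hvec, List.map_singleton, hunit]
      rw [← List.append_nil (G'.map vec)] at hb'
      refine hb'.insert _ ?_ fun v => ?_
      · intro hmem
        have := (mem_blockKernel.mp hmem.1).1 n le_rfl
        simp at this
      · rw [mem_blockKernel_succ hρ, h0, zero_mul, add_zero, ← hupd]
        constructor
        · rintro ⟨h1, h2⟩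
          refine ⟨v n, ?_⟩
          have : v - v n • Pi.single n 1 = Function.update v n 0 := by
            funext i
            by_cases hi : i = n
            · subst hi; simp
            · simp [hi]
          rw [this]
          exact ⟨h1, h2⟩
        · rintro ⟨x, h1, h2⟩
          have h3 := (mem_blockKernel.mp h1).1 n le_rfl
          have : v - x • Pi.single n 1 = Function.update v n 0 := by
            funext i
            by_cases hi : i = n
            · subst hi; simpa using h3
            · simp [hi]
          rw [this] at h1 h2
          exact ⟨h1, h2⟩
  · -- the last equation determines the last unknown
    have hval : (kerStep (fieldArith K M) G n row).val =
        G.map fun g => g ++ [(0 - rowForm (ρ n) n (vec g)) / ρ n n] := by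
      simp [kerStep, hrow.entryAt_eq M hn, h0, hform, hzip, Function.comp_def]
    rw [hval]
    refine ⟨fun g hg => ?_, ?_⟩
    · obtain ⟨g', hg', rfl⟩ := List.mem_map.mp hg
      simp [hlen g' hg']
    · let φ : (ℕ → K) →ₗ[K] (ℕ → K) := LinearMap.id -
        ((ρ n n)⁻¹ • rowForm (ρ n) n).smulRight (Pi.single n (1 : K))
      have hφ : ∀ f, f n = 0 → φ f = Function.update f n (-(rowForm (ρ n) n f) / ρ n n) := by
        intro f hf
        funext i
        by_cases hi : i = n
        · subst hi; simp [φ, hf]; field_simp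
        · simp [φ, hi]
      have hvec : (G.map fun g => g ++ [(0 - rowForm (ρ n) n (vec g)) / ρ n n]).map vec =
          (G.map vec).map φ := by
        rw [List.map_map, List.map_map]
        refine List.map_congr_left fun g hg => ?_
        rw [Function.comp_apply, Function.comp_apply, vec_append_singleton _ _ _ (hlen g hg),
          hφ _ (vec_eq_zero_of_le (hlen g hg).le), zero_sub]
      rw [hvec]
      have himg : (blockKernel ρ n).map φ = blockKernel ρ (n + 1) := by
        ext v
        rw [mem_blockKernel_succ hρ, Submodule.mem_map]
        constructor
        · rintro ⟨f, hf, rfl⟩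
          have hfn := (mem_blockKernel.mp hf).1 n le_rfl
          rw [hφ f hfn]
          have h2 : Function.update f n 0 = f := by rw [← hfn, Function.update_eq_self]
          refine ⟨by simpa [h2] using hf, ?_⟩
          rw [← hupd, Function.update_idem, h2, Function.update_self]
          field_simp
          ring
        · rintro ⟨h1, h2⟩
          refine ⟨_, h1, ?_⟩
          rw [hφ _ (by simp), hupd]
          have : -(rowForm (ρ n) n v) / ρ n n = v n := by
            field_simp
            linear_combination -h2
          rw [this, Function.update_idem, Function.update_eq_self]
      rw [← himg]
      refine hG.map φ fun v hv h => ?_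
      have hvn := (mem_blockKernel.mp hv).1 n le_rfl
      rw [hφ v hvn] at h
      funext i
      by_cases hi : i = n
      · rw [hi, hvn]; rfl
      · simpa [hi] using congrFun h i

/-- Cost of a step of forward substitution, and number of vectors it returns: a zero on the diagonal
adds at most one vector and entails an elimination. -/
theorem ops_kerStep_le {n s : ℕ} {row : List (ℕ × K)} (hs : row.length ≤ s) {G : List (List K)}
    (hlen : ∀ g ∈ G, g.length = n) :
    if entryAt (fieldArith K M) row n = 0 then
      (kerStep (fieldArith K M) G n row).val.length ≤ G.length + 1 ∧
        (kerStep (fieldArith K M) G n row).ops ≤ G.length * (2 * s + 2) + 1 + G.length * (2 * n)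
    else
      (kerStep (fieldArith K M) G n row).val.length = G.length ∧
        (kerStep (fieldArith K M) G n row).ops ≤ G.length * (2 * s + 2) + 1 := by
  have h1 := Counted.ops_mapM_le (fun g => dotBelow (fieldArith K M) row n g) G (2 * s)
    fun g _ => (ops_dotBelow_le M row n g).trans (by omega)
  have hz : (G.zip (G.map fun g => (dotBelow (fieldArith K M) row n g).val)).length =
    G.length := by simp
  have hmem : ∀ e ∈ G.zip (G.map fun g => (dotBelow (fieldArith K M) row n g).val),
      e.1.length = n := fun e he => hlen _ (List.of_mem_zip he).1
  split_ifs with h0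
  · have h2 := length_eliminate_le M
      (G.zip (G.map fun g => (dotBelow (fieldArith K M) row n g).val)) []
    have h3 := ops_eliminate_le M n
      (G.zip (G.map fun g => (dotBelow (fieldArith K M) row n g).val)) [] hmem
    rw [hz] at h2 h3
    constructor
    · simp [kerStep, h0] at h2 ⊢
      exact h2
    · simp [kerStep, h0] at h1 h3 ⊢
      nlinarith
  · constructor
    · simp [kerStep, h0]
    · have h4 := Counted.ops_mapM_le (fun e : List K × K =>
        (fieldArith K M).sub (fieldArith K M).zero e.2 >>= fun u =>
          (fieldArith K M).div u (entryAt (fieldArith K M) row n) >>= fun y =>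
            pure (e.1 ++ [y])) (G.zip (G.map fun g => (dotBelow (fieldArith K M) row n g).val)) 2
        (fun e _ => by simp)
      rw [hz] at h4
      simp only [kerStep, h0, Counted.ops_bind, val_isZero, Counted.val_mapM,
        ops_isZero, decide_false, Bool.false_eq_true, if_false]
      nlinarith

/-- Value and cost of the computation of the kernel of a lower triangular matrix with at most `s`
entries per row, in terms of the number of zeros on the diagonal. -/
theorem kerLowerTriangular_spec {ρ : ℕ → ℕ → K} (hρ : ∀ i j, i < j → ρ i j = 0) {w : ℕ}
    {rows : List (List (ℕ × K))} (hw : rows.length = w)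
    (hrows : ∀ i < w, RepresentsRow w (rows.getD i []) (ρ i)) :
    (∀ g ∈ (kerLowerTriangular (fieldArith K M) rows).val, g.length = w) ∧
    IsListBasis ((kerLowerTriangular (fieldArith K M) rows).val.map vec) (blockKernel ρ w) ∧
    ∀ s z : ℕ, (∀ i < w, (rows.getD i []).length ≤ s) →
      ((Finset.range w).filter fun i => ρ i i = 0).card ≤ z →
      (kerLowerTriangular (fieldArith K M) rows).val.length ≤ z ∧
      (kerLowerTriangular (fieldArith K M) rows).val.length ≤ w ∧
      (kerLowerTriangular (fieldArith K M) rows).ops ≤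
        w * (z * (2 * s + 2) + 1) + z * (z * (2 * w)) := by
  -- the state after `n` steps
  let st : ℕ → Counted (List (List K)) := fun n =>
    (List.range n).foldlM (fun G n => kerStep (fieldArith K M) G n (rows.getD n [])) []
  have hst : kerLowerTriangular (fieldArith K M) rows = st w := by rw [← hw]; rfl
  have hsucc : ∀ n, (st (n + 1)).val = (kerStep (fieldArith K M) (st n).val n
      (rows.getD n [])).val ∧ (st (n + 1)).ops = (st n).ops +
        (kerStep (fieldArith K M) (st n).val n (rows.getD n [])).ops := fun n => by
    simp [st, List.range_succ, List.foldlM_append]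
  have hval : ∀ n ≤ w, (∀ g ∈ (st n).val, g.length = n) ∧
      IsListBasis ((st n).val.map vec) (blockKernel ρ n) := by
    intro n
    induction n with
    | zero =>
      intro _
      refine ⟨by simp [st], ?_⟩
      have : blockKernel ρ 0 = ⊥ := by
        rw [eq_bot_iff]
        intro f hf
        exact funext fun i => (mem_blockKernel.mp hf).1 i (Nat.zero_le i)
      rw [this]
      exact isListBasis_nil
    | succ n ih =>
      intro hn
      obtain ⟨h1, h2⟩ := ih (Nat.le_of_succ_le hn)
      rw [(hsucc n).1]
      exact kerStep_spec M hρ hn (hrows n hn) h1 h2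
  rw [hst]
  refine ⟨(hval w le_rfl).1, (hval w le_rfl).2, fun s z hs hz => ?_⟩
  -- eliminations, which cost `2 n` operations per vector, happen only at the zeros of the diagonal
  let cnt : ℕ → ℕ := fun n => ((Finset.range n).filter fun i => ρ i i = 0).card
  have hcnt : ∀ n, cnt (n + 1) = cnt n + if ρ n n = 0 then 1 else 0 := fun n => by
    simp only [cnt, Finset.range_add_one, Finset.filter_insert]
    split_ifs
    · rw [Finset.card_insert_of_notMem (by simp)]
    · rfl
  have hmono : ∀ n ≤ w, cnt n ≤ z := fun n hn =>
    (Finset.card_le_card (Finset.filter_subset_filter _ (Finset.range_mono hn))).trans hz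
  have hops : ∀ n ≤ w, (st n).val.length ≤ cnt n ∧
      (st n).ops ≤ n * (z * (2 * s + 2) + 1) + cnt n * (z * (2 * w)) := by
    intro n
    induction n with
    | zero => intro _; simp [st]
    | succ n ih =>
      intro hn
      obtain ⟨h1, h2⟩ := ih (Nat.le_of_succ_le hn)
      have h3 := ops_kerStep_le M (hs n hn) (hval n (Nat.le_of_succ_le hn)).1
      have hG := h1.trans (hmono n (Nat.le_of_succ_le hn))
      rw [(hsucc n).1, (hsucc n).2, hcnt n]
      rw [(hrows n hn).entryAt_eq M hn] at h3
      have h5 : (st n).val.length * (2 * s + 2) ≤ z * (2 * s + 2) := Nat.mul_le_mul_right _ hG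
      split_ifs at h3 ⊢ with h0
      · have h4 : (st n).val.length * (2 * n) ≤ z * (2 * w) :=
          Nat.mul_le_mul hG (by omega)
        refine ⟨h3.1.trans (by omega), ?_⟩
        rw [Nat.succ_mul n, Nat.succ_mul (cnt n)]
        omega
      · refine ⟨h3.1.le.trans (by omega), ?_⟩
        rw [Nat.succ_mul n]
        simp only [add_zero]
        omega
  obtain ⟨h1, h2⟩ := hops w le_rfl
  refine ⟨h1.trans (hmono w le_rfl), h1.trans ?_, h2.trans ?_⟩
  · exact (Finset.card_filter_le _ _).trans (by simp)
  · exact Nat.add_le_add_left (Nat.mul_le_mul_right _ (hmono w le_rfl)) _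

end Kernel

/-! ### Linear relations from an LSP decomposition -/

section Relations

variable {K : Type} [Field K]

/-- If the images under `Φ` of the vectors of `A` are linearly independent and those of the vectors
of `B` are zero, then `B` is a basis of the kernel of `Φ`. -/
theorem IsListBasis.ker_of_append {E F : Type} [AddCommGroup E] [Module K E] [AddCommGroup F]
    [Module K F] {A B : List E} {V : Submodule K E} (hb : IsListBasis (A ++ B) V) (Φ : E →ₗ[K] F)
    (hA : ListIndep K (A.map Φ)) (hB : ∀ b ∈ B, Φ b = 0) :
    IsListBasis B (V ⊓ LinearMap.ker Φ) := by
  have hB' : ∀ b : ℕ → K, Φ (comb b B) = 0 := fun b => by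
    rw [comb, map_sum]
    refine Finset.sum_eq_zero fun i hi => ?_
    have hi' : i < B.length := Finset.mem_range.mp hi
    simp [hi', hB _ (List.getElem_mem hi')]
  refine ⟨fun c hc => ?_, fun v => ?_⟩
  · have := (listIndep_append (K := K)).mp hb.indep (fun _ => 0) c (by
      rw [hc, comb_eq_zero (fun _ _ => rfl), add_zero])
    exact this.2
  · rw [Submodule.mem_inf, hb.mem_iff, exists_comb_append, LinearMap.mem_ker]
    constructor
    · rintro ⟨⟨a, b, rfl⟩, hv⟩
      rw [map_add, hB', add_zero, ← comb_map] at hv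
      refine ⟨b, ?_⟩
      rw [comb_eq_zero (G := A) (c := a), zero_add]
      simpa using hA a hv
    · rintro ⟨b, rfl⟩
      exact ⟨⟨fun _ => 0, b, by rw [comb_eq_zero (fun _ _ => rfl), zero_add]⟩, hB' b⟩

/-- The kernel of `Φ` on a space with basis `G`, in terms of the linear relations between the images
of the vectors of `G`. -/
theorem IsListBasis.ker_of_relations {E F : Type} [AddCommGroup E] [Module K E] [AddCommGroup F]
    [Module K F] {G : List E} {V : Submodule K E} (hb : IsListBasis G V) (Φ : E →ₗ[K] F)
    {Z : List (ℕ → K)}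
    (hZ : IsListBasis Z (supportedBelow K G.length ⊓ LinearMap.ker (combHom (G.map Φ)))) :
    IsListBasis (Z.map (combHom G)) (V ⊓ LinearMap.ker Φ) := by
  have h := hZ.map (combHom G) fun c hc h0 => by
    funext i
    rcases lt_or_ge i G.length with hi | hi
    · exact hb.indep c h0 i hi
    · exact hc.1 i hi
  convert h using 1
  ext v
  rw [Submodule.mem_inf, hb.mem_iff, Submodule.mem_map, LinearMap.mem_ker]
  constructor
  · rintro ⟨⟨c, rfl⟩, hv⟩
    have hc : comb (fun i => if i < G.length then c i else 0) G = comb c G :=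
      comb_congr G fun i hi => if_pos hi
    refine ⟨_, ⟨fun i hi => if_neg hi.not_gt, ?_⟩, hc⟩
    rw [SetLike.mem_coe, LinearMap.mem_ker, combHom_apply, comb_map, hc, hv]
  · rintro ⟨c, ⟨-, hc⟩, rfl⟩
    refine ⟨⟨c, rfl⟩, ?_⟩
    rw [SetLike.mem_coe, LinearMap.mem_ker, combHom_apply, comb_map] at hc
    exact hc

variable [DecidableEq K] (M : ℕ → ℕ)

/-- Reduction of a row `rc.1` by the pivot rows `l`; the vector `rc.2` records the row operations.
-/
def reduceRow (l : List (ℕ × List K × List K)) (rc : List K × List K) :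
    Counted (List K × List K) :=
  l.foldlM (fun (rc : List K × List K) p => do
    let f ← (fieldArith K M).div (rc.1.getD p.1 (fieldArith K M).zero)
      (p.2.1.getD p.1 (fieldArith K M).zero)
    let row ← subMulVec (fieldArith K M) rc.1 f p.2.1
    let comb ← subMulVec (fieldArith K M) rc.2 f p.2.2
    pure (row, comb)) rc

/-- The pivot rows found so far: the second component of each is nonzero at its pivot position,
where the later ones vanish, and it is the combination of the vectors `S` given by the third
component. -/
structure IsEchelon (S : List (ℕ → K)) (h ρ i : ℕ) (l : List (ℕ × List K × List K)) : Prop where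
  lengths : ∀ p ∈ l, p.2.1.length = h ∧ p.2.2.length = ρ
  row_eq : ∀ p ∈ l, vec p.2.1 = combHom S (vec p.2.2)
  comb_mem : ∀ p ∈ l, vec p.2.2 ∈ supportedBelow K i
  pivot : ∀ p ∈ l, vec p.2.1 p.1 ≠ 0
  later : l.Pairwise fun p p' => vec p'.2.1 p.1 = 0

/-- Reduction by the pivot rows annihilates all pivot positions: an entry made zero stays zero since
the later pivot rows vanish there. -/
theorem reduceRow_spec {S : List (ℕ → K)} {h ρ i : ℕ} (l : List (ℕ × List K × List K))
    (hl : IsEchelon S h ρ i l) (rc : List K × List K) (h1 : rc.1.length = h)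
    (h2 : rc.2.length = ρ) (hrc : vec rc.1 = combHom S (vec rc.2)) :
    let rc' := (reduceRow M l rc).val
    rc'.1.length = h ∧ rc'.2.length = ρ ∧ vec rc'.1 = combHom S (vec rc'.2) ∧
      vec rc'.2 - vec rc.2 ∈ supportedBelow K i ∧ (∀ p ∈ l, vec rc'.1 p.1 = 0) ∧
      (∀ c, vec rc.1 c = 0 → (∀ p ∈ l, vec p.2.1 c = 0) → vec rc'.1 c = 0) ∧
      (reduceRow M l rc).ops ≤ l.length * (1 + 2 * h + 2 * ρ) := by
  induction l generalizing rc with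
  | nil => simp [reduceRow, h1, h2, hrc]
  | cons p l ih =>
    have hl' : IsEchelon S h ρ i l :=
      ⟨fun q hq => hl.lengths q (by simp [hq]), fun q hq => hl.row_eq q (by simp [hq]),
        fun q hq => hl.comb_mem q (by simp [hq]), fun q hq => hl.pivot q (by simp [hq]),
        (List.pairwise_cons.mp hl.later).2⟩
    obtain ⟨hp1, hp2⟩ := hl.lengths p (by simp)
    have hprow := hl.row_eq p (by simp)
    have hpcomb := hl.comb_mem p (by simp)
    have hpp := hl.pivot p (by simp)
    have hlater := (List.pairwise_cons.mp hl.later).1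
    obtain ⟨f, hf⟩ : ∃ f, f = vec rc.1 p.1 / vec p.2.1 p.1 := ⟨_, rfl⟩
    obtain ⟨rc₁, hrc₁⟩ : ∃ rc₁ : List K × List K,
      rc₁ = ((subMulVec (fieldArith K M) rc.1 f p.2.1).val,
        (subMulVec (fieldArith K M) rc.2 f p.2.2).val) := ⟨_, rfl⟩
    have hval : (reduceRow M (p :: l) rc).val = (reduceRow M l rc₁).val := by
      rw [hrc₁, hf]
      simp [reduceRow, vec]
    have hops : (reduceRow M (p :: l) rc).ops =
        (1 + h * 2 + ρ * 2) + (reduceRow M l rc₁).ops := by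
      rw [hrc₁, hf]
      simp [reduceRow, vec, ops_subMulVec, h1, h2, hp1, hp2, add_assoc]
    have hv1 : vec rc₁.1 = vec rc.1 - f • vec p.2.1 := by
      rw [hrc₁]; exact vec_subMulVec M _ _ _ (h1.trans hp1.symm)
    have hv2 : vec rc₁.2 = vec rc.2 - f • vec p.2.2 := by
      rw [hrc₁]; exact vec_subMulVec M _ _ _ (h2.trans hp2.symm)
    obtain ⟨e1, e2, e3, e4, e5, e6, e7⟩ := ih hl' rc₁ (by rw [hrc₁]; simp [h1, hp1])
      (by rw [hrc₁]; simp [h2, hp2]) (by rw [hv1, hv2, hrc, hprow, map_sub, map_smul])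
    rw [hval, hops]
    refine ⟨e1, e2, e3, ?_, ?_, ?_, ?_⟩
    · have : vec (reduceRow M l rc₁).val.2 - vec rc.2 =
          (vec (reduceRow M l rc₁).val.2 - vec rc₁.2) - f • vec p.2.2 := by
        rw [hv2]; abel
      rw [this]
      exact Submodule.sub_mem _ e4 (Submodule.smul_mem _ _ hpcomb)
    · intro q hq
      rcases List.mem_cons.mp hq with rfl | hq
      · refine e6 _ ?_ hlater
        rw [hv1, Pi.sub_apply, Pi.smul_apply, smul_eq_mul, hf, div_mul_cancel₀ _ hpp, sub_self]
      · exact e5 q hq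
    · intro c hc hc'
      refine e6 c ?_ fun q hq => hc' q (by simp [hq])
      rw [hv1, Pi.sub_apply, Pi.smul_apply, hc, hc' p (by simp), smul_zero, sub_zero]
    · rw [List.length_cons, Nat.succ_mul]
      linarith

omit [DecidableEq K] in
/-- Pivot rows are linearly independent. -/
theorem IsEchelon.listIndep {S : List (ℕ → K)} {h ρ i : ℕ} {l : List (ℕ × List K × List K)}
    (hl : IsEchelon S h ρ i l) : ListIndep K (l.map fun p => vec p.2.1) := by
  have hp := hl.pivot
  have hlat := hl.later
  clear hl
  induction l with
  | nil => exact fun _ _ i hi => absurd hi (by simp)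
  | cons p l ih =>
    rw [List.map_cons, listIndep_cons]
    intro x b hx
    have hzero : comb b (l.map fun p => vec p.2.1) p.1 = 0 := by
      rw [comb, Finset.sum_apply]
      refine Finset.sum_eq_zero fun j hj => ?_
      have hj' : j < l.length := by simpa using hj
      simp [hj', (List.pairwise_cons.mp hlat).1 _ (List.getElem_mem hj')]
    have hx0 : x = 0 := by
      have h1 := congrFun hx p.1
      rw [Pi.add_apply, hzero, add_zero, Pi.smul_apply, smul_eq_mul, Pi.zero_apply] at h1
      exact (mul_eq_zero.mp h1).resolve_right (hp p (by simp))
    rw [hx0, zero_smul, zero_add] at hx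
    exact ⟨hx0, ih (fun q hq => hp q (by simp [hq])) (List.pairwise_cons.mp hlat).2 b hx⟩

/-- The vectors of coefficients recorded for the rows that reduce to zero form a basis of the linear
relations between the rows. The recorded vectors of all rows are unitriangular, hence a basis of
`K ^ n`, and the rows that do not reduce to zero are linearly independent. -/
theorem lspKernel_spec {h : ℕ} (S : List (List K)) (hS : ∀ s ∈ S, s.length = h) :
    (∀ κ ∈ (lspKernel (fieldArith K M) S).val, κ.length = S.length) ∧
    IsListBasis ((lspKernel (fieldArith K M) S).val.map vec)
      (supportedBelow K S.length ⊓ LinearMap.ker (combHom (S.map vec))) ∧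
    (lspKernel (fieldArith K M) S).val.length ≤ S.length ∧
    (lspKernel (fieldArith K M) S).ops ≤
      S.length * (S.length * (1 + 2 * h + 2 * S.length) + h) := by
  obtain ⟨unit, hunit⟩ : ∃ unit : ℕ → List K, unit = fun i =>
    (List.range S.length).map fun j => if j = i then 1 else 0 := ⟨_, rfl⟩
  -- one step of the decomposition
  let step : List (ℕ × List K × List K) × List (List K) → ℕ →
      Counted (List (ℕ × List K × List K) × List (List K)) := fun st i => do
    let rc ← reduceRow M st.1 (S.getD i [], unit i)
    let flags ← rc.1.mapM (fieldArith K M).isZero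
    match flags.findIdx? (fun z => !z) with
    | none => pure (st.1, st.2 ++ [rc.2])
    | some c => pure (st.1 ++ [(c, rc.1, rc.2)], st.2)
  let run : ℕ → Counted (List (ℕ × List K × List K) × List (List K)) := fun n =>
    (List.range n).foldlM step ([], [])
  have hrun : lspKernel (fieldArith K M) S = run S.length >>= fun res => pure res.2 := by
    subst hunit
    rfl
  have hsucc : ∀ n, (run (n + 1)).val = (step (run n).val n).val ∧
      (run (n + 1)).ops = (run n).ops + (step (run n).val n).ops := fun n => by
    simp [run, List.range_succ, List.foldlM_append]
  -- the recorded vectors of the first `n` rows form a basis of the vectors supported below `n`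
  have key : ∀ n ≤ S.length, IsEchelon (S.map vec) h S.length n (run n).val.1 ∧
      (∀ κ ∈ (run n).val.2, κ.length = S.length ∧ combHom (S.map vec) (vec κ) = 0) ∧
      IsListBasis ((run n).val.1.map (fun p => vec p.2.2) ++ (run n).val.2.map vec)
        (supportedBelow K n) ∧
      (run n).val.1.length ≤ n ∧ (run n).val.2.length ≤ n ∧
      (run n).ops ≤ n * (S.length * (1 + 2 * h + 2 * S.length) + h) := by
    intro n
    induction n with
    | zero =>
      intro _
      refine ⟨⟨by simp [run], by simp [run], by simp [run], by simp [run], by simp [run]⟩,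
        by simp [run], ?_, by simp [run], by simp [run], by simp [run]⟩
      have : supportedBelow K 0 = ⊥ := by
        rw [eq_bot_iff]
        exact fun f hf => funext fun i => hf i (Nat.zero_le i)
      rw [this]
      exact isListBasis_nil
    | succ n ih =>
      intro hn
      obtain ⟨hE, hk, hb, hc1, hc2, ho⟩ := ih (Nat.le_of_succ_le hn)
      obtain ⟨⟨piv, ker⟩, hst⟩ : ∃ st, st = (run n).val := ⟨_, rfl⟩
      rw [← hst] at hE hk hb hc1 hc2
      simp only at hE hk hb hc1 hc2
      have hSn : (S.getD n []).length = h := by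
        rw [List.getD_eq_getElem _ _ hn]
        exact hS _ (List.getElem_mem hn)
      have hun : (unit n).length = S.length := by simp [hunit]
      have huv : vec (unit n) = Pi.single n 1 := by
        funext j
        rw [hunit, vec_map_range]
        by_cases hj : j = n
        · subst hj; simp [Nat.lt_of_succ_le hn]
        · simp [hj]
      have hrow : vec (S.getD n []) = combHom (S.map vec) (vec (unit n)) := by
        rw [huv, combHom_apply, comb, Finset.sum_eq_single n]
        · simp [Nat.lt_of_succ_le hn]
        · intro j _ hj; simp [hj]
        · intro hj; exact absurd (by simpa using hn) hj
      obtain ⟨r1, r2, r3, r4, r5, -, r7⟩ :=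
        reduceRow_spec M piv hE (S.getD n [], unit n) hSn hun hrow
      obtain ⟨rc, hrc⟩ : ∃ rc, rc = (reduceRow M piv (S.getD n [], unit n)).val := ⟨_, rfl⟩
      rw [← hrc] at r1 r2 r3 r4 r5
      have hu : vec rc.2 n = 1 := by
        have := r4 n le_rfl
        rw [huv, Pi.sub_apply, Pi.single_eq_same, sub_eq_zero] at this
        exact this
      have hub : vec rc.2 ∈ supportedBelow K (n + 1) := fun j hj => by
        have := r4 j (by omega)
        rw [huv, Pi.sub_apply, Pi.single_eq_of_ne (by omega), sub_zero] at this
        exact this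
      have hmono : ∀ f, f ∈ supportedBelow K n → f ∈ supportedBelow K (n + 1) :=
        fun f hf j hj => hf j (by omega)
      have hnot : vec rc.2 ∉ supportedBelow K n := fun hmem => by
        rw [hmem n le_rfl] at hu
        exact zero_ne_one hu
      have hcompl : ∀ v, v ∈ supportedBelow K (n + 1) ↔
          ∃ x : K, v - x • vec rc.2 ∈ supportedBelow K n := fun v => by
        constructor
        · intro hv
          refine ⟨v n, fun j hj => ?_⟩
          rcases hj.eq_or_lt with rfl | hj
          · simp [hu]
          · simp [hv j hj, hub j hj]
        · rintro ⟨x, hx⟩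
          rw [← sub_add_cancel v (x • vec rc.2)]
          exact Submodule.add_mem _ (hmono _ hx) (Submodule.smul_mem _ _ hub)
      have hops : (run n).ops + (step (run n).val n).ops ≤
          (n + 1) * (S.length * (1 + 2 * h + 2 * S.length) + h) := by
        have h1 : (step (run n).val n).ops ≤ S.length * (1 + 2 * h + 2 * S.length) + h := by
          rw [← hst]
          have h2 : (rc.1.mapM (fieldArith K M).isZero).ops = h := by
            simp [r1]
          have h3 : (step (piv, ker) n).ops =
              (reduceRow M piv (S.getD n [], unit n)).ops + h := by
            rw [← h2, hrc]
            simp only [step, Counted.ops_bind]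
            split <;> simp
          rw [h3]
          refine Nat.add_le_add_right (r7.trans (Nat.mul_le_mul_right _ ?_)) _
          omega
        rw [Nat.succ_mul]
        omega
      rw [(hsucc n).1, (hsucc n).2]
      cases hfl : (rc.1.map fun x => decide (x = 0)).findIdx? (fun z => !z) with
      | none =>
        have hstep : (step (run n).val n).val = (piv, ker ++ [rc.2]) := by
          rw [← hst]
          simp only [step, Counted.val_bind, Counted.val_mapM, val_isZero, ← hrc, hfl,
            Counted.val_pure]
        have hz : vec rc.1 = 0 := by
          have hz' : ∀ x ∈ rc.1, x = 0 := by
            rw [List.findIdx?_eq_none_iff] at hfl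
            simpa using hfl
          funext j
          by_cases hj : j < rc.1.length
          · simp [vec, hj, hz' _ (List.getElem_mem hj)]
          · exact vec_eq_zero_of_le (not_lt.mp hj)
        rw [hstep]
        refine ⟨⟨hE.lengths, hE.row_eq, fun p hp => hmono _ (hE.comb_mem p hp), hE.pivot,
          hE.later⟩, ?_, ?_, by simp only; omega, by simp; omega, hops⟩
        · intro κ hκ
          rcases List.mem_append.mp hκ with hκ | hκ
          · exact hk κ hκ
          · obtain rfl := List.mem_singleton.mp hκ
            exact ⟨r2, by rw [← r3, hz]⟩
        · rw [← List.append_nil (_ ++ _)] at hb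
          have := hb.insert (vec rc.2) hnot hcompl
          simpa using this
      | some c =>
        have hstep : (step (run n).val n).val = (piv ++ [(c, rc.1, rc.2)], ker) := by
          rw [← hst]
          simp only [step, Counted.val_bind, Counted.val_mapM, val_isZero, ← hrc, hfl,
            Counted.val_pure]
        have hc : vec rc.1 c ≠ 0 := by
          rw [List.findIdx?_eq_some_iff_getElem] at hfl
          obtain ⟨h1, h2, -⟩ := hfl
          have h1' : c < rc.1.length := by simpa using h1
          simpa [vec, h1'] using h2
        rw [hstep]
        have hmem : ∀ {P : ℕ × List K × List K → Prop}, (∀ p ∈ piv, P p) → P (c, rc.1, rc.2) →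
            ∀ p ∈ piv ++ [(c, rc.1, rc.2)], P p := fun h1 h2 p hp => by
          rcases List.mem_append.mp hp with hp | hp
          · exact h1 p hp
          · rw [List.mem_singleton.mp hp]; exact h2
        refine ⟨⟨hmem hE.lengths ⟨r1, r2⟩, hmem hE.row_eq r3,
          hmem (fun p hp => hmono _ (hE.comb_mem p hp)) hub, hmem hE.pivot hc, ?_⟩, hk, ?_,
          by simp; omega, by simp only; omega, hops⟩
        · refine List.pairwise_append.mpr ⟨hE.later, List.pairwise_singleton _ _, ?_⟩
          intro p hp q hq
          rw [List.mem_singleton.mp hq]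
          exact r5 p hp
        · have := hb.insert (vec rc.2) hnot hcompl
          simpa using this
  obtain ⟨hE, hk, hb, -, hc2, ho⟩ := key S.length le_rfl
  rw [hrun]
  refine ⟨fun κ hκ => (hk κ hκ).1, ?_, hc2, by simpa using ho⟩
  refine hb.ker_of_append (combHom (S.map vec)) ?_ ?_
  · have : (List.map (fun p => vec p.2.2) (run S.length).val.1).map (combHom (S.map vec)) =
        (run S.length).val.1.map fun p => vec p.2.1 := by
      rw [List.map_map]
      exact List.map_congr_left fun p hp => (hE.row_eq p hp).symm
    rw [this]
    exact hE.listIndep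
  · intro b hb
    obtain ⟨κ, hκ, rfl⟩ := List.mem_map.mp hb
    exact (hk κ hκ).2

/-- The linear combination of the lists `G`, of length `w`, with coefficients `κ`. -/
theorem recombine_spec {w : ℕ} (G : List (List K)) (hG : ∀ g ∈ G, g.length = w) (κ : List K)
    (hκ : κ.length = G.length) :
    let f := (G.zip κ).foldlM (fun acc e => addMulVec (fieldArith K M) acc e.2 e.1)
      (List.replicate w 0)
    f.val.length = w ∧ vec f.val = comb (vec κ) (G.map vec) ∧ f.ops ≤ G.length * (2 * w) := by
  have key : ∀ (acc : List K), acc.length = w →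
      let f := (G.zip κ).foldlM (fun acc e => addMulVec (fieldArith K M) acc e.2 e.1) acc
      f.val.length = w ∧ vec f.val = vec acc + comb (vec κ) (G.map vec) ∧
        f.ops ≤ G.length * (2 * w) := by
    induction G generalizing κ with
    | nil => intro acc hacc; simp [hacc]
    | cons g G ih =>
      intro acc hacc
      cases κ with
      | nil => simp at hκ
      | cons x κ =>
        have hg := hG g (by simp)
        have := ih (fun g hg => hG g (by simp [hg])) κ (by simpa using hκ)
          (addMulVec (fieldArith K M) acc x g).val (by simp [hacc, hg])
        obtain ⟨h1, h2, h3⟩ := this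
        simp only [List.zip_cons_cons, List.foldlM_cons, Counted.val_bind, Counted.ops_bind]
        refine ⟨h1, ?_, ?_⟩
        · rw [h2, vec_addMulVec _ _ _ _ (hacc.trans hg.symm), List.map_cons, comb_cons, add_assoc]
          rfl
        · rw [ops_addMulVec, hacc, hg, min_self, List.length_cons, Nat.succ_mul]
          omega
  simpa using key (List.replicate w 0) (by simp)

end Relations

/-! ### The infinite matrix and its sparse rows -/

section Rows

variable {K : Type} [Field K]

/-- The entry `(i, n)` of the infinite matrix of the transformed operator: the coefficient of
`t ^ i` in the image of `t ^ n`. -/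
def rmat (b : ℕ) (a : ℕ → ℕ → K) (φ : ChangeVar) (ts : List MahlerTerm) (i : ℤ) (n : ℕ) : K :=
  (ts.map fun T => ∑ j ∈ Finset.range (T.deg + 1),
    if φ.α * (b : ℤ) ^ T.k + φ.β * j - φ.γ + n * (b : ℤ) ^ T.k = i then a T.k j else 0).sum

theorem sum_rmat_mul (b : ℕ) (a : ℕ → ℕ → K) (φ : ChangeVar) (ts : List MahlerTerm) (i : ℤ)
    (s : Finset ℕ) (f : ℕ → K) :
    ∑ n ∈ s, rmat b a φ ts i n * f n = (ts.map fun T => ∑ j ∈ Finset.range (T.deg + 1),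
      ∑ n ∈ s, if φ.α * (b : ℤ) ^ T.k + φ.β * j - φ.γ + n * (b : ℤ) ^ T.k = i then
        a T.k j * f n else 0).sum := by
  induction ts with
  | nil => simp [rmat]
  | cons T ts ih =>
    rw [List.map_cons, List.sum_cons, ← ih, Finset.sum_comm, ← Finset.sum_add_distrib]
    refine Finset.sum_congr rfl fun n _ => ?_
    rw [rmat, List.map_cons, List.sum_cons, add_mul, Finset.sum_mul]
    congr 1
    refine Finset.sum_congr rfl fun j _ => ?_
    rw [ite_mul, zero_mul]

variable [DecidableEq K] (M : ℕ → ℕ)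

theorem addEntry_spec (c : ℕ) (x : K) (row : List (ℕ × K)) (hrow : (row.map Prod.fst).Nodup) :
    (∀ n, n ∈ (addEntry (fieldArith K M) c x row).val.map Prod.fst ↔
      n = c ∨ n ∈ row.map Prod.fst) ∧
    ((addEntry (fieldArith K M) c x row).val.map Prod.fst).Nodup ∧
    (∀ f : ℕ → K, ((addEntry (fieldArith K M) c x row).val.map fun e => e.2 * f e.1).sum =
      (row.map fun e => e.2 * f e.1).sum + x * f c) ∧
    (addEntry (fieldArith K M) c x row).val.length ≤ row.length + 1 ∧
    (addEntry (fieldArith K M) c x row).ops ≤ 1 := by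
  induction row with
  | nil => simp [addEntry]
  | cons e row ih =>
    obtain ⟨c', y⟩ := e
    rw [List.map_cons, List.nodup_cons] at hrow
    by_cases hc : c' = c
    · subst hc
      have : addEntry (fieldArith K M) c' x ((c', y) :: row) =
        (fieldArith K M).add y x >>= fun z => pure ((c', z) :: row) := by simp [addEntry]
      rw [this]
      refine ⟨by simp, by simpa using hrow, fun f => ?_, by simp, by simp⟩
      simp
      ring
    · have : addEntry (fieldArith K M) c x ((c', y) :: row) =
        addEntry (fieldArith K M) c x row >>= fun t' => pure ((c', y) :: t') := by
        simp [addEntry, hc]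
      rw [this]
      obtain ⟨h1, h2, h3, h4, h5⟩ := ih hrow.2
      refine ⟨fun n => ?_, ?_, fun f => ?_, by simpa using h4, by simpa using h5⟩
      · simp only [Counted.val_bind, Counted.val_pure, List.map_cons, List.mem_cons, h1]
        tauto
      · simp only [Counted.val_bind, Counted.val_pure, List.map_cons, List.nodup_cons, h1]
        exact ⟨not_or.mpr ⟨hc, hrow.1⟩, h2⟩
      · simp only [Counted.val_bind, Counted.val_pure, List.map_cons, List.sum_cons, h3]
        ring

theorem foldlM_addEntry_spec (l row : List (ℕ × K)) (hrow : (row.map Prod.fst).Nodup) :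
    let res := l.foldlM (fun row e => addEntry (fieldArith K M) e.1 e.2 row) row
    (res.val.map Prod.fst).Nodup ∧
    (∀ f : ℕ → K, (res.val.map fun e => e.2 * f e.1).sum =
      (row.map fun e => e.2 * f e.1).sum + (l.map fun e => e.2 * f e.1).sum) ∧
    res.val.length ≤ row.length + l.length ∧ res.ops ≤ l.length := by
  induction l generalizing row with
  | nil => simp [hrow]
  | cons e l ih =>
    obtain ⟨-, h2, h3, h4, h5⟩ := addEntry_spec M e.1 e.2 row hrow
    obtain ⟨g1, g2, g3, g4⟩ := ih _ h2
    simp only [List.foldlM_cons, Counted.val_bind, Counted.ops_bind]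
    refine ⟨g1, fun f => ?_, ?_, ?_⟩
    · rw [g2, h3, List.map_cons, List.sum_cons, add_assoc]
    · rw [List.length_cons]; omega
    · rw [List.length_cons]; omega

/-- The entries contributed to the row `i` by the coefficient of `M ^ k`, as computed by the
algorithm. -/
def rowEntries (b : ℕ) (a : ℕ → ℕ → K) (φ : ChangeVar) (w : ℕ) (i : ℤ) (T : MahlerTerm) :
    List (ℕ × K) :=
  let q : ℕ := b ^ T.k
  let B : ℤ := i + φ.γ - φ.α * q
  let j₀ : ℕ := ((Nat.gcdA φ.β q * B) % (q : ℤ)).toNat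
  (((List.range (T.deg / q + 1)).map fun u => j₀ + u * q).filter fun j : ℕ =>
    j ≤ T.deg ∧ (φ.β * j : ℤ) ≤ B ∧ B - q * w < φ.β * j).map fun j : ℕ =>
      (((B - φ.β * j) / q).toNat, a T.k j)

theorem buildRow_eq (b : ℕ) (a : ℕ → ℕ → K) (φ : ChangeVar) (ts : List MahlerTerm) (w : ℕ) (i : ℤ) :
    buildRow (fieldArith K M) b a φ ts w i =
      (ts.flatMap (rowEntries b a φ w i)).foldlM
        (fun row e => addEntry (fieldArith K M) e.1 e.2 row) [] := rfl

/-- The exponents `j` for which `β j ≡ B` modulo `q`: the inverse of `β` is a Bézout coefficient. -/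
theorem dvd_sub_mul_iff {β q : ℕ} (hq : 0 < q) (hβ : Nat.Coprime β q) (B : ℤ) (j : ℕ) :
    (q : ℤ) ∣ B - β * j ↔ ∃ u : ℕ, j = ((Nat.gcdA β q * B) % (q : ℤ)).toNat + u * q := by
  have hq' : (0 : ℤ) < q := by exact_mod_cast hq
  obtain ⟨j₀, hj₀⟩ : ∃ j₀, j₀ = ((Nat.gcdA β q * B) % (q : ℤ)).toNat := ⟨_, rfl⟩
  have hj₀' : (j₀ : ℤ) = (Nat.gcdA β q * B) % (q : ℤ) := by
    rw [hj₀, Int.toNat_of_nonneg (Int.emod_nonneg _ hq'.ne')]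
  have hlt : (j₀ : ℤ) < q := hj₀' ▸ Int.emod_lt_of_pos _ hq'
  have hbez : (β : ℤ) * Nat.gcdA β q + q * Nat.gcdB β q = 1 := by
    rw [← Nat.gcd_eq_gcd_ab, hβ]; rfl
  have hB : (q : ℤ) ∣ B - β * j₀ := by
    have h1 : (q : ℤ) ∣ Nat.gcdA β q * B - j₀ := by
      rw [hj₀']; exact Int.dvd_self_sub_emod
    have h2 : B - β * j₀ = β * (Nat.gcdA β q * B - j₀) + q * (Nat.gcdB β q * B) := by
      linear_combination -B * hbez
    rw [h2]
    exact dvd_add (h1.mul_left _) (dvd_mul_right _ _)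
  have hcop : IsCoprime (q : ℤ) (β : ℤ) := (Nat.isCoprime_iff_coprime.mpr hβ).symm
  rw [← hj₀]
  constructor
  · intro h
    have h1 : (q : ℤ) ∣ β * ((j : ℤ) - j₀) := by
      have := dvd_sub hB h
      rwa [show B - β * (j₀ : ℤ) - (B - β * j) = β * ((j : ℤ) - j₀) by ring] at this
    obtain ⟨u, hu⟩ := hcop.dvd_of_dvd_mul_left h1
    have hu0 : 0 ≤ u := by
      by_contra hneg
      have : (q : ℤ) * u ≤ q * (-1) := mul_le_mul_of_nonneg_left (by omega) hq'.le
      omega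
    lift u to ℕ using hu0
    refine ⟨u, ?_⟩
    have : (j : ℤ) = j₀ + u * q := by linarith
    exact_mod_cast this
  · rintro ⟨u, rfl⟩
    have : B - β * ((j₀ + u * q : ℕ) : ℤ) = (B - β * j₀) - q * (β * u) := by push_cast; ring
    rw [this]
    exact dvd_sub hB (dvd_mul_right _ _)

omit [DecidableEq K] in
/-- The listed entries are exactly the contributions of the coefficient of `M ^ k` to the row `i` in
columns less than `w`. -/
theorem sum_rowEntries {b : ℕ} (hb : 0 < b) (a : ℕ → ℕ → K) (φ : ChangeVar)
    (hβ : φ.β.Coprime b) (w : ℕ) (i : ℤ) (T : MahlerTerm) (f : ℕ → K) :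
    ((rowEntries b a φ w i T).map fun e => e.2 * f e.1).sum =
      ∑ j ∈ Finset.range (T.deg + 1), ∑ n ∈ Finset.range w,
        if φ.α * (b : ℤ) ^ T.k + φ.β * j - φ.γ + n * (b : ℤ) ^ T.k = i then
          a T.k j * f n else 0 := by
  obtain ⟨q, hq⟩ : ∃ q, q = b ^ T.k := ⟨_, rfl⟩
  have hq0 : 0 < q := hq ▸ Nat.pow_pos hb
  have hq' : (0 : ℤ) < q := by exact_mod_cast hq0
  have hcop : φ.β.Coprime q := hq ▸ Nat.Coprime.pow_right _ hβ
  obtain ⟨B, hB⟩ : ∃ B : ℤ, B = i + φ.γ - φ.α * q := ⟨_, rfl⟩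
  have hqz : (b : ℤ) ^ T.k = q := by rw [hq]; push_cast; rfl
  obtain ⟨l, hl⟩ : ∃ l : List ℕ, l =
      (((List.range (T.deg / q + 1)).map fun u =>
        ((Nat.gcdA φ.β q * B) % (q : ℤ)).toNat + u * q).filter fun j : ℕ =>
          j ≤ T.deg ∧ (φ.β * j : ℤ) ≤ B ∧ B - q * w < φ.β * j) := ⟨_, rfl⟩
  have hentries : rowEntries b a φ w i T =
      l.map fun j : ℕ => (((B - φ.β * j) / q).toNat, a T.k j) := by
    rw [hl, hB, hq]; rfl
  have hnd : l.Nodup := by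
    rw [hl]
    refine List.Nodup.filter _ (List.Nodup.map (fun u u' h => ?_) List.nodup_range)
    exact Nat.eq_of_mul_eq_mul_right hq0 (Nat.add_left_cancel h)
  have hmem : ∀ j, j ∈ l ↔ j ≤ T.deg ∧ (q : ℤ) ∣ B - φ.β * j ∧ (φ.β * j : ℤ) ≤ B ∧
      B - q * w < φ.β * j := fun j => by
    rw [hl, List.mem_filter, List.mem_map, dvd_sub_mul_iff hq0 hcop, decide_eq_true_iff]
    constructor
    · rintro ⟨⟨u, -, rfl⟩, h1, h2, h3⟩
      exact ⟨h1, ⟨u, rfl⟩, h2, h3⟩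
    · rintro ⟨h1, ⟨u, hu⟩, h2, h3⟩
      refine ⟨⟨u, ?_, hu.symm⟩, h1, h2, h3⟩
      rw [List.mem_range, Nat.lt_succ_iff, Nat.le_div_iff_mul_le hq0]
      omega
  rw [hentries, List.map_map]
  have h1 : (l.map ((fun e : ℕ × K => e.2 * f e.1) ∘
      fun j : ℕ => (((B - φ.β * j) / q).toNat, a T.k j))).sum =
      ∑ j ∈ l.toFinset, a T.k j * f ((B - φ.β * j) / q).toNat :=
    (List.sum_toFinset _ hnd).symm
  have hsub : l.toFinset ⊆ Finset.range (T.deg + 1) := fun j hj => by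
    rw [List.mem_toFinset, hmem] at hj
    rw [Finset.mem_range]
    omega
  rw [h1, ← Finset.sum_subset hsub]
  · refine Finset.sum_congr rfl fun j hj => ?_
    rw [List.mem_toFinset, hmem] at hj
    obtain ⟨-, ⟨n, hn⟩, h3, h4⟩ := hj
    have hn0 : 0 ≤ n := by
      by_contra hneg
      have : (q : ℤ) * n ≤ q * (-1) := mul_le_mul_of_nonneg_left (by omega) hq'.le
      omega
    lift n to ℕ using hn0
    have hnw : n < w := by
      have : (q : ℤ) * n < q * w := by omega
      exact_mod_cast lt_of_mul_lt_mul_left this hq'.le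
    rw [hn, Int.mul_ediv_cancel_left _ hq'.ne', Int.toNat_natCast, hqz,
      Finset.sum_eq_single n, if_pos (by rw [hB] at hn; linarith)]
    · intro n' _ hne
      refine if_neg fun h => hne ?_
      have : (q : ℤ) * n' = q * n := by rw [hB] at hn; linarith
      exact_mod_cast mul_left_cancel₀ hq'.ne' this
    · intro h
      exact absurd (Finset.mem_range.mpr hnw) h
  · intro j hj hj'
    refine Finset.sum_eq_zero fun n hn => if_neg fun h => hj' ?_
    rw [hqz] at h
    have hn' : (n : ℤ) + 1 ≤ w := by exact_mod_cast Finset.mem_range.mp hn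
    have hBj : B - φ.β * j = q * n := by rw [hB]; linarith
    have h5 : (q : ℤ) * (n + 1) ≤ q * w := mul_le_mul_of_nonneg_left hn' hq'.le
    have h6 : (0 : ℤ) ≤ q * n := by positivity
    rw [List.mem_toFinset, hmem]
    refine ⟨Nat.lt_succ_iff.mp (Finset.mem_range.mp hj), ⟨n, hBj⟩, by omega, ?_⟩
    rw [mul_add] at h5
    omega

theorem buildRow_spec {b : ℕ} (hb : 0 < b) (a : ℕ → ℕ → K) (φ : ChangeVar)
    (hβ : φ.β.Coprime b) (ts : List MahlerTerm) (w : ℕ) (i : ℤ) :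
    RepresentsRow w (buildRow (fieldArith K M) b a φ ts w i).val (rmat b a φ ts i) := by
  rw [buildRow_eq]
  obtain ⟨h1, h2, -⟩ := foldlM_addEntry_spec M (ts.flatMap (rowEntries b a φ w i)) [] (by simp)
  refine ⟨h1, fun f => ?_⟩
  rw [h2, sum_rmat_mul, List.map_nil, List.sum_nil, zero_add]
  clear h1 h2
  induction ts with
  | nil => simp
  | cons T ts ih =>
    rw [List.flatMap_cons, List.map_append, List.sum_append, ih, sum_rowEntries hb a φ hβ,
      List.map_cons, List.sum_cons]

omit [Field K] [DecidableEq K] in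
/-- The number of entries of a row is bounded by a geometric sum: the coefficient of `M ^ k`
contributes only in columns given by the exponents `j ≤ d` in one class modulo `b ^ k`. -/
theorem length_flatMap_rowEntries_le {b r d : ℕ} (hb : 2 ≤ b) (a : ℕ → ℕ → K) (φ : ChangeVar)
    (ts : List MahlerTerm) (w : ℕ) (i : ℤ) (hk : (ts.map MahlerTerm.k).Sublist (List.range (r + 1)))
    (hdeg : ∀ T ∈ ts, T.deg ≤ d) :
    (ts.flatMap (rowEntries b a φ w i)).length ≤ 2 * d + (r + 1) := by
  have h1 : (ts.flatMap (rowEntries b a φ w i)).length ≤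
      ((ts.map MahlerTerm.k).map fun k => d / b ^ k + 1).sum := by
    clear hk
    induction ts with
    | nil => simp
    | cons T ts ih =>
      rw [List.flatMap_cons, List.length_append, List.map_cons, List.map_cons, List.sum_cons]
      refine Nat.add_le_add ?_ (ih fun T hT => hdeg T (by simp [hT]))
      rw [rowEntries, List.length_map]
      refine (List.length_filter_le _ _).trans ?_
      rw [List.length_map, List.length_range]
      exact Nat.succ_le_succ (Nat.div_le_div_right (hdeg T (by simp)))
  have h2 : ((ts.map MahlerTerm.k).map fun k => d / b ^ k + 1).sum ≤
      ((List.range (r + 1)).map fun k => d / b ^ k + 1).sum :=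
    (hk.map _).sum_le_sum fun _ _ => Nat.zero_le _
  have h3 : ((List.range (r + 1)).map fun k => d / b ^ k + 1).sum =
      ∑ k ∈ Finset.range (r + 1), d / b ^ k + (r + 1) := by
    rw [← List.sum_toFinset _ List.nodup_range, List.toFinset_range, Finset.sum_add_distrib]
    simp
  have h4 := Nat.geom_sum_le hb d (r + 1)
  have h5 : d * b / (b - 1) ≤ 2 * d := by
    rw [Nat.div_le_iff_le_mul_add_pred (by omega)]
    obtain ⟨e, rfl⟩ := Nat.exists_eq_add_of_le hb
    have : 2 + e - 1 = e + 1 := by omega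
    rw [this]
    nlinarith
  omega

theorem length_buildRow_le {b r d : ℕ} (hb : 2 ≤ b) (a : ℕ → ℕ → K) (φ : ChangeVar)
    (ts : List MahlerTerm) (w : ℕ) (i : ℤ) (hk : (ts.map MahlerTerm.k).Sublist (List.range (r + 1)))
    (hdeg : ∀ T ∈ ts, T.deg ≤ d) :
    (buildRow (fieldArith K M) b a φ ts w i).val.length ≤ 2 * d + (r + 1) ∧
      (buildRow (fieldArith K M) b a φ ts w i).ops ≤ 2 * d + (r + 1) := by
  have h := length_flatMap_rowEntries_le hb a φ ts w i hk hdeg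
  obtain ⟨-, -, h3, h4⟩ := foldlM_addEntry_spec M (ts.flatMap (rowEntries b a φ w i)) [] (by simp)
  rw [buildRow_eq]
  simp only [List.length_nil] at h3
  omega

end Rows

/-! ### Truncated products by blocks -/

section Products

variable {K : Type} [Field K]

/-- The power series whose coefficients are the entries of a list. -/
noncomputable def listSeries (p : List K) : PowerSeries K := PowerSeries.mk (vec p)

theorem coeff_listSeries (p : List K) (n : ℕ) : PowerSeries.coeff n (listSeries p) = vec p n :=
  PowerSeries.coeff_mk _ _

/-- The block of index `i` of a list, for blocks of length `D + 1`. -/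
def listBlock (D : ℕ) (l : List K) (i : ℕ) : List K := (l.drop (i * (D + 1))).take (D + 1)

theorem vec_listBlock (D : ℕ) (l : List K) (i n : ℕ) :
    vec (listBlock D l i) n = if n < D + 1 then vec l (i * (D + 1) + n) else 0 := by
  rw [listBlock, vec_take, vec_drop]

omit [Field K] in
theorem length_listBlock_le (D : ℕ) (l : List K) (i : ℕ) : (listBlock D l i).length ≤ D + 1 := by
  simp [listBlock]

theorem listSeries_eq_sum_blocks (D h : ℕ) (l : List K) (hl : l.length ≤ h) :
    listSeries l = ∑ i ∈ Finset.range (h / (D + 1) + 1),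
      PowerSeries.X ^ (i * (D + 1)) * listSeries (listBlock D l i) := by
  ext n
  rw [map_sum, coeff_listSeries]
  have hterm : ∀ i, PowerSeries.coeff n
      (PowerSeries.X ^ (i * (D + 1)) * listSeries (listBlock D l i)) =
      if n / (D + 1) = i then vec l n else 0 := fun i => by
    rw [PowerSeries.coeff_X_pow_mul', coeff_listSeries, vec_listBlock]
    have hdiv : n / (D + 1) = i ↔ i * (D + 1) ≤ n ∧ n < (i + 1) * (D + 1) := by
      rw [← Nat.le_div_iff_mul_le (Nat.succ_pos D), ← Nat.div_lt_iff_lt_mul (Nat.succ_pos D),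
        Nat.lt_succ_iff, and_comm]
      exact le_antisymm_iff
    by_cases h1 : i * (D + 1) ≤ n
    · rw [if_pos h1, Nat.add_sub_cancel' h1]
      refine if_congr ?_ rfl rfl
      rw [hdiv, Nat.succ_mul]
      omega
    · rw [if_neg h1, if_neg fun h => h1 (hdiv.mp h).1]
  simp only [hterm]
  rw [Finset.sum_ite_eq]
  split_ifs with hn
  · rfl
  · rw [Finset.mem_range] at hn
    refine vec_eq_zero_of_le (hl.trans ?_)
    by_contra hlt
    exact hn (Nat.lt_succ_of_le (Nat.div_le_div_right (not_le.mp hlt).le))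

variable [DecidableEq K] (M : ℕ → ℕ)

theorem listSeries_polyMul (D : ℕ) (p q : List K) (hp : p.length ≤ D + 1)
    (hq : q.length ≤ D + 1) :
    listSeries ((fieldArith K M).polyMul D p q).val = listSeries p * listSeries q := by
  have hval : ((fieldArith K M).polyMul D p q).val = (List.range (2 * D + 1)).map fun i =>
      ((List.range (i + 1)).map fun j => vec p j * vec q (i - j)).sum := by
    have h1 : ((fieldArith K M).polyMul D p q).val = (List.range (2 * D + 1)).map fun i =>
      ((List.range (i + 1)).map fun j =>
        (p.take (D + 1)).getD j 0 * (q.take (D + 1)).getD (i - j) 0).sum := rfl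
    rw [h1, List.take_of_length_le hp, List.take_of_length_le hq]
    rfl
  have hsum : ∀ i, ((List.range (i + 1)).map fun j => vec p j * vec q (i - j)).sum =
      PowerSeries.coeff i (listSeries p * listSeries q) := fun i => by
    rw [PowerSeries.coeff_mul, Finset.Nat.sum_antidiagonal_eq_sum_range_succ_mk,
      ← List.sum_toFinset _ List.nodup_range, List.toFinset_range]
    simp only [coeff_listSeries]
  ext n
  rw [coeff_listSeries, hval, vec_map_range, hsum]
  split_ifs with hn
  · rfl
  · rw [PowerSeries.coeff_mul]
    symm
    refine Finset.sum_eq_zero fun x hx => ?_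
    rw [Finset.HasAntidiagonal.mem_antidiagonal] at hx
    rw [coeff_listSeries, coeff_listSeries]
    rcases le_or_gt (D + 1) x.1 with h | h
    · rw [vec_eq_zero_of_le (hp.trans h), zero_mul]
    · rw [vec_eq_zero_of_le (hq.trans (by omega)), mul_zero]

theorem addShifted_spec (acc : List K) (o : ℕ) (p : List K) :
    (addShifted (fieldArith K M) acc o p).val.length = acc.length ∧
    (∀ n < acc.length, vec (addShifted (fieldArith K M) acc o p).val n =
      vec acc n + PowerSeries.coeff n (PowerSeries.X ^ o * listSeries p)) ∧
    (addShifted (fieldArith K M) acc o p).ops ≤ acc.length := by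
  refine ⟨by simp [addShifted], fun n hn => ?_, ?_⟩
  · rw [addShifted, Counted.val_mapM, vec_map_range, if_pos hn, PowerSeries.coeff_X_pow_mul']
    by_cases h1 : o ≤ n
    · rw [if_pos h1, coeff_listSeries]
      by_cases h2 : n - o < p.length
      · rw [if_pos ⟨h1, h2⟩]
        rfl
      · rw [if_neg fun h => h2 h.2, vec_eq_zero_of_le (not_lt.mp h2), add_zero]
        rfl
    · rw [if_neg h1, if_neg fun h => h1 h.1, add_zero]
      rfl
  · have := Counted.ops_mapM_le (fun i => if o ≤ i ∧ i - o < p.length then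
      (fieldArith K M).add (acc.getD i (fieldArith K M).zero) (p.getD (i - o) (fieldArith K M).zero)
      else pure (acc.getD i (fieldArith K M).zero)) (List.range acc.length) 1 (fun i _ => by
        split <;> simp)
    simpa [addShifted] using this

/-- Multiplication by blocks of length `D + 1` computes the truncated product with
`(h / (D + 1) + 1) ^ 2` multiplications of polynomials of degree at most `D`. -/
theorem mulTrunc_spec (D h : ℕ) (p q : List K) (hp : p.length ≤ h) (hq : q.length ≤ h) :
    (mulTrunc (fieldArith K M) D h p q).val.length = h ∧
    (∀ n < h, vec (mulTrunc (fieldArith K M) D h p q).val n =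
      PowerSeries.coeff n (listSeries p * listSeries q)) ∧
    (mulTrunc (fieldArith K M) D h p q).ops ≤ (h / (D + 1) + 1) ^ 2 * (M D + h) := by
  obtain ⟨cnt, hcnt⟩ : ∃ cnt, cnt = h / (D + 1) + 1 := ⟨_, rfl⟩
  obtain ⟨pairs, hpairs⟩ : ∃ l : List (ℕ × ℕ), l = (List.range cnt).flatMap fun i =>
    (List.range cnt).map fun j => (i, j) := ⟨_, rfl⟩
  have hmt : mulTrunc (fieldArith K M) D h p q = pairs.foldlM
      (fun acc e => (fieldArith K M).polyMul D (listBlock D p e.1) (listBlock D q e.2) >>=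
        fun z => addShifted (fieldArith K M) acc ((e.1 + e.2) * (D + 1)) z)
      (List.replicate h 0) := by
    rw [hpairs, hcnt]; rfl
  have key : ∀ (l : List (ℕ × ℕ)) (acc : List K), acc.length = h →
      let res := l.foldlM (fun acc e =>
        (fieldArith K M).polyMul D (listBlock D p e.1) (listBlock D q e.2) >>=
          fun z => addShifted (fieldArith K M) acc ((e.1 + e.2) * (D + 1)) z) acc
      res.val.length = h ∧ (∀ n < h, vec res.val n = vec acc n + PowerSeries.coeff n
        (l.map fun e => (PowerSeries.X ^ (e.1 * (D + 1)) * listSeries (listBlock D p e.1)) *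
          (PowerSeries.X ^ (e.2 * (D + 1)) * listSeries (listBlock D q e.2))).sum) ∧
        res.ops ≤ l.length * (M D + h) := by
    intro l
    induction l with
    | nil => intro acc hacc; simp [hacc]
    | cons e l ih =>
      intro acc hacc
      obtain ⟨h1, h2, h3⟩ := addShifted_spec M acc ((e.1 + e.2) * (D + 1))
        ((fieldArith K M).polyMul D (listBlock D p e.1) (listBlock D q e.2)).val
      obtain ⟨g1, g2, g3⟩ := ih _ (h1.trans hacc)
      simp only [List.foldlM_cons, Counted.val_bind, Counted.ops_bind, ops_polyMul]
      refine ⟨g1, fun n hn => ?_, ?_⟩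
      · rw [g2 n hn, h2 n (hacc ▸ hn), listSeries_polyMul M D _ _ (length_listBlock_le D p e.1)
          (length_listBlock_le D q e.2), List.map_cons, List.sum_cons, map_add, add_assoc]
        congr 3
        rw [add_mul, pow_add]
        ring
      · rw [List.length_cons, Nat.succ_mul]
        omega
  obtain ⟨h1, h2, h3⟩ := key pairs (List.replicate h 0) (by simp)
  have hprod : (pairs.map fun e =>
      (PowerSeries.X ^ (e.1 * (D + 1)) * listSeries (listBlock D p e.1)) *
        (PowerSeries.X ^ (e.2 * (D + 1)) * listSeries (listBlock D q e.2))).sum =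
      listSeries p * listSeries q := by
    rw [listSeries_eq_sum_blocks D h p hp, listSeries_eq_sum_blocks D h q hq,
      Finset.sum_mul_sum, ← hcnt, hpairs, List.map_flatMap]
    rw [List.flatMap, List.sum_flatten, List.map_map]
    rw [← List.toFinset_range, List.sum_toFinset _ List.nodup_range]
    congr 1
    refine List.map_congr_left fun i _ => ?_
    rw [List.sum_toFinset _ List.nodup_range, Function.comp_apply, List.map_map]
    rfl
  have hlen : pairs.length = cnt ^ 2 := by
    rw [hpairs]; simp [List.length_flatMap, sq]
  rw [hmt, ← hcnt, ← hlen]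
  refine ⟨h1, fun n hn => ?_, h3⟩
  rw [h2 n hn, hprod]
  simp

theorem transformedCoeff_eq (b : ℕ) (a : ℕ → ℕ → K) (φ : ChangeVar) (h : ℕ)
    (T : MahlerTerm) : transformedCoeff (fieldArith K M) b a φ h T = (List.range h).map fun i : ℕ =>
      if (φ.β : ℤ) ∣ i + φ.γ - φ.α * (b : ℤ) ^ T.k ∧ 0 ≤ i + φ.γ - φ.α * (b : ℤ) ^ T.k ∧
          (i + φ.γ - φ.α * (b : ℤ) ^ T.k) / φ.β ≤ T.deg then
        a T.k ((i + φ.γ - φ.α * (b : ℤ) ^ T.k) / φ.β).toNat else 0 := by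
  simp [transformedCoeff, ← List.map_eq_flatMap]

/-- The coefficients of order less than `h` of the image of a polynomial under the transformed
operator, computed by fast multiplication, are given by the rows of the infinite matrix. -/
theorem applyTransformed_spec {b : ℕ} (hb : 0 < b) (a : ℕ → ℕ → K) (φ : ChangeVar) (hβ : 0 < φ.β)
    (ts : List MahlerTerm)
    (hpos : ∀ T ∈ ts, ∀ j ≤ T.deg, a T.k j ≠ 0 → 0 ≤ φ.α * (b : ℤ) ^ T.k + φ.β * j - φ.γ)
    (D h w : ℕ) (g : List K) (hg : g.length = w) :
    (applyTransformed (fieldArith K M) b a φ ts D h g).val.length = h ∧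
    (∀ i < h, vec (applyTransformed (fieldArith K M) b a φ ts D h g).val i =
      rowForm (rmat b a φ ts i) w (vec g)) ∧
    (applyTransformed (fieldArith K M) b a φ ts D h g).ops ≤
      ts.length * ((h / (D + 1) + 1) ^ 2 * (M D + h) + h) := by
  have hterm : ∀ T ∈ ts, ∀ i < h,
      PowerSeries.coeff i (listSeries (transformedCoeff (fieldArith K M) b a φ h T) *
        listSeries (mahlerSubst (fieldArith K M) b T.k h g)) =
      ∑ j ∈ Finset.range (T.deg + 1), ∑ n ∈ Finset.range w,
        if φ.α * (b : ℤ) ^ T.k + φ.β * j - φ.γ + n * (b : ℤ) ^ T.k = i then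
          a T.k j * vec g n else 0 := by
    intro T hT i hi
    obtain ⟨q, hq⟩ : ∃ q, q = b ^ T.k := ⟨_, rfl⟩
    have hq0 : 0 < q := hq ▸ Nat.pow_pos hb
    have hqz : (b : ℤ) ^ T.k = q := by rw [hq]; push_cast; rfl
    have hβ' : (0 : ℤ) < φ.β := by exact_mod_cast hβ
    have htc : ∀ u < h, vec (transformedCoeff (fieldArith K M) b a φ h T) u =
        ∑ j ∈ Finset.range (T.deg + 1),
          if φ.α * (b : ℤ) ^ T.k + φ.β * j - φ.γ = u then a T.k j else 0 := by
      intro u hu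
      rw [transformedCoeff_eq, vec_map_range, if_pos hu, hqz]
      by_cases hc : (φ.β : ℤ) ∣ u + φ.γ - φ.α * q ∧ 0 ≤ u + φ.γ - φ.α * q ∧
          (u + φ.γ - φ.α * q) / φ.β ≤ T.deg
      · rw [if_pos hc]
        obtain ⟨⟨j, hj⟩, h2, h3⟩ := hc
        rw [hj] at h2 h3 ⊢
        rw [Int.mul_ediv_cancel_left _ hβ'.ne'] at h3 ⊢
        have hj0 : 0 ≤ j := nonneg_of_mul_nonneg_right h2 hβ'
        lift j to ℕ using hj0
        rw [Int.toNat_natCast, Finset.sum_eq_single j, if_pos (by linarith)]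
        · intro j' _ hne
          refine if_neg fun h => hne ?_
          have : (φ.β : ℤ) * j' = φ.β * j := by linarith
          exact_mod_cast mul_left_cancel₀ hβ'.ne' this
        · intro hj'
          exact absurd (Finset.mem_range.mpr (by omega)) hj'
      · rw [if_neg hc]
        symm
        refine Finset.sum_eq_zero fun j hj => if_neg fun h => hc ?_
        have hu' : u + φ.γ - φ.α * q = φ.β * j := by linarith
        rw [hu', Int.mul_ediv_cancel_left _ hβ'.ne']
        refine ⟨dvd_mul_right _ _, by positivity, ?_⟩
        have := Finset.mem_range.mp hj
        omega
    have hms : ∀ u < h, vec (mahlerSubst (fieldArith K M) b T.k h g) u =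
        ∑ n ∈ Finset.range w, if n * q = u then vec g n else 0 := by
      intro u hu
      rw [mahlerSubst, vec_map_range, if_pos hu, ← hq]
      simp only [fieldArith_zero]
      by_cases hd : q ∣ u
      · obtain ⟨n, rfl⟩ := hd
        rw [if_pos (dvd_mul_right _ _), Nat.mul_div_cancel_left _ hq0]
        by_cases hn : n < w
        · rw [Finset.sum_eq_single n, if_pos (mul_comm _ _)]
          · rfl
          · intro n' _ hne
            refine if_neg fun h => hne ?_
            rw [mul_comm] at h
            exact Nat.eq_of_mul_eq_mul_left hq0 h
          · intro h
            exact absurd (Finset.mem_range.mpr hn) h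
        · rw [Finset.sum_eq_zero]
          · exact vec_eq_zero_of_le (hg.le.trans (not_lt.mp hn))
          · intro n' hn'
            refine if_neg fun h => hn ?_
            rw [mul_comm] at h
            rw [← Nat.eq_of_mul_eq_mul_left hq0 h]
            exact Finset.mem_range.mp hn'
      · rw [if_neg hd]
        symm
        refine Finset.sum_eq_zero fun n _ => if_neg fun h => hd ?_
        exact ⟨n, by rw [← h, mul_comm]⟩
    rw [PowerSeries.coeff_mul]
    have hstep : ∀ x ∈ Finset.HasAntidiagonal.antidiagonal i,
        PowerSeries.coeff x.1 (listSeries (transformedCoeff (fieldArith K M) b a φ h T)) *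
          PowerSeries.coeff x.2 (listSeries (mahlerSubst (fieldArith K M) b T.k h g)) =
        ∑ j ∈ Finset.range (T.deg + 1), ∑ n ∈ Finset.range w,
          if φ.α * (b : ℤ) ^ T.k + φ.β * j - φ.γ = x.1 ∧ n * q = x.2 then
            a T.k j * vec g n else 0 := by
      intro x hx
      rw [Finset.HasAntidiagonal.mem_antidiagonal] at hx
      rw [coeff_listSeries, coeff_listSeries, htc _ (by omega), hms _ (by omega),
        Finset.sum_mul_sum]
      refine Finset.sum_congr rfl fun j _ => Finset.sum_congr rfl fun n _ => ?_
      rw [ite_and]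
      split_ifs <;> simp
    rw [Finset.sum_congr rfl hstep, Finset.sum_comm]
    refine Finset.sum_congr rfl fun j hj => ?_
    rw [Finset.sum_comm]
    refine Finset.sum_congr rfl fun n _ => ?_
    by_cases ha : a T.k j = 0
    · simp [ha]
    · have he := hpos T hT j (Nat.lt_succ_iff.mp (Finset.mem_range.mp hj)) ha
      obtain ⟨e, he'⟩ := Int.eq_ofNat_of_zero_le he
      rw [he', hqz]
      by_cases hi' : e + n * q = i
      · rw [if_pos (by exact_mod_cast hi'), Finset.sum_eq_single (e, n * q)]
        · simp
        · intro x _ hne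
          refine if_neg fun h => hne ?_
          ext
          · exact (by exact_mod_cast h.1.symm : x.1 = e)
          · exact h.2.symm
        · intro h
          exact absurd (Finset.HasAntidiagonal.mem_antidiagonal.mpr hi') h
      · rw [if_neg fun h => hi' (by exact_mod_cast h)]
        refine Finset.sum_eq_zero fun x hx => if_neg fun h => hi' ?_
        rw [Finset.HasAntidiagonal.mem_antidiagonal] at hx
        rw [h.2, ← hx]
        congr 1
        exact_mod_cast h.1
  have key : ∀ (l : List MahlerTerm), (∀ T ∈ l, T ∈ ts) → ∀ acc : List K, acc.length = h →
      let res := l.foldlM (fun acc T =>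
        mulTrunc (fieldArith K M) D h (transformedCoeff (fieldArith K M) b a φ h T)
          (mahlerSubst (fieldArith K M) b T.k h g) >>= fun p => addVec (fieldArith K M) acc p) acc
      res.val.length = h ∧ (∀ i < h, vec res.val i = vec acc i +
        rowForm (rmat b a φ l i) w (vec g)) ∧
        res.ops ≤ l.length * ((h / (D + 1) + 1) ^ 2 * (M D + h) + h) := by
    intro l
    induction l with
    | nil => intro _ acc hacc; simp [hacc, rowForm_apply, rmat]
    | cons T l ih =>
      intro hl acc hacc
      obtain ⟨h1, h2, h3⟩ := mulTrunc_spec M D h (transformedCoeff (fieldArith K M) b a φ h T)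
        (mahlerSubst (fieldArith K M) b T.k h g) (by simp [transformedCoeff_eq])
        (by simp [mahlerSubst])
      have hl1 := hacc.trans h1.symm
      obtain ⟨g1, g2, g3⟩ := ih (fun T hT => hl T (by simp [hT]))
        (addVec (fieldArith K M) acc (mulTrunc (fieldArith K M) D h
          (transformedCoeff (fieldArith K M) b a φ h T)
          (mahlerSubst (fieldArith K M) b T.k h g)).val).val
        ((length_addVec M _ _ hl1).trans hacc)
      simp only [List.foldlM_cons, Counted.val_bind, Counted.ops_bind]
      refine ⟨g1, fun i hi => ?_, ?_⟩
      · rw [g2 i hi, vec_addVec M _ _ hl1, Pi.add_apply, h2 i hi, hterm T (hl T (by simp)) i hi,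
          add_assoc]
        congr 1
        rw [rowForm_apply, rowForm_apply, sum_rmat_mul, sum_rmat_mul, List.map_cons, List.sum_cons]
      · rw [ops_addVec, h1, hacc, min_self, List.length_cons, Nat.succ_mul]
        omega
  have := key ts (fun _ h => h) (List.replicate h 0) (by simp)
  simpa [applyTransformed] using this

end Products

/-! ### Polynomial approximate solutions and their prolongation -/

section Solvers

variable {K : Type} [Field K]

/-- The vectors of length `w` annihilated by the rows of index less than `h` of the matrix `R`. -/
def truncatedKernel (R : ℤ → ℕ → K) (h w : ℕ) : Submodule K (ℕ → K) :=
  supportedBelow K w ⊓ ⨅ i : Fin h, LinearMap.ker (rowForm (R (i : ℕ)) w)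

theorem mem_truncatedKernel {R : ℤ → ℕ → K} {h w : ℕ} {f : ℕ → K} :
    f ∈ truncatedKernel R h w ↔
      (∀ i, w ≤ i → f i = 0) ∧ ∀ i : ℕ, i < h → rowForm (R i) w f = 0 := by
  simp [truncatedKernel, mem_supportedBelow, Fin.forall_iff]

/-- The first `h` coefficients of the image under the matrix `R` of a vector of length `w`. -/
def truncatedImage (R : ℤ → ℕ → K) (h w : ℕ) : (ℕ → K) →ₗ[K] (ℕ → K) :=
  LinearMap.pi fun i => if i < h then rowForm (R i) w else 0

theorem truncatedImage_apply (R : ℤ → ℕ → K) (h w : ℕ) (f : ℕ → K) (i : ℕ) :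
    truncatedImage R h w f i = if i < h then rowForm (R i) w f else 0 := by
  rw [truncatedImage, LinearMap.pi_apply]
  split_ifs <;> rfl

/-- The kernel of the rows `E i`, on which the remaining conditions are imposed, is no restriction
if these rows are among the first `h`. -/
theorem blockKernel_inf_ker_truncatedImage {R : ℤ → ℕ → K} {h w : ℕ} {E : ℕ → ℤ}
    (hE : ∀ i < w, 0 ≤ E i ∧ E i < h) :
    blockKernel (fun i => R (E i)) w ⊓ LinearMap.ker (truncatedImage R h w) =
      truncatedKernel R h w := by
  ext f
  rw [Submodule.mem_inf, mem_blockKernel, mem_truncatedKernel, LinearMap.mem_ker]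
  constructor
  · rintro ⟨⟨h1, -⟩, h2⟩
    refine ⟨h1, fun i hi => ?_⟩
    have := congrFun h2 i
    rwa [truncatedImage_apply, if_pos hi] at this
  · rintro ⟨h1, h2⟩
    refine ⟨⟨h1, fun i hi => ?_⟩, funext fun i => ?_⟩
    · obtain ⟨h3, h4⟩ := hE i hi
      obtain ⟨m, hm⟩ := Int.eq_ofNat_of_zero_le h3
      have := h2 m (by omega)
      rwa [← hm] at this
    · rw [truncatedImage_apply]
      split_ifs with hi
      · exact h2 i hi
      · rfl

variable [DecidableEq K] (M : ℕ → ℕ)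

/-- If rows `E i` of index less than `h` form a lower triangular matrix, the vectors of length `w`
annihilated by the first `h` rows are found as the combinations of a basis of the kernel of that
triangular matrix whose images have first `h` coefficients zero. The cost depends on a bound `z` for
the number of zeros on the diagonal, which bounds the dimension of the kernel. -/
theorem solvePrescribed_spec {b r d : ℕ} (hb : 2 ≤ b) (a : ℕ → ℕ → K) (φ : ChangeVar)
    (hβ : 0 < φ.β) (hcop : φ.β.Coprime b) (ts : List MahlerTerm)
    (hk : (ts.map MahlerTerm.k).Sublist (List.range (r + 1))) (hdeg : ∀ T ∈ ts, T.deg ≤ d)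
    (hpos : ∀ T ∈ ts, ∀ j ≤ T.deg, a T.k j ≠ 0 → 0 ≤ φ.α * (b : ℤ) ^ T.k + φ.β * j - φ.γ)
    (D h w : ℕ) (E : ℕ → ℤ) (hE : ∀ i < w, 0 ≤ E i ∧ E i < h)
    (htri : ∀ i j, i < j → rmat b a φ ts (E i) j = 0) :
    let F := solvePrescribed (fieldArith K M) b a φ ts D h w ((List.range w).map E)
    (∀ f ∈ F.val, f.length = w) ∧
    IsListBasis (F.val.map vec) (truncatedKernel (rmat b a φ ts) h w) ∧
    ∀ s z : ℕ, 2 * d + (r + 1) ≤ s →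
      ((Finset.range w).filter fun i => rmat b a φ ts (E i) i = 0).card ≤ z →
      F.val.length ≤ z ∧
      F.ops ≤ w * s + (w * (z * (2 * s + 2) + 1) + z * (z * (2 * w))) +
        z * ((r + 1) * ((h / (D + 1) + 1) ^ 2 * (M D + h) + h)) +
        z * (z * (1 + 2 * h + 2 * w) + h) + z * (z * (2 * w)) := by
  have hb0 : 0 < b := by omega
  obtain ⟨rows, hrows⟩ : ∃ rows, rows = ((List.range w).map E).mapM fun i =>
    buildRow (fieldArith K M) b a φ ts w i := ⟨_, rfl⟩
  have hrl : rows.val.length = w := by rw [hrows]; simp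
  have hrow : ∀ i < w, rows.val.getD i [] = (buildRow (fieldArith K M) b a φ ts w (E i)).val :=
    fun i hi => by rw [hrows]; simp [hi]
  obtain ⟨G, hG⟩ : ∃ G, G = kerLowerTriangular (fieldArith K M) rows.val := ⟨_, rfl⟩
  have hker := kerLowerTriangular_spec M (ρ := fun i => rmat b a φ ts (E i)) htri hrl
    fun i hi => by rw [hrow i hi]; exact buildRow_spec M hb0 a φ hcop ts w (E i)
  rw [← hG] at hker
  obtain ⟨hGl, hGb, hGc⟩ := hker
  obtain ⟨S, hS⟩ : ∃ S, S = G.val.mapM fun g =>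
    applyTransformed (fieldArith K M) b a φ ts D h g := ⟨_, rfl⟩
  have happ := fun g (hg : g ∈ G.val) =>
    applyTransformed_spec M hb0 a φ hβ ts hpos D h w g (hGl g hg)
  have hSval : S.val = G.val.map fun g =>
    (applyTransformed (fieldArith K M) b a φ ts D h g).val := by rw [hS]; simp
  have hSl : ∀ s ∈ S.val, s.length = h := fun s hs => by
    rw [hSval] at hs
    obtain ⟨g, hg, rfl⟩ := List.mem_map.mp hs
    exact (happ g hg).1
  have hSlen : S.val.length = G.val.length := by rw [hSval]; simp
  have hSvec : S.val.map vec = (G.val.map vec).map (truncatedImage (rmat b a φ ts) h w) := by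
    rw [hSval, List.map_map, List.map_map]
    refine List.map_congr_left fun g hg => funext fun i => ?_
    rw [Function.comp_apply, Function.comp_apply, truncatedImage_apply]
    split_ifs with hi
    · exact (happ g hg).2.1 i hi
    · exact vec_eq_zero_of_le ((happ g hg).1.le.trans (not_lt.mp hi))
  obtain ⟨Z, hZ⟩ : ∃ Z, Z = lspKernel (fieldArith K M) S.val := ⟨_, rfl⟩
  have hlsp := lspKernel_spec M S.val hSl
  rw [← hZ, hSlen, hSvec] at hlsp
  obtain ⟨hZl, hZb, hZc, hZo⟩ := hlsp
  have hrec := fun κ (hκ : κ ∈ Z.val) => recombine_spec M G.val hGl κ (hZl κ hκ)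
  have hF : solvePrescribed (fieldArith K M) b a φ ts D h w ((List.range w).map E) =
      rows >>= fun _ => G >>= fun _ => S >>= fun _ => Z >>= fun _ => Z.val.mapM fun κ =>
        (G.val.zip κ).foldlM (fun acc e => addMulVec (fieldArith K M) acc e.2 e.1)
          (List.replicate w 0) := by
    subst hZ hS hG hrows
    rfl
  rw [hF]
  simp only [Counted.val_bind, Counted.ops_bind, Counted.val_mapM, List.length_map]
  refine ⟨fun f hf => ?_, ?_, fun s z hs hz => ?_⟩
  · obtain ⟨κ, hκ, rfl⟩ := List.mem_map.mp hf
    exact (hrec κ hκ).1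
  · rw [← blockKernel_inf_ker_truncatedImage hE]
    convert hGb.ker_of_relations (truncatedImage (rmat b a φ ts) h w) (Z := Z.val.map vec)
      (by simpa using hZb) using 1
    rw [List.map_map, List.map_map]
    exact List.map_congr_left fun κ hκ => (hrec κ hκ).2.1
  · have hbl : ∀ i : ℤ, _ := fun i => length_buildRow_le M hb a φ ts w i hk hdeg
    obtain ⟨c1, c2, c3⟩ := hGc s z (fun i hi => by
      rw [hrow i hi]; exact (hbl (E i)).1.trans hs) hz
    have o1 : rows.ops ≤ w * s := by
      rw [hrows]
      refine (Counted.ops_mapM_le _ _ s fun i _ => (hbl i).2.trans hs).trans ?_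
      simp
    have hts : ts.length ≤ r + 1 := by simpa using hk.length_le
    have o2 : S.ops ≤ z * ((r + 1) * ((h / (D + 1) + 1) ^ 2 * (M D + h) + h)) := by
      rw [hS]
      refine (Counted.ops_mapM_le _ _ _ fun g hg => (happ g hg).2.2).trans ?_
      exact Nat.mul_le_mul c1 (Nat.mul_le_mul_right _ hts)
    have o3 : Z.ops ≤ z * (z * (1 + 2 * h + 2 * w) + h) := by
      refine hZo.trans (Nat.mul_le_mul c1 (Nat.add_le_add_right (Nat.mul_le_mul c1 ?_) _))
      omega
    have o4 : (Z.val.mapM fun κ =>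
        (G.val.zip κ).foldlM (fun acc e => addMulVec (fieldArith K M) acc e.2 e.1)
          (List.replicate w 0)).ops ≤ z * (z * (2 * w)) := by
      refine (Counted.ops_mapM_le _ _ _ fun κ hκ => (hrec κ hκ).2.2).trans ?_
      exact Nat.mul_le_mul (hZc.trans c1) (Nat.mul_le_mul_right _ c1)
    refine ⟨hZc.trans c1, ?_⟩
    omega

end Solvers

section Prolong

variable {K : Type} [Field K]

/-- The sequence that agrees with `f` below `w`, and whose later terms are determined by forward
substitution: the row `m + n` of the matrix `R` gives the term of index `n`. -/
def prolongSeq (R : ℤ → ℕ → K) (m : ℤ) (w : ℕ) (f : ℕ → K) (n : ℕ) : K :=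
  if n < w then f n
  else -(∑ j : Fin n, R (m + n) j * prolongSeq R m w f j) / R (m + n) n
termination_by n
decreasing_by exact j.2

theorem prolongSeq_of_lt (R : ℤ → ℕ → K) (m : ℤ) {w : ℕ} (f : ℕ → K) {n : ℕ} (hn : n < w) :
    prolongSeq R m w f n = f n := by
  rw [prolongSeq, if_pos hn]

theorem prolongSeq_of_le (R : ℤ → ℕ → K) (m : ℤ) {w : ℕ} (f : ℕ → K) {n : ℕ} (hn : w ≤ n) :
    prolongSeq R m w f n =
      -(∑ j ∈ Finset.range n, R (m + n) j * prolongSeq R m w f j) / R (m + n) n := by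
  rw [prolongSeq, if_neg hn.not_gt, Finset.sum_range]

variable [DecidableEq K] (M : ℕ → ℕ)

/-- The prolongation computed by the algorithm is the one by forward substitution; each new
coefficient costs a number of operations proportional to the number of entries of a row. -/
theorem prolong_spec {b r d : ℕ} (hb : 2 ≤ b) (a : ℕ → ℕ → K) (φ : ChangeVar)
    (hcop : φ.β.Coprime b) (ts : List MahlerTerm)
    (hk : (ts.map MahlerTerm.k).Sublist (List.range (r + 1))) (hdeg : ∀ T ∈ ts, T.deg ≤ d)
    (ν : ℕ) (v₀ : ℤ) (n' : ℕ) (f : List K) (hf : f.length = ν + 1) :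
    let z := prolong (fieldArith K M) b a φ ts ν (v₀ + ν) n' f
    z.val.length = ν + 1 + n' ∧
    (∀ n < ν + 1 + n', vec z.val n = prolongSeq (rmat b a φ ts) v₀ (ν + 1) (vec f) n) ∧
    z.ops ≤ n' * (3 * (2 * d + (r + 1)) + 2) := by
  have hb0 : 0 < b := by omega
  obtain ⟨rows, hrows⟩ : ∃ rows, rows = (List.range n').mapM fun i : ℕ =>
    buildRow (fieldArith K M) b a φ ts (ν + n' + 1) (v₀ + ν + 1 + i) := ⟨_, rfl⟩
  have hbl : ∀ i : ℤ, _ := fun i => length_buildRow_le M hb a φ ts (ν + n' + 1) i hk hdeg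
  have hrow : ∀ i < n', rows.val.getD i [] = (buildRow (fieldArith K M) b a φ ts (ν + n' + 1)
      (v₀ + ((ν + 1 + i : ℕ) : ℤ))).val := fun i hi => by
    rw [hrows]
    simp only [Counted.val_mapM, List.getD_eq_getElem?_getD, List.getElem?_map]
    rw [List.getElem?_range hi]
    simp only [Option.map_some, Option.getD_some]
    congr 2
    push_cast
    ring
  let step : List K → ℕ → Counted (List K) := fun y i => do
    let t ← dotBelow (fieldArith K M) (rows.val.getD i []) (ν + 1 + i) y
    let u ← (fieldArith K M).sub 0 t
    let z ← (fieldArith K M).div u (entryAt (fieldArith K M) (rows.val.getD i []) (ν + 1 + i))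
    pure (y ++ [z])
  have hz : prolong (fieldArith K M) b a φ ts ν (v₀ + ν) n' f =
      rows >>= fun _ => (List.range n').foldlM step f := by
    subst hrows
    have hcast : (List.range n' >>= fun i : ℕ => pure (i : ℤ)) =
        (List.range n').map fun i : ℕ => (i : ℤ) := by simp [← List.map_eq_flatMap]
    rw [prolong, hcast, List.mapM_map]
    rfl
  have key : ∀ m ≤ n', ((List.range m).foldlM step f).val.length = ν + 1 + m ∧
      (∀ n < ν + 1 + m, vec ((List.range m).foldlM step f).val n =
        prolongSeq (rmat b a φ ts) v₀ (ν + 1) (vec f) n) ∧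
      ((List.range m).foldlM step f).ops ≤ m * (2 * (2 * d + (r + 1)) + 2) := by
    intro m
    induction m with
    | zero =>
      intro _
      exact ⟨hf, fun n hn => (prolongSeq_of_lt _ _ _ hn).symm, by simp⟩
    | succ m ih =>
      intro hm
      obtain ⟨h1, h2, h3⟩ := ih (Nat.le_of_succ_le hm)
      obtain ⟨y, hy⟩ : ∃ y, y = (List.range m).foldlM step f := ⟨_, rfl⟩
      rw [← hy] at h1 h2 h3
      have hR := buildRow_spec M hb0 a φ hcop ts (ν + n' + 1) (v₀ + ((ν + 1 + m : ℕ) : ℤ))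
      have hsucc : (List.range (m + 1)).foldlM step f = y >>= fun y => step y m := by
        rw [List.range_succ, List.foldlM_append, hy]
        simp
      have hstep : (step y.val m).val = y.val ++
          [prolongSeq (rmat b a φ ts) v₀ (ν + 1) (vec f) (ν + 1 + m)] := by
        simp only [step, Counted.val_bind, val_sub, val_div, Counted.val_pure]
        rw [hrow m hm, hR.val_dotBelow M (by omega), hR.entryAt_eq M (by omega),
          prolongSeq_of_le _ _ _ (by omega), zero_sub]
        congr 4
        refine Finset.sum_congr rfl fun j hj => ?_
        rw [h2 j (Finset.mem_range.mp hj)]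
      rw [hsucc]
      simp only [Counted.val_bind, Counted.ops_bind]
      refine ⟨by rw [hstep]; simp [h1]; omega, fun n hn => ?_, ?_⟩
      · rw [hstep, vec_append_singleton _ _ _ h1]
        rcases (show n < ν + 1 + m ∨ n = ν + 1 + m by omega) with hn | rfl
        · rw [Function.update_of_ne hn.ne, h2 n hn]
        · rw [Function.update_self]
      · have h4 := ops_dotBelow_le M (rows.val.getD m []) (ν + 1 + m) y.val
        have h5 : (rows.val.getD m []).length ≤ 2 * d + (r + 1) := by
          rw [hrow m hm]; exact (hbl _).1
        have h6 : (step y.val m).ops =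
            (dotBelow (fieldArith K M) (rows.val.getD m []) (ν + 1 + m) y.val).ops + 2 := by
          simp [step]
        rw [h6, Nat.succ_mul m]
        omega
  obtain ⟨h1, h2, h3⟩ := key n' le_rfl
  have h4 : rows.ops ≤ n' * (2 * d + (r + 1)) := by
    rw [hrows]
    exact (Counted.ops_mapM_le _ _ _ fun i _ => (hbl _).2).trans (by simp)
  rw [hz]
  refine ⟨h1, h2, ?_⟩
  rw [Counted.ops_bind]
  calc _ ≤ n' * (2 * d + (r + 1)) + n' * (2 * (2 * d + (r + 1)) + 2) := Nat.add_le_add h4 h3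
    _ = _ := by ring

end Prolong

/-! ### The monomials of the operator and its Newton polygon -/

section NewtonPolygon

/-- The list `ts` describes the valuations and degrees of the nonzero polynomials among
`∑ j, a k j x ^ j`, for `k ≤ r`, by increasing `k`. -/
structure IsTermList {K : Type} [Field K] (r d : ℕ) (a : ℕ → ℕ → K) (ts : List MahlerTerm) :
    Prop where
  sublist : (ts.map MahlerTerm.k).Sublist (List.range (r + 1))
  lead : ∀ T ∈ ts, a T.k T.v ≠ 0
  v_le_deg : ∀ T ∈ ts, T.v ≤ T.deg
  deg_le : ∀ T ∈ ts, T.deg ≤ d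
  support : ∀ T ∈ ts, ∀ j ≤ d, a T.k j ≠ 0 → T.v ≤ j ∧ j ≤ T.deg
  complete : ∀ k ≤ r, ∀ j ≤ d, a k j ≠ 0 → ∃ T ∈ ts, T.k = k

/-- If the members of `l.filterMap g` remember by `key` where they come from, their keys form a
sublist of `l`. -/
theorem List.sublist_of_filterMap_key {α β : Type} (g : α → Option β) (key : β → α)
    (l : List α) (h : ∀ x ∈ l, ∀ y, g x = some y → key y = x) :
    ((l.filterMap g).map key).Sublist l := by
  induction l with
  | nil => simp
  | cons x l ih =>
    have ih' := ih fun y hy => h y (by simp [hy])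
    cases hx : g x with
    | none =>
      rw [List.filterMap_cons_none hx]
      exact ih'.cons x
    | some y =>
      rw [List.filterMap_cons_some hx, List.map_cons, h x (by simp) y hx]
      exact ih'.cons_cons x

variable {K : Type} [Field K] [DecidableEq K] (M : ℕ → ℕ)

theorem ops_mahlerTerms (r d : ℕ) (a : ℕ → ℕ → K) :
    (mahlerTerms (fieldArith K M) r d a).ops = (r + 1) * (d + 1) := by
  simp [mahlerTerms]

theorem mahlerTerms_spec (r d : ℕ) (a : ℕ → ℕ → K) :
    IsTermList r d a (mahlerTerms (fieldArith K M) r d a).val := by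
  obtain ⟨S, hS⟩ : ∃ S : ℕ → List ℕ, S = fun k =>
    (List.range (d + 1)).filter fun j => decide (a k j ≠ 0) := ⟨_, rfl⟩
  obtain ⟨g, hg⟩ : ∃ g : ℕ → Option MahlerTerm, g = fun k =>
    match (S k).head?, (S k).getLast? with
    | some v, some e => some ⟨k, v, e⟩
    | _, _ => none := ⟨_, rfl⟩
  have hval : (mahlerTerms (fieldArith K M) r d a).val = (List.range (r + 1)).filterMap g := by
    simp only [mahlerTerms, Counted.val_bind, Counted.val_pure, Counted.val_mapM, val_isZero]
    refine List.filterMap_congr fun k hk => ?_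
    have hk' := List.mem_range.mp hk
    have hSk : (List.range (d + 1)).filter (fun j => !((((List.range (r + 1)).map fun k =>
        (List.range (d + 1)).map fun j => decide (a k j = 0)).getD k []).getD j true)) = S k := by
      rw [hS]
      refine List.filter_congr fun j hj => ?_
      have hj' := List.mem_range.mp hj
      simp [hk', hj']
    rw [hSk]
    subst hg
    rfl
  have hSmem : ∀ k j, j ∈ S k ↔ j ≤ d ∧ a k j ≠ 0 := fun k j => by
    rw [hS]; simp
  have hSsorted : ∀ k, (S k).Pairwise (· < ·) := fun k => by
    rw [hS]; exact List.pairwise_lt_range.filter _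
  have hgsome : ∀ k T, g k = some T → T.k = k ∧ (S k).head? = some T.v ∧
      (S k).getLast? = some T.deg := fun k T h => by
    rw [hg] at h
    cases h1 : (S k).head? with
    | none => simp [h1] at h
    | some v =>
      cases h2 : (S k).getLast? with
      | none => simp [h2] at h
      | some e =>
        simp only [h1, h2, Option.some.injEq] at h
        subst h
        exact ⟨rfl, rfl, rfl⟩
  have hmem : ∀ T ∈ (List.range (r + 1)).filterMap g, (S T.k).head? = some T.v ∧
      (S T.k).getLast? = some T.deg := fun T hT => by
    obtain ⟨k, -, hk⟩ := List.mem_filterMap.mp hT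
    obtain ⟨h1, h2, h3⟩ := hgsome k T hk
    rw [h1]
    exact ⟨h2, h3⟩
  have hhead : ∀ k v, (S k).head? = some v → ∀ j ∈ S k, v ≤ j := fun k v hv j hj => by
    obtain ⟨ys, hys⟩ := List.head?_eq_some_iff.mp hv
    have hs := hSsorted k
    rw [hys] at hs hj
    rcases List.mem_cons.mp hj with rfl | hj
    · exact le_rfl
    · exact ((List.pairwise_cons.mp hs).1 j hj).le
  have hlast : ∀ k e, (S k).getLast? = some e → ∀ j ∈ S k, j ≤ e := fun k e he j hj => by
    obtain ⟨ys, hys⟩ := List.getLast?_eq_some_iff.mp he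
    have hs := hSsorted k
    rw [hys] at hs hj
    rcases List.mem_append.mp hj with hj | hj
    · exact ((List.pairwise_append.mp hs).2.2 j hj e (by simp)).le
    · exact (List.mem_singleton.mp hj).le
  rw [hval]
  refine ⟨List.sublist_of_filterMap_key g _ _ fun k _ T hT => (hgsome k T hT).1, fun T hT => ?_,
    fun T hT => ?_, fun T hT => ?_, fun T hT j hj ha => ?_, fun k hk j hj ha => ?_⟩
  · exact ((hSmem _ _).mp (List.mem_of_mem_head? (hmem T hT).1)).2
  · exact hlast _ _ (hmem T hT).2 _ (List.mem_of_mem_head? (hmem T hT).1)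
  · exact ((hSmem _ _).mp (List.mem_of_getLast? (hmem T hT).2)).1
  · have := (hSmem T.k j).mpr ⟨hj, ha⟩
    exact ⟨hhead _ _ (hmem T hT).1 j this, hlast _ _ (hmem T hT).2 j this⟩
  · have hne : S k ≠ [] := List.ne_nil_of_mem ((hSmem k j).mpr ⟨hj, ha⟩)
    refine ⟨⟨k, (S k).head hne, (S k).getLast hne⟩, List.mem_filterMap.mpr ⟨k, ?_, ?_⟩, rfl⟩
    · exact List.mem_range.mpr (Nat.lt_succ_of_le hk)
    · rw [hg]
      simp only [List.head?_eq_some_head hne, List.getLast?_eq_some_getLast hne]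

omit [DecidableEq K] in
theorem IsTermList.eq_of_k_eq {r d : ℕ} {a : ℕ → ℕ → K} {ts : List MahlerTerm}
    (h : IsTermList r d a ts) {T T' : MahlerTerm} (hT : T ∈ ts) (hT' : T' ∈ ts)
    (hk : T.k = T'.k) : T = T' :=
  List.inj_on_of_nodup_map (h.sublist.nodup List.nodup_range) hT hT' hk

omit [DecidableEq K] in
theorem IsTermList.nodup {r d : ℕ} {a : ℕ → ℕ → K} {ts : List MahlerTerm}
    (h : IsTermList r d a ts) : ts.Nodup :=
  List.Nodup.of_map _ (h.sublist.nodup List.nodup_range)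

omit [DecidableEq K] in
theorem IsTermList.k_le {r d : ℕ} {a : ℕ → ℕ → K} {ts : List MahlerTerm}
    (h : IsTermList r d a ts) {T : MahlerTerm} (hT : T ∈ ts) : T.k ≤ r :=
  Nat.lt_succ_iff.mp (List.mem_range.mp (h.sublist.subset (List.mem_map_of_mem hT)))

omit [DecidableEq K] in
theorem IsTermList.length_le {r d : ℕ} {a : ℕ → ℕ → K} {ts : List MahlerTerm}
    (h : IsTermList r d a ts) : ts.length ≤ r + 1 := by
  simpa using h.sublist.length_le

theorem mem_newtonEdges {b : ℕ} {ts : List MahlerTerm} {e : ℚ × ℚ} :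
    e ∈ newtonEdges b ts ↔ ∃ T₁ ∈ ts, ∃ T₂ ∈ ts, T₁.k < T₂.k ∧
      e.1 = ((T₂.v : ℚ) - T₁.v) / ((b : ℚ) ^ T₂.k - (b : ℚ) ^ T₁.k) ∧
      (∀ T ∈ ts, T₁.intercept b e.1 ≤ T.intercept b e.1) ∧ e.2 = T₁.intercept b e.1 := by
  rw [newtonEdges, List.mem_dedup, List.mem_flatMap]
  constructor
  · rintro ⟨T₁, h1, h⟩
    obtain ⟨T₂, h2, h⟩ := List.mem_filterMap.mp h
    simp only [Option.ite_none_right_eq_some, Option.some.injEq] at h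
    obtain ⟨⟨h3, h4⟩, rfl⟩ := h
    exact ⟨T₁, h1, T₂, h2, h3, rfl, h4, rfl⟩
  · rintro ⟨T₁, h1, T₂, h2, h3, h4, h5, h6⟩
    refine ⟨T₁, h1, List.mem_filterMap.mpr ⟨T₂, h2, ?_⟩⟩
    simp only [Option.ite_none_right_eq_some, Option.some.injEq]
    rw [← h4]
    exact ⟨⟨h3, h5⟩, Prod.ext rfl h6.symm⟩

theorem pow_lt_pow_rat {b : ℕ} (hb : 2 ≤ b) {k l : ℕ} (h : k < l) : (b : ℚ) ^ k < (b : ℚ) ^ l :=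
  pow_lt_pow_right₀ (by exact_mod_cast (by omega : 1 < b)) h

omit [DecidableEq K] in
/-- An edge of the Newton polygon is determined by its left end, so that there are at most `r + 1`
of them. -/
theorem length_newtonEdges_le {b r d : ℕ} (hb : 2 ≤ b) {a : ℕ → ℕ → K} {ts : List MahlerTerm}
    (h : IsTermList r d a ts) : (newtonEdges b ts).length ≤ r + 1 := by
  have h1 : (newtonEdges b ts).length = (newtonEdges b ts).toFinset.card := by
    rw [List.card_toFinset, newtonEdges, List.dedup_idem]
  rw [h1, ← Finset.card_range (r + 1)]
  -- with the left end fixed, the slope of an edge is at most that of a segment to another monomial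
  have hle : ∀ T₁ T₂ T₂' : MahlerTerm, ∀ s s' : ℚ, T₁.k < T₂.k → T₁.k < T₂'.k →
      s' = ((T₂'.v : ℚ) - T₁.v) / ((b : ℚ) ^ T₂'.k - (b : ℚ) ^ T₁.k) →
      T₁.intercept b s ≤ T₂'.intercept b s → s ≤ s' := by
    intro T₁ T₂ T₂' s s' _ h2 hs' h3
    have hpos := sub_pos.mpr (pow_lt_pow_rat hb h2)
    rw [hs', le_div_iff₀ hpos]
    simp only [MahlerTerm.intercept] at h3
    linarith
  refine Finset.card_le_card_of_forall_subsingleton (fun (e : ℚ × ℚ) k => ∃ T₁ ∈ ts, T₁.k = k ∧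
    ∃ T₂ ∈ ts, T₁.k < T₂.k ∧ e.1 = ((T₂.v : ℚ) - T₁.v) / ((b : ℚ) ^ T₂.k - (b : ℚ) ^ T₁.k) ∧
      (∀ T ∈ ts, T₁.intercept b e.1 ≤ T.intercept b e.1) ∧ e.2 = T₁.intercept b e.1) ?_ ?_
  · intro e he
    obtain ⟨T₁, g1, T₂, g2⟩ := mem_newtonEdges.mp (List.mem_toFinset.mp he)
    exact ⟨T₁.k, Finset.mem_range.mpr (Nat.lt_succ_of_le (h.k_le g1)), T₁, g1, rfl, T₂, g2⟩
  · rintro k - e ⟨-, T₁, g1, g2, T₂, g3, g4, g5, g6, g7⟩ e'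
      ⟨-, T₁', g1', g2', T₂', g3', g4', g5', g6', g7'⟩
    obtain rfl := h.eq_of_k_eq g1 g1' (g2.trans g2'.symm)
    have hs : e.1 = e'.1 := le_antisymm
      (hle T₁ T₂ T₂' _ _ g4 g4' g5' (g6 _ g3')) (hle T₁ T₂' T₂ _ _ g4' g4 g5 (g6' _ g3))
    exact Prod.ext hs (by rw [g7, g7', hs])

/-- An edge is admissible if the coefficients of its monomials add up to zero. -/
def IsAdmissible (b : ℕ) (a : ℕ → ℕ → K) (ts : List MahlerTerm) (e : ℚ × ℚ) : Prop :=
  ((ts.filter fun T => T.intercept b e.1 = e.2).map fun T => a T.k T.v).sum = 0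

/-- The first admissible edge of a list: every other admissible edge comes later, that is, it is
related to the first one by any relation `R` that orders the list. -/
theorem firstAdmissible_spec (b : ℕ) (a : ℕ → ℕ → K) (ts : List MahlerTerm) (es : List (ℚ × ℚ)) :
    ((firstAdmissible (fieldArith K M) b a ts es).val = none → ∀ e ∈ es, ¬ IsAdmissible b a ts e) ∧
    (∀ e, (firstAdmissible (fieldArith K M) b a ts es).val = some e → e ∈ es ∧
      ∀ R : ℚ × ℚ → ℚ × ℚ → Prop, es.Pairwise R → ∀ e' ∈ es, IsAdmissible b a ts e' →
        e' = e ∨ R e e') ∧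
    (firstAdmissible (fieldArith K M) b a ts es).ops ≤ es.length * (ts.length + 1) := by
  induction es with
  | nil => simp [firstAdmissible]
  | cons e es ih =>
    obtain ⟨s, c⟩ := e
    obtain ⟨ih1, ih2, ih3⟩ := ih
    obtain ⟨t, ht⟩ : ∃ t, t = (ts.filter fun T => T.intercept b s = c).foldlM
      (fun acc T => (fieldArith K M).add acc (a T.k T.v)) (0 : K) := ⟨_, rfl⟩
    have htv : t.val = 0 ↔ IsAdmissible b a ts (s, c) := by
      have key : ∀ (l : List MahlerTerm) (x : K),
          l.foldl (fun acc T => acc + a T.k T.v) x = x + (l.map fun T => a T.k T.v).sum := by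
        intro l
        induction l with
        | nil => simp
        | cons T l ih => intro x; rw [List.foldl_cons, ih, List.map_cons, List.sum_cons, add_assoc]
      rw [ht, Counted.val_foldlM]
      simp only [val_add]
      rw [key, zero_add, IsAdmissible]
    have hto : t.ops ≤ ts.length := by
      rw [ht]
      refine ((Counted.foldlM_spec _ _ _ (fun _ => True) 1 trivial
        fun _ _ _ _ => ⟨trivial, by simp⟩).2).trans ?_
      rw [Nat.mul_one]
      exact List.length_filter_le _ _
    have hcons : firstAdmissible (fieldArith K M) b a ts ((s, c) :: es) =
        t >>= fun _ => (fieldArith K M).isZero t.val >>= fun z => if z = true then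
          pure (some (s, c)) else firstAdmissible (fieldArith K M) b a ts es := by
      subst ht; rfl
    by_cases h0 : t.val = 0
    · have hval : (firstAdmissible (fieldArith K M) b a ts ((s, c) :: es)).val = some (s, c) ∧
          (firstAdmissible (fieldArith K M) b a ts ((s, c) :: es)).ops = t.ops + 1 := by
        rw [hcons]
        simp [h0]
      rw [hval.1, hval.2]
      refine ⟨by simp, fun e he => ?_, ?_⟩
      · rw [Option.some.injEq] at he
        subst he
        refine ⟨by simp, fun R hR e' he' _ => ?_⟩
        rcases List.mem_cons.mp he' with rfl | he'
        · exact Or.inl rfl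
        · exact Or.inr ((List.pairwise_cons.mp hR).1 e' he')
      · rw [List.length_cons, Nat.succ_mul]
        omega
    · have hval : (firstAdmissible (fieldArith K M) b a ts ((s, c) :: es)).val =
          (firstAdmissible (fieldArith K M) b a ts es).val ∧
          (firstAdmissible (fieldArith K M) b a ts ((s, c) :: es)).ops =
          t.ops + (1 + (firstAdmissible (fieldArith K M) b a ts es).ops) := by
        rw [hcons]
        simp [h0]
      rw [hval.1, hval.2]
      refine ⟨fun hn e he => ?_, fun e he => ?_, ?_⟩
      · rcases List.mem_cons.mp he with rfl | he
        · exact fun h => h0 (htv.mpr h)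
        · exact ih1 hn e he
      · obtain ⟨h1, h2⟩ := ih2 e he
        refine ⟨by simp [h1], fun R hR e' he' hadm => ?_⟩
        rcases List.mem_cons.mp he' with rfl | he'
        · exact absurd (htv.mpr hadm) h0
        · exact h2 R (List.pairwise_cons.mp hR).2 e' he' hadm
      · rw [List.length_cons, Nat.succ_mul]
        omega

theorem rightmostAdmissibleEdge_spec {b r d : ℕ} (hb : 2 ≤ b) (N : ℕ) (a : ℕ → ℕ → K)
    {ts : List MahlerTerm} (h : IsTermList r d a ts) :
    let res := rightmostAdmissibleEdge (fieldArith K M) b N a ts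
    (res.val = none → ∀ e ∈ newtonEdges b ts, ((N : ℚ) * e.1).den = 1 → ¬ IsAdmissible b a ts e) ∧
    (∀ e, res.val = some e → e ∈ newtonEdges b ts ∧ ((N : ℚ) * e.1).den = 1 ∧
      ∀ e' ∈ newtonEdges b ts, ((N : ℚ) * e'.1).den = 1 → IsAdmissible b a ts e' → e'.1 ≤ e.1) ∧
    res.ops ≤ (r + 1) * (r + 2) := by
  obtain ⟨es, hes⟩ : ∃ es, es = (((newtonEdges b ts).filter fun e =>
    ((N : ℚ) * e.1).den = 1).mergeSort fun e e' => decide (e'.1 ≤ e.1)) := ⟨_, rfl⟩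
  have hmem : ∀ e, e ∈ es ↔ e ∈ newtonEdges b ts ∧ ((N : ℚ) * e.1).den = 1 := fun e => by
    rw [hes, List.mem_mergeSort, List.mem_filter, decide_eq_true_iff]
  have hsort : es.Pairwise fun e e' => e'.1 ≤ e.1 := by
    rw [hes]
    refine (List.pairwise_mergeSort (fun x y z hxy hyz => ?_) (fun x y => ?_) _).imp
      fun {x y} hxy => of_decide_eq_true hxy
    · exact decide_eq_true ((of_decide_eq_true hyz).trans (of_decide_eq_true hxy))
    · simpa using le_total y.1 x.1
  have hlen : es.length ≤ r + 1 := by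
    rw [hes, List.length_mergeSort]
    exact (List.length_filter_le _ _).trans (length_newtonEdges_le hb h)
  have hres : rightmostAdmissibleEdge (fieldArith K M) b N a ts =
      firstAdmissible (fieldArith K M) b a ts es := by rw [hes]; rfl
  obtain ⟨h1, h2, h3⟩ := firstAdmissible_spec M b a ts es
  rw [hres]
  refine ⟨fun hn e he hd => h1 hn e ((hmem e).mpr ⟨he, hd⟩), fun e he => ?_, ?_⟩
  · obtain ⟨g1, g2⟩ := h2 e he
    refine ⟨((hmem e).mp g1).1, ((hmem e).mp g1).2, fun e' he' hd hadm => ?_⟩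
    rcases g2 _ hsort e' ((hmem e').mpr ⟨he', hd⟩) hadm with rfl | h
    · exact le_rfl
    · exact h
  · exact h3.trans (Nat.mul_le_mul hlen (Nat.succ_le_succ h.length_le))

end NewtonPolygon

/-! ### Parameters of the transformed operator -/

section Parameters

variable {K : Type} [Field K]

/-- The change of variables `φ` moves an edge of the lower Newton polygon with monomials of degrees
`k₁ < k₂` in `M` to the horizontal axis: the transformed valuations are nonnegative, and zero at
both ends of the edge. The coefficient of `M ^ 0` is supposed to be nonzero. -/
structure IsEdgeChange (b r d : ℕ) (a : ℕ → ℕ → K) (φ : ChangeVar) (ts : List MahlerTerm) :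
    Prop where
  terms : IsTermList r d a ts
  two_le : 2 ≤ b
  beta_pos : 0 < φ.β
  coprime : φ.β.Coprime b
  tval_nonneg : ∀ T ∈ ts, 0 ≤ T.tval b φ
  edge : ∃ T₁ ∈ ts, ∃ T₂ ∈ ts, T₁.k < T₂.k ∧ T₁.tval b φ = 0 ∧ T₂.tval b φ = 0
  constant : ∃ T ∈ ts, T.k = 0

variable {b r d : ℕ} {a : ℕ → ℕ → K} {φ : ChangeVar} {ts : List MahlerTerm}

theorem tval₀_eq (h : IsTermList r d a ts) {T : MahlerTerm} (hT : T ∈ ts) (hk : T.k = 0) :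
    tval₀ b φ ts = T.tval b φ := by
  have hmem : T ∈ ts.filter fun T => T.k = 0 := List.mem_filter.mpr ⟨hT, by simpa using hk⟩
  cases hl : ts.filter fun T => T.k = 0 with
  | nil => rw [hl] at hmem; simp at hmem
  | cons T' l =>
    have hT' : T' ∈ ts.filter fun T => T.k = 0 := by rw [hl]; simp
    obtain ⟨h1, h2⟩ := List.mem_filter.mp hT'
    obtain rfl := h.eq_of_k_eq hT h1 (hk.trans (of_decide_eq_true h2).symm)
    simp [tval₀, hl]

theorem nuT_spec (hex : ∃ T ∈ ts, 1 ≤ T.k) :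
    (∃ T ∈ ts, 1 ≤ T.k ∧
      nuT b φ ts = ((tval₀ b φ ts : ℚ) - T.tval b φ) / ((b : ℚ) ^ T.k - 1)) ∧
    ∀ T ∈ ts, 1 ≤ T.k →
      ((tval₀ b φ ts : ℚ) - T.tval b φ) / ((b : ℚ) ^ T.k - 1) ≤ nuT b φ ts := by
  obtain ⟨l, hl⟩ : ∃ l, l = (ts.filter fun T => 1 ≤ T.k).map fun T =>
    ((tval₀ b φ ts : ℚ) - T.tval b φ) / ((b : ℚ) ^ T.k - 1) := ⟨_, rfl⟩
  have hmem : ∀ x, x ∈ l ↔ ∃ T ∈ ts, 1 ≤ T.k ∧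
      x = ((tval₀ b φ ts : ℚ) - T.tval b φ) / ((b : ℚ) ^ T.k - 1) := fun x => by
    rw [hl, List.mem_map]
    constructor
    · rintro ⟨T, hT, rfl⟩
      rw [List.mem_filter, decide_eq_true_iff] at hT
      exact ⟨T, hT.1, hT.2, rfl⟩
    · rintro ⟨T, h1, h2, rfl⟩
      exact ⟨T, List.mem_filter.mpr ⟨h1, decide_eq_true h2⟩, rfl⟩
  have hnu : nuT b φ ts = (l.max?).getD 0 := by rw [hl]; rfl
  obtain ⟨T, hT, hTk⟩ := hex
  cases hm : l.max? with
  | none =>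
    rw [List.max?_eq_none_iff] at hm
    have := (hmem _).mpr ⟨T, hT, hTk, rfl⟩
    rw [hm] at this
    simp at this
  | some x =>
    rw [hnu, hm, Option.getD_some]
    obtain ⟨h1, h2⟩ := List.max?_eq_some_iff.mp hm
    exact ⟨(hmem x).mp h1, fun T h3 h4 => h2 _ ((hmem _).mpr ⟨T, h3, h4, rfl⟩)⟩

theorem profileRow_spec (hne : ts ≠ []) (n : ℕ) :
    (∃ T ∈ ts, profileRow b φ ts n = T.tval b φ + n * (b : ℤ) ^ T.k) ∧
    ∀ T ∈ ts, profileRow b φ ts n ≤ T.tval b φ + n * (b : ℤ) ^ T.k := by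
  cases hm : (ts.map fun T => T.tval b φ + n * (b : ℤ) ^ T.k).min? with
  | none =>
    rw [List.min?_eq_none_iff, List.map_eq_nil_iff] at hm
    exact absurd hm hne
  | some x =>
    rw [profileRow, hm, Option.getD_some]
    obtain ⟨h1, h2⟩ := List.min?_eq_some_iff.mp hm
    obtain ⟨T, hT, rfl⟩ := List.mem_map.mp h1
    exact ⟨⟨T, hT, rfl⟩, fun T' hT' => h2 _ (List.mem_map_of_mem hT')⟩

/-- An entry of the infinite matrix on or above the profile of its column. -/
theorem rmat_eq_of_le (h : IsTermList r d a ts) (hβ : 0 < φ.β) {i : ℤ} {n : ℕ}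
    (hle : ∀ T ∈ ts, i ≤ T.tval b φ + n * (b : ℤ) ^ T.k) :
    rmat b a φ ts i n =
      (ts.map fun T => if T.tval b φ + n * (b : ℤ) ^ T.k = i then a T.k T.v else 0).sum := by
  rw [rmat]
  congr 1
  refine List.map_congr_left fun T hT => ?_
  have hvd := h.v_le_deg T hT
  have hdd := h.deg_le T hT
  have htv : T.tval b φ = φ.α * (b : ℤ) ^ T.k + φ.β * T.v - φ.γ := rfl
  rw [Finset.sum_eq_single T.v]
  · rw [htv]
  · intro j hj hne
    have hj' := Finset.mem_range.mp hj
    by_cases ha : a T.k j = 0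
    · rw [ha, ite_self]
    · refine if_neg fun heq => ?_
      have h1 := (h.support T hT j (by omega) ha).1
      have h2 := hle T hT
      have h3 : (φ.β : ℤ) * (T.v + 1) ≤ φ.β * j :=
        mul_le_mul_of_nonneg_left (by exact_mod_cast (lt_of_le_of_ne h1 hne.symm)) (by positivity)
      have h4 : (0 : ℤ) < φ.β := by exact_mod_cast hβ
      rw [htv] at h2
      linarith
  · intro hj
    exact absurd (Finset.mem_range.mpr (Nat.lt_succ_of_le hvd)) hj

theorem rmat_eq_zero_of_lt (h : IsTermList r d a ts) (hβ : 0 < φ.β) {i : ℤ} {n : ℕ}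
    (hlt : ∀ T ∈ ts, i < T.tval b φ + n * (b : ℤ) ^ T.k) : rmat b a φ ts i n = 0 := by
  rw [rmat_eq_of_le h hβ fun T hT => (hlt T hT).le]
  refine List.sum_eq_zero fun x hx => ?_
  obtain ⟨T, hT, rfl⟩ := List.mem_map.mp hx
  exact if_neg (hlt T hT).ne'

/-- An entry on the profile to which a single coefficient of the operator contributes. -/
theorem rmat_eq_lead (h : IsTermList r d a ts) (hβ : 0 < φ.β) {i : ℤ} {n : ℕ} {T : MahlerTerm}
    (hT : T ∈ ts) (heq : T.tval b φ + n * (b : ℤ) ^ T.k = i)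
    (hlt : ∀ T' ∈ ts, T' ≠ T → i < T'.tval b φ + n * (b : ℤ) ^ T'.k) :
    rmat b a φ ts i n = a T.k T.v := by
  classical
  have hle : ∀ T' ∈ ts, i ≤ T'.tval b φ + n * (b : ℤ) ^ T'.k := fun T' hT' => by
    by_cases hTT : T' = T
    · rw [hTT, heq]
    · exact (hlt T' hT' hTT).le
  rw [rmat_eq_of_le h hβ hle, ← List.sum_toFinset _ h.nodup,
    Finset.sum_eq_single T, if_pos heq]
  · intro T' hT' hne
    exact if_neg (hlt T' (List.mem_toFinset.mp hT') hne).ne'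
  · intro hn
    exact absurd (List.mem_toFinset.mpr hT) hn

theorem one_lt_pow_rat (hb : 2 ≤ b) {k : ℕ} (hk : 1 ≤ k) : (2 : ℚ) ≤ (b : ℚ) ^ k := by
  have : b ^ 1 ≤ b ^ k := Nat.pow_le_pow_right (by omega) hk
  rw [pow_one] at this
  exact_mod_cast hb.trans this

namespace IsEdgeChange

theorem exists_pos (H : IsEdgeChange b r d a φ ts) : ∃ T ∈ ts, 1 ≤ T.k := by
  obtain ⟨_, _, T₂, h2, h3, _⟩ := H.edge
  exact ⟨T₂, h2, by omega⟩

theorem ne_nil (H : IsEdgeChange b r d a φ ts) : ts ≠ [] := by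
  obtain ⟨T, hT, -⟩ := H.constant
  exact List.ne_nil_of_mem hT

theorem tval₀_nonneg (H : IsEdgeChange b r d a φ ts) : 0 ≤ tval₀ b φ ts := by
  obtain ⟨T, hT, hk⟩ := H.constant
  rw [tval₀_eq H.terms hT hk]
  exact H.tval_nonneg T hT

theorem nuT_nonneg (H : IsEdgeChange b r d a φ ts) : 0 ≤ nuT b φ ts := by
  obtain ⟨_, _, T₂, h2, h3, _, h5⟩ := H.edge
  refine le_trans (div_nonneg ?_ ?_) ((nuT_spec H.exists_pos).2 T₂ h2 (by omega))
  · rw [h5, Int.cast_zero, sub_zero]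
    exact_mod_cast H.tval₀_nonneg
  · linarith [one_lt_pow_rat H.two_le (show 1 ≤ T₂.k by omega)]

theorem natCast_floor_nuT (H : IsEdgeChange b r d a φ ts) :
    ((⌊nuT b φ ts⌋.toNat : ℕ) : ℤ) = ⌊nuT b φ ts⌋ :=
  Int.toNat_of_nonneg (Int.floor_nonneg.mpr H.nuT_nonneg)

theorem floor_muT (H : IsEdgeChange b r d a φ ts) :
    ⌊muT b φ ts⌋ = tval₀ b φ ts + (⌊nuT b φ ts⌋.toNat : ℕ) := by
  rw [muT, Int.floor_intCast_add, H.natCast_floor_nuT]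

/-- Beyond the index `ν`, the coefficient of `M ^ 0` alone determines the profile. -/
theorem lt_of_floor_lt (H : IsEdgeChange b r d a φ ts) {n : ℕ} (hn : ⌊nuT b φ ts⌋.toNat < n)
    {T : MahlerTerm} (hT : T ∈ ts) (hk : 1 ≤ T.k) :
    tval₀ b φ ts + n < T.tval b φ + n * (b : ℤ) ^ T.k := by
  have h1 : nuT b φ ts < n := by
    have : ⌊nuT b φ ts⌋ < n := by rw [← H.natCast_floor_nuT]; exact_mod_cast hn
    exact_mod_cast Int.floor_lt.mp this
  have h2 := ((nuT_spec H.exists_pos).2 T hT hk).trans_lt h1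
  rw [div_lt_iff₀ (by linarith [one_lt_pow_rat H.two_le hk])] at h2
  have h3 : ((tval₀ b φ ts + n : ℤ) : ℚ) < ((T.tval b φ + n * (b : ℤ) ^ T.k : ℤ) : ℚ) := by
    push_cast
    linarith
  exact_mod_cast h3

theorem tval₀_add_le (H : IsEdgeChange b r d a φ ts) {n : ℕ} (hn : ⌊nuT b φ ts⌋.toNat < n)
    {T : MahlerTerm} (hT : T ∈ ts) : tval₀ b φ ts + n ≤ T.tval b φ + n * (b : ℤ) ^ T.k := by
  rcases Nat.eq_zero_or_pos T.k with hk | hk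
  · rw [tval₀_eq H.terms hT hk, hk, pow_zero, mul_one]
  · exact (H.lt_of_floor_lt hn hT hk).le

theorem rmat_eq_zero_of_tval₀_lt (H : IsEdgeChange b r d a φ ts) {i : ℤ} {n : ℕ}
    (hn : ⌊nuT b φ ts⌋.toNat < n) (hi : i < tval₀ b φ ts + n) : rmat b a φ ts i n = 0 :=
  rmat_eq_zero_of_lt H.terms H.beta_pos fun _ hT => hi.trans_le (H.tval₀_add_le hn hT)

theorem rmat_diag_ne_zero (H : IsEdgeChange b r d a φ ts) {n : ℕ}
    (hn : ⌊nuT b φ ts⌋.toNat < n) : rmat b a φ ts (tval₀ b φ ts + n) n ≠ 0 := by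
  obtain ⟨T, hT, hk⟩ := H.constant
  rw [rmat_eq_lead H.terms H.beta_pos hT]
  · exact H.terms.lead T hT
  · rw [tval₀_eq H.terms hT hk, hk, pow_zero, mul_one]
  · intro T' hT' hne
    refine H.lt_of_floor_lt hn hT' (Nat.one_le_iff_ne_zero.mpr fun h0 => hne ?_)
    exact H.terms.eq_of_k_eq hT' hT (h0.trans hk.symm)

theorem pow_pos (H : IsEdgeChange b r d a φ ts) (k : ℕ) : (1 : ℤ) ≤ (b : ℤ) ^ k := by
  have : 1 ≤ b ^ k := Nat.one_le_pow _ _ (by have := H.two_le; omega)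
  exact_mod_cast this

/-- Each row of the infinite matrix has finitely many nonzero entries. -/
theorem rmat_eq_zero_of_row_lt (H : IsEdgeChange b r d a φ ts) {i : ℤ} {n : ℕ} (hi : i < n) :
    rmat b a φ ts i n = 0 :=
  rmat_eq_zero_of_lt H.terms H.beta_pos fun T hT => by
    have h1 := H.tval_nonneg T hT
    have h2 : (n : ℤ) * 1 ≤ n * (b : ℤ) ^ T.k :=
      mul_le_mul_of_nonneg_left (H.pow_pos T.k) (Int.natCast_nonneg n)
    omega

theorem exponent_nonneg (H : IsEdgeChange b r d a φ ts) {T : MahlerTerm} (hT : T ∈ ts) {j : ℕ}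
    (hj : j ≤ T.deg) (ha : a T.k j ≠ 0) : 0 ≤ φ.α * (b : ℤ) ^ T.k + φ.β * j - φ.γ := by
  have h1 := (H.terms.support T hT j (hj.trans (H.terms.deg_le T hT)) ha).1
  have h2 : (φ.β : ℤ) * T.v ≤ φ.β * j :=
    mul_le_mul_of_nonneg_left (by exact_mod_cast h1) (Int.natCast_nonneg _)
  have h3 : 0 ≤ φ.α * (b : ℤ) ^ T.k + φ.β * T.v - φ.γ := H.tval_nonneg T hT
  linarith

theorem profileRow_mem_range (H : IsEdgeChange b r d a φ ts) (n : ℕ) :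
    0 ≤ profileRow b φ ts n ∧ profileRow b φ ts n ≤ tval₀ b φ ts + n := by
  obtain ⟨⟨T, hT, h1⟩, h2⟩ := profileRow_spec (b := b) (φ := φ) H.ne_nil n
  obtain ⟨T₀, hT₀, hk⟩ := H.constant
  constructor
  · rw [h1]
    have h3 := H.tval_nonneg T hT
    have h4 := H.pow_pos T.k
    positivity
  · have := h2 T₀ hT₀
    rwa [← tval₀_eq H.terms hT₀ hk, hk, pow_zero, mul_one] at this

theorem rmat_profileRow_eq_zero (H : IsEdgeChange b r d a φ ts) {i j : ℕ} (hij : i < j) :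
    rmat b a φ ts (profileRow b φ ts i) j = 0 :=
  rmat_eq_zero_of_lt H.terms H.beta_pos fun T hT => by
    refine ((profileRow_spec (b := b) (φ := φ) H.ne_nil i).2 T hT).trans_lt ?_
    have h1 : (i : ℤ) < j := by exact_mod_cast hij
    have h2 := mul_lt_mul_of_pos_right h1 (show (0 : ℤ) < (b : ℤ) ^ T.k by
      have := H.pow_pos T.k; omega)
    linarith

/-- A zero on the diagonal of the triangular submatrix corresponds to an edge of the Newton polygon
of the transformed operator, and different zeros to edges of different slopes. -/
theorem card_zero_diag_le [DecidableEq K] (H : IsEdgeChange b r d a φ ts) (w : ℕ) :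
    ((Finset.range w).filter fun i => rmat b a φ ts (profileRow b φ ts i) i = 0).card ≤ r + 1 := by
  have hprof := fun i : ℕ => profileRow_spec (b := b) (φ := φ) H.ne_nil i
  have hpow : ∀ {k l : ℕ}, k < l → (b : ℤ) ^ k < (b : ℤ) ^ l := fun h =>
    pow_lt_pow_right₀ (by have := H.two_le; exact_mod_cast this) h
  rw [← Finset.card_range (r + 1)]
  refine (Finset.card_le_card_of_forall_subsingleton (fun (i k : ℕ) => ∃ T ∈ ts, T.k = k ∧
    ∃ T' ∈ ts, T.k < T'.k ∧ profileRow b φ ts i = T.tval b φ + i * (b : ℤ) ^ T.k ∧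
      profileRow b φ ts i = T'.tval b φ + i * (b : ℤ) ^ T'.k) ?_ ?_)
  · intro i hi
    have h0 := (Finset.mem_filter.mp hi).2
    obtain ⟨⟨T, hT, h1⟩, h2⟩ := hprof i
    have hex : ∃ T' ∈ ts, T' ≠ T ∧ profileRow b φ ts i = T'.tval b φ + i * (b : ℤ) ^ T'.k := by
      by_contra hcon
      push Not at hcon
      refine H.terms.lead T hT ?_
      rw [← rmat_eq_lead H.terms H.beta_pos hT h1.symm fun T' hT' hne =>
        lt_of_le_of_ne (h2 T' hT') (hcon T' hT' hne)]
      exact h0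
    obtain ⟨T', hT', hne, h3⟩ := hex
    have hk : T.k ≠ T'.k := fun hk => hne (H.terms.eq_of_k_eq hT' hT hk.symm)
    rcases lt_or_gt_of_ne hk with hk | hk
    · exact ⟨T.k, Finset.mem_range.mpr (Nat.lt_succ_of_le (H.terms.k_le hT)), T, hT, rfl, T', hT',
        hk, h1, h3⟩
    · exact ⟨T'.k, Finset.mem_range.mpr (Nat.lt_succ_of_le (H.terms.k_le hT')), T', hT', rfl, T,
        hT, hk, h3, h1⟩
  · -- the second point of the later edge would lie below the earlier edge
    have key : ∀ (i i' : ℕ) (T T' : MahlerTerm), T' ∈ ts → i < i' → T.k < T'.k →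
        profileRow b φ ts i = T.tval b φ + i * (b : ℤ) ^ T.k →
        profileRow b φ ts i' = T.tval b φ + i' * (b : ℤ) ^ T.k →
        profileRow b φ ts i' ≠ T'.tval b φ + i' * (b : ℤ) ^ T'.k := by
      intro i i' T T' hT' hi hk h1 h2 h3
      have h4 := (hprof i).2 T' hT'
      have h5 : (0 : ℤ) < ((i' : ℤ) - i) * ((b : ℤ) ^ T'.k - (b : ℤ) ^ T.k) :=
        mul_pos (by omega) (sub_pos.mpr (hpow hk))
      nlinarith
    rintro k - i ⟨-, T, g1, g2, T₂, g3, g4, g5, g6⟩ i' ⟨-, T', g1', g2', T₂', g3', g4', g5', g6'⟩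
    obtain rfl := H.terms.eq_of_k_eq g1 g1' (g2.trans g2'.symm)
    rcases lt_trichotomy i i' with hi | hi | hi
    · exact absurd g6' (key i i' T T₂' g3' hi g4' g5 g5')
    · exact hi
    · exact absurd g6 (key i' i T T₂ g3 hi g4 g5' g5)

/-! ### Bounds on the parameters -/

theorem v_le (H : IsEdgeChange b r d a φ ts) {T : MahlerTerm} (hT : T ∈ ts) : T.v ≤ d :=
  (H.terms.v_le_deg T hT).trans (H.terms.deg_le T hT)

/-- The parameter `ν` in terms of the original operator. -/
theorem nuT_term (H : IsEdgeChange b r d a φ ts) {T₀ T : MahlerTerm} (hT₀ : T₀ ∈ ts)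
    (hk₀ : T₀.k = 0) (hk : 1 ≤ T.k) :
    ((tval₀ b φ ts : ℚ) - T.tval b φ) / ((b : ℚ) ^ T.k - 1) =
      -φ.α + φ.β * (((T₀.v : ℚ) - T.v) / ((b : ℚ) ^ T.k - 1)) := by
  have hpos : (b : ℚ) ^ T.k - 1 ≠ 0 := by linarith [one_lt_pow_rat H.two_le hk]
  rw [tval₀_eq H.terms hT₀ hk₀, MahlerTerm.tval, MahlerTerm.tval, hk₀]
  push_cast
  field_simp
  ring

theorem abs_slope_le (H : IsEdgeChange b r d a φ ts) {T₀ T : MahlerTerm} (hT₀ : T₀ ∈ ts)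
    (hT : T ∈ ts) (hk : 1 ≤ T.k) : |((T₀.v : ℚ) - T.v) / ((b : ℚ) ^ T.k - 1)| ≤ d := by
  have hpos := one_lt_pow_rat H.two_le hk
  have h1 : (T₀.v : ℚ) ≤ d := by exact_mod_cast H.v_le hT₀
  have h2 : (T.v : ℚ) ≤ d := by exact_mod_cast H.v_le hT
  have h3 : (0 : ℚ) ≤ T₀.v := Nat.cast_nonneg _
  have h4 : (0 : ℚ) ≤ T.v := Nat.cast_nonneg _
  rw [abs_div, abs_of_pos (by linarith : (0 : ℚ) < (b : ℚ) ^ T.k - 1), div_le_iff₀ (by linarith)]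
  have h5 : |(T₀.v : ℚ) - T.v| ≤ d := abs_le.mpr ⟨by linarith, by linarith⟩
  nlinarith

/-- Up to the slope of the chosen edge, `ν` is `β` times a slope of the Newton polygon. -/
theorem nuT_bounds (H : IsEdgeChange b r d a φ ts) :
    -φ.α - φ.β * d ≤ nuT b φ ts ∧ nuT b φ ts ≤ -φ.α + φ.β * d := by
  obtain ⟨T₀, hT₀, hk₀⟩ := H.constant
  obtain ⟨⟨T, hT, hk, h1⟩, -⟩ := nuT_spec (b := b) (φ := φ) H.exists_pos
  rw [h1, H.nuT_term hT₀ hk₀ hk]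
  obtain ⟨h2, h3⟩ := abs_le.mp (H.abs_slope_le hT₀ hT hk)
  have hβ : (0 : ℚ) ≤ φ.β := Nat.cast_nonneg _
  constructor <;> nlinarith

/-- Bounds for the slope and the intercept of the chosen edge. The intercept is bounded below since
`b ^ k₁ ≤ b ^ k₂ - b ^ k₁`. -/
theorem edge_bounds (H : IsEdgeChange b r d a φ ts) : -φ.α ≤ φ.β * d ∧ -(φ.β * d : ℤ) ≤ φ.γ := by
  obtain ⟨T₁, h1, T₂, h2, hk, e1, e2⟩ := H.edge
  have hv1 : (T₁.v : ℤ) ≤ d := by exact_mod_cast H.v_le h1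
  have hv2 : (T₂.v : ℤ) ≤ d := by exact_mod_cast H.v_le h2
  have hv1' : (0 : ℤ) ≤ T₁.v := Int.natCast_nonneg _
  have hv2' : (0 : ℤ) ≤ T₂.v := Int.natCast_nonneg _
  have hβ : (0 : ℤ) ≤ φ.β := Int.natCast_nonneg _
  have hq1 := H.pow_pos T₁.k
  have hq2 : 2 * (b : ℤ) ^ T₁.k ≤ (b : ℤ) ^ T₂.k := by
    have h3 : b ^ (T₁.k + 1) ≤ b ^ T₂.k := Nat.pow_le_pow_right (by have := H.two_le; omega) hk
    have h4 : 2 * b ^ T₁.k ≤ b ^ (T₁.k + 1) := by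
      rw [pow_succ, mul_comm]; exact Nat.mul_le_mul_left _ H.two_le
    exact_mod_cast h4.trans h3
  rw [MahlerTerm.tval] at e1 e2
  have hd1 : (φ.β : ℤ) * T₁.v ≤ φ.β * d := mul_le_mul_of_nonneg_left hv1 hβ
  have hd2 : (φ.β : ℤ) * T₂.v ≤ φ.β * d := mul_le_mul_of_nonneg_left hv2 hβ
  have hn1 : (0 : ℤ) ≤ φ.β * T₁.v := mul_nonneg hβ hv1'
  have hn2 : (0 : ℤ) ≤ φ.β * T₂.v := mul_nonneg hβ hv2'
  have hdiff : -φ.α * ((b : ℤ) ^ T₂.k - (b : ℤ) ^ T₁.k) = φ.β * T₂.v - φ.β * T₁.v := by linarith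
  rcases le_total 0 φ.α with hα | hα
  · refine ⟨by linarith, ?_⟩
    have := mul_nonneg hα (by linarith : (0 : ℤ) ≤ (b : ℤ) ^ T₁.k)
    linarith
  · have h5 := mul_le_mul_of_nonneg_left
      (by linarith : (b : ℤ) ^ T₁.k ≤ (b : ℤ) ^ T₂.k - (b : ℤ) ^ T₁.k) (neg_nonneg.mpr hα)
    have h6 := mul_le_mul_of_nonneg_left hq1 (neg_nonneg.mpr hα)
    constructor <;> linarith

theorem floor_nuT_le (H : IsEdgeChange b r d a φ ts) : ⌊nuT b φ ts⌋.toNat ≤ 2 * (φ.β * d) := by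
  have h1 := H.nuT_bounds.2
  have h2 : -(φ.α : ℚ) ≤ φ.β * d := by exact_mod_cast H.edge_bounds.1
  have h3 : ⌊nuT b φ ts⌋ ≤ 2 * (φ.β * d) := by
    rw [← Int.cast_le (R := ℚ)]
    refine (Int.floor_le _).trans ?_
    push_cast
    linarith
  rw [← H.natCast_floor_nuT] at h3
  exact_mod_cast h3

theorem floor_muT_le (H : IsEdgeChange b r d a φ ts) : ⌊muT b φ ts⌋ ≤ 3 * (φ.β * d) := by
  obtain ⟨T₀, hT₀, hk₀⟩ := H.constant
  have h1 := H.nuT_bounds.2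
  have h2 : -(φ.β * d : ℚ) ≤ φ.γ := by exact_mod_cast H.edge_bounds.2
  have h3 : (φ.β : ℚ) * T₀.v ≤ φ.β * d :=
    mul_le_mul_of_nonneg_left (by exact_mod_cast H.v_le hT₀) (Nat.cast_nonneg _)
  rw [← Int.cast_le (R := ℚ)]
  refine (Int.floor_le _).trans ?_
  rw [muT, tval₀_eq H.terms hT₀ hk₀, MahlerTerm.tval, hk₀]
  push_cast
  linarith

theorem le_floor_nuT (H : IsEdgeChange b r d a φ ts) :
    -φ.α - φ.β * d ≤ (⌊nuT b φ ts⌋.toNat : ℕ) := by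
  rw [H.natCast_floor_nuT, Int.le_floor]
  push_cast
  exact H.nuT_bounds.1

end IsEdgeChange

end Parameters

/-! ### The Mahler operator on coefficients of Puiseux series -/

section Series

variable {K : Type} [Field K]

theorem coeff_mahlerMap_pow {b : ℕ} (hb : 2 ≤ b) (k : ℕ) (y : HahnSeries ℚ K) (q : ℚ) :
    ((mahlerMap K b hb ^ k) y).coeff q = y.coeff (q / (b : ℚ) ^ k) := by
  have hb0 : (b : ℚ) ≠ 0 := by exact_mod_cast (by omega : b ≠ 0)
  have h1 : ∀ (y : HahnSeries ℚ K) (q : ℚ), (mahlerMap K b hb y).coeff q = y.coeff (q / b) := by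
    intro y q
    have h2 := HahnSeries.embDomain_coeff (x := y) (a := q / b)
      (f := OrderEmbedding.ofStrictMono (fun q : ℚ => (b : ℚ) * q)
        fun _ _ h => mul_lt_mul_of_pos_left h (by exact_mod_cast (by omega : 0 < b)))
    rw [← h2]
    change _ = HahnSeries.coeff _ ((b : ℚ) * (q / b))
    rw [mul_div_cancel₀ _ hb0]
    rfl
  induction k generalizing q with
  | zero => simp
  | succ k ih =>
    rw [pow_succ', Module.End.mul_apply, h1, ih, div_div, pow_succ']

theorem coeff_polyToSeries_mul {p : K[X]} {d : ℕ} (hp : p.natDegree ≤ d) (z : HahnSeries ℚ K)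
    (q : ℚ) : (polyToSeries p * z).coeff q =
      ∑ j ∈ Finset.range (d + 1), p.coeff j * z.coeff (q - j) := by
  rw [polyToSeries, Polynomial.eval₂_eq_sum_range' _ (Nat.lt_succ_of_le hp), Finset.sum_mul,
    HahnSeries.coeff_sum]
  refine Finset.sum_congr rfl fun j _ => ?_
  rw [HahnSeries.single_pow, HahnSeries.C_apply, HahnSeries.single_mul_single, one_pow, mul_one,
    zero_add, HahnSeries.coeff_single_mul, nsmul_eq_mul, mul_one]

theorem coeff_mahlerOperator {b r d : ℕ} (hb : 2 ≤ b) {ℓ : ℕ → K[X]}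
    (hdeg : ∀ k ≤ r, (ℓ k).natDegree ≤ d) (y : HahnSeries ℚ K) (q : ℚ) :
    (mahlerOperator b hb r ℓ y).coeff q = ∑ k ∈ Finset.range (r + 1),
      ∑ j ∈ Finset.range (d + 1), (ℓ k).coeff j * y.coeff ((q - j) / (b : ℚ) ^ k) := by
  change (∑ k ∈ Finset.range (r + 1), polyToSeries (ℓ k) * (mahlerMap K b hb ^ k) y).coeff q = _
  rw [HahnSeries.coeff_sum]
  refine Finset.sum_congr rfl fun k hk => ?_
  rw [coeff_polyToSeries_mul (hdeg k (Nat.lt_succ_iff.mp (Finset.mem_range.mp hk)))]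
  simp only [coeff_mahlerMap_pow hb]

theorem IsTermList.sum_eq {r d : ℕ} {a : ℕ → ℕ → K} {ts : List MahlerTerm}
    (h : IsTermList r d a ts) (F : ℕ → ℕ → K) :
    ∑ k ∈ Finset.range (r + 1), ∑ j ∈ Finset.range (d + 1), a k j * F k j =
      (ts.map fun T => ∑ j ∈ Finset.range (T.deg + 1), a T.k j * F T.k j).sum := by
  have h1 : (ts.map fun T => ∑ j ∈ Finset.range (T.deg + 1), a T.k j * F T.k j) =
      (ts.map MahlerTerm.k).map fun k => ∑ j ∈ Finset.range (d + 1), a k j * F k j := by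
    rw [List.map_map]
    refine List.map_congr_left fun T hT => ?_
    refine Finset.sum_subset (Finset.range_mono (Nat.succ_le_succ (h.deg_le T hT))) ?_
    intro j hj hj'
    by_cases ha : a T.k j = 0
    · rw [ha, zero_mul]
    · have := (h.support T hT j (Nat.lt_succ_iff.mp (Finset.mem_range.mp hj)) ha).2
      exact absurd (Finset.mem_range.mpr (Nat.lt_succ_of_le this)) hj'
  rw [h1, ← List.sum_toFinset _ (h.sublist.nodup List.nodup_range)]
  symm
  refine Finset.sum_subset (fun k hk => ?_) fun k hk hk' => ?_
  · exact Finset.mem_range.mpr (List.mem_range.mp (h.sublist.subset (List.mem_toFinset.mp hk)))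
  · refine Finset.sum_eq_zero fun j hj => ?_
    by_cases ha : a k j = 0
    · rw [ha, zero_mul]
    · obtain ⟨T, hT, rfl⟩ := h.complete k (Nat.lt_succ_iff.mp (Finset.mem_range.mp hk)) j
        (Nat.lt_succ_iff.mp (Finset.mem_range.mp hj)) ha
      exact absurd (List.mem_toFinset.mpr (List.mem_map_of_mem hT)) hk'

/-! ### Valuations of solutions -/

/-- The valuation of a nonzero solution is the opposite of the slope of an admissible edge: the
terms of least exponent of the `ℓ_k M ^ k y` have to cancel. -/
theorem exists_admissible_edge [DecidableEq K] {b r d N : ℕ} (hb : 2 ≤ b) (hN : 0 < N)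
    {ℓ : ℕ → K[X]} (hdeg : ∀ k ≤ r, (ℓ k).natDegree ≤ d) {ts : List MahlerTerm}
    (hts : IsTermList r d (fun k j => (ℓ k).coeff j) ts) (hne : ts ≠ []) {y : HahnSeries ℚ K}
    (hy : y ∈ solutionSpace b hb r N ℓ) (hy0 : y ≠ 0) :
    ∃ e ∈ newtonEdges b ts, e.1 = -y.order ∧ ((N : ℚ) * e.1).den = 1 ∧
      IsAdmissible b (fun k j => (ℓ k).coeff j) ts e := by
  classical
  obtain ⟨v, hv⟩ : ∃ v, v = y.order := ⟨_, rfl⟩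
  have hlead : y.coeff v ≠ 0 := by
    rw [hv]; exact fun h => hy0 (HahnSeries.coeff_order_eq_zero.mp h)
  obtain ⟨T₀, hT₀, hmin⟩ := Finset.exists_min_image ts.toFinset (MahlerTerm.intercept b (-v))
    (by rwa [List.toFinset_nonempty_iff])
  rw [List.mem_toFinset] at hT₀
  have hmin' : ∀ T ∈ ts, T₀.intercept b (-v) ≤ T.intercept b (-v) := fun T hT =>
    hmin T (List.mem_toFinset.mpr hT)
  obtain ⟨c, hc⟩ : ∃ c, c = T₀.intercept b (-v) := ⟨_, rfl⟩
  rw [← hc] at hmin'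
  have hpow : ∀ k, (0 : ℚ) < (b : ℚ) ^ k := fun k =>
    pow_pos (by exact_mod_cast (by omega : 0 < b)) k
  -- the coefficient of least exponent of `L y`
  have hterm : ∀ T ∈ ts, ∑ j ∈ Finset.range (T.deg + 1), (ℓ T.k).coeff j *
      y.coeff ((c - j) / (b : ℚ) ^ T.k) =
      if T.intercept b (-v) = c then (ℓ T.k).coeff T.v * y.coeff v else 0 := by
    intro T hT
    have hzero : ∀ j ∈ Finset.range (T.deg + 1), j ≠ T.v → (ℓ T.k).coeff j *
        y.coeff ((c - j) / (b : ℚ) ^ T.k) = 0 := by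
      intro j hj hne
      by_contra hcon
      have h1 := left_ne_zero_of_mul hcon
      have h2 := HahnSeries.order_le_of_coeff_ne_zero (right_ne_zero_of_mul hcon)
      have h3 := (hts.support T hT j ((Nat.lt_succ_iff.mp (Finset.mem_range.mp hj)).trans
        (hts.deg_le T hT)) h1).1
      rw [← hv, le_div_iff₀ (hpow _)] at h2
      have h4 := hmin' T hT
      have h5 : (T.v : ℚ) + 1 ≤ j := by exact_mod_cast lt_of_le_of_ne h3 hne.symm
      rw [MahlerTerm.intercept] at h4
      linarith
    have hTv : T.v ∈ Finset.range (T.deg + 1) :=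
      Finset.mem_range.mpr (Nat.lt_succ_of_le (hts.v_le_deg T hT))
    rw [Finset.sum_eq_single_of_mem T.v hTv hzero]
    split_ifs with heq
    · congr 2
      rw [← heq, MahlerTerm.intercept]
      have := (hpow T.k).ne'
      field_simp
      ring
    · rw [mul_eq_zero]
      right
      by_contra hcon
      have h2 := HahnSeries.order_le_of_coeff_ne_zero hcon
      rw [← hv, le_div_iff₀ (hpow _)] at h2
      have h4 := lt_of_le_of_ne (hmin' T hT) (Ne.symm heq)
      rw [MahlerTerm.intercept] at h4
      linarith
  have hsum : (ts.map fun T => if T.intercept b (-v) = c then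
      (ℓ T.k).coeff T.v * y.coeff v else 0).sum = 0 := by
    rw [← List.map_congr_left hterm, ← hts.sum_eq fun k j => y.coeff ((c - j) / (b : ℚ) ^ k),
      ← coeff_mahlerOperator hb hdeg]
    have : mahlerOperator b hb r ℓ y = 0 := hy.1
    rw [this, HahnSeries.coeff_zero]
  have hadm : IsAdmissible b (fun k j => (ℓ k).coeff j) ts (-v, c) := by
    have h1 : (ts.map fun T => if T.intercept b (-v) = c then
        (ℓ T.k).coeff T.v * y.coeff v else 0).sum =
        ((ts.filter fun T => T.intercept b (-v) = c).map fun T => (ℓ T.k).coeff T.v).sum *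
          y.coeff v := by
      rw [List.sum_map_ite, List.sum_map_mul_right]
      simp
    rw [h1] at hsum
    exact (mul_eq_zero.mp hsum).resolve_right hlead
  -- a single monomial of least exponent could not cancel
  have hex : ∃ T ∈ ts, T ≠ T₀ ∧ T.intercept b (-v) = c := by
    by_contra hcon
    push Not at hcon
    rw [← List.sum_toFinset _ hts.nodup, Finset.sum_eq_single T₀, if_pos hc.symm] at hsum
    · exact mul_ne_zero (hts.lead T₀ hT₀) hlead hsum
    · intro T hT hTT
      exact if_neg (hcon T (List.mem_toFinset.mp hT) hTT)
    · intro h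
      exact absurd (List.mem_toFinset.mpr hT₀) h
  obtain ⟨T, hT, hTT, hTc⟩ := hex
  have hedge : ∀ T₁ ∈ ts, ∀ T₂ ∈ ts, T₁.k < T₂.k → T₁.intercept b (-v) = c →
      T₂.intercept b (-v) = c → (-v, c) ∈ newtonEdges b ts := by
    intro T₁ h1 T₂ h2 hk e1 e2
    refine mem_newtonEdges.mpr ⟨T₁, h1, T₂, h2, hk, ?_, fun T hT => e1.le.trans (hmin' T hT),
      e1.symm⟩
    have hpos := sub_pos.mpr (pow_lt_pow_rat hb hk)
    rw [eq_div_iff hpos.ne']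
    rw [MahlerTerm.intercept] at e1 e2
    simp only
    linarith
  have hden : ((N : ℚ) * -v).den = 1 := by
    obtain ⟨i, hi⟩ := hy.2 v hlead
    have hN' : (N : ℚ) ≠ 0 := by exact_mod_cast hN.ne'
    have : (N : ℚ) * -v = ((-i : ℤ) : ℚ) := by rw [hi]; push_cast; field_simp
    rw [this, Rat.den_intCast]
  refine ⟨(-v, c), ?_, by rw [← hv], hden, hadm⟩
  have hk : T.k ≠ T₀.k := fun hk => hTT (hts.eq_of_k_eq hT hT₀ hk)
  rcases lt_or_gt_of_ne hk with hk | hk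
  · exact hedge T hT T₀ hT₀ hk hTc hc.symm
  · exact hedge T₀ hT₀ T hT hk hc.symm hTc

/-! ### Puiseux series given by sequences of coefficients -/

/-- The order embedding `n ↦ (α + n) / N` of the natural numbers into the exponents. -/
def exponentEmbedding (N : ℕ) (hN : 0 < N) (α : ℤ) : ℕ ↪o ℚ :=
  OrderEmbedding.ofStrictMono (fun n : ℕ => ((α : ℚ) + n) / N) fun m n h => by
    have : (m : ℚ) < n := by exact_mod_cast h
    exact div_lt_div_of_pos_right (by linarith) (by exact_mod_cast hN)

/-- The Puiseux series `∑ n, z n x ^ ((α + n) / N)`. -/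
noncomputable def seqSeries (N : ℕ) (hN : 0 < N) (α : ℤ) : (ℕ → K) →ₗ[K] HahnSeries ℚ K :=
  (HahnSeries.embDomainLinearMap (exponentEmbedding N hN α)) ∘ₗ
    { toFun := fun z => ⟨z, Set.IsPWO.of_linearOrder _⟩
      map_add' := fun _ _ => rfl
      map_smul' := fun _ _ => rfl }

theorem coeff_seqSeries {N : ℕ} (hN : 0 < N) (α : ℤ) (z : ℕ → K) (n : ℕ) :
    (seqSeries N hN α z).coeff (((α : ℚ) + n) / N) = z n :=
  HahnSeries.embDomain_coeff (f := exponentEmbedding N hN α)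

theorem coeff_seqSeries_of_ne {N : ℕ} (hN : 0 < N) (α : ℤ) (z : ℕ → K) {q : ℚ}
    (hq : ∀ n : ℕ, q ≠ ((α : ℚ) + n) / N) : (seqSeries N hN α z).coeff q = 0 :=
  HahnSeries.embDomain_of_notMem_range (f := exponentEmbedding N hN α)
    fun ⟨n, hn⟩ => hq n hn.symm

theorem seqSeries_injective {N : ℕ} (hN : 0 < N) (α : ℤ) :
    Function.Injective (seqSeries (K := K) N hN α) := fun z z' h => by
  funext n
  rw [← coeff_seqSeries hN α z n, h, coeff_seqSeries]

theorem seqSeries_mem_ramifiedSeries {N : ℕ} (hN : 0 < N) (α : ℤ) (z : ℕ → K) :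
    seqSeries N hN α z ∈ ramifiedSeries K N := fun q hq => by
  by_contra hcon
  refine hq (coeff_seqSeries_of_ne hN α z fun n hn => hcon ⟨α + n, ?_⟩)
  rw [hn]
  push_cast
  rfl

/-- A series in `x ^ (1 / N)` of valuation at least `α / N` is given by a sequence. -/
theorem eq_seqSeries {N : ℕ} (hN : 0 < N) (α : ℤ) {y : HahnSeries ℚ K}
    (hy : y ∈ ramifiedSeries K N) (hα : ∀ q, y.coeff q ≠ 0 → (α : ℚ) / N ≤ q) :
    seqSeries N hN α (fun n => y.coeff (((α : ℚ) + n) / N)) = y := by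
  have hN' : (0 : ℚ) < N := by exact_mod_cast hN
  ext q
  by_cases hq : ∃ n : ℕ, q = ((α : ℚ) + n) / N
  · obtain ⟨n, rfl⟩ := hq
    rw [coeff_seqSeries]
  · push Not at hq
    rw [coeff_seqSeries_of_ne hN α _ hq]
    by_contra hcon
    obtain ⟨i, hi⟩ := hy q (Ne.symm hcon)
    have h1 := hα q (Ne.symm hcon)
    rw [hi, div_le_div_iff_of_pos_right hN'] at h1
    have h2 : α ≤ i := by exact_mod_cast h1
    obtain ⟨n, hn⟩ := Int.eq_ofNat_of_zero_le (sub_nonneg.mpr h2)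
    refine hq n ?_
    rw [hi]
    congr 1
    have : (i : ℚ) = ((α + n : ℤ) : ℚ) := by exact_mod_cast (by linarith : i = α + n)
    rw [this]
    push_cast
    rfl

theorem toPuiseux_eq_seqSeries {N : ℕ} (hN : 0 < N) (α : ℤ) (z : List K) :
    toPuiseux N α z = seqSeries N hN α (vec z) := by
  have hN' : (N : ℚ) ≠ 0 := by exact_mod_cast hN.ne'
  ext q
  rw [toPuiseux, HahnSeries.coeff_sum]
  simp only [HahnSeries.coeff_single]
  by_cases hq : ∃ n : ℕ, q = ((α : ℚ) + n) / N
  · obtain ⟨n, rfl⟩ := hq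
    rw [coeff_seqSeries]
    have hiff : ∀ j : ℕ, ((α : ℚ) + n) / N = ((α : ℚ) + j) / N ↔ n = j := fun j => by
      rw [div_left_inj' hN', add_right_inj, Nat.cast_inj]
    simp only [hiff]
    rw [Finset.sum_ite_eq]
    split_ifs with hn
    · rfl
    · exact (vec_eq_zero_of_le (by simpa using hn)).symm
  · push Not at hq
    rw [coeff_seqSeries_of_ne hN α _ hq]
    exact Finset.sum_eq_zero fun j _ => if_neg (hq j)

/-- The rows of the infinite matrix give the coefficients of the image under `L`. -/
theorem mahlerOperator_seqSeries_eq_zero_iff {b r d : ℕ} (hb : 2 ≤ b) {ℓ : ℕ → K[X]}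
    (hdeg : ∀ k ≤ r, (ℓ k).natDegree ≤ d) {φ : ChangeVar} {ts : List MahlerTerm}
    (H : IsEdgeChange b r d (fun k j => (ℓ k).coeff j) φ ts) (z : ℕ → K) :
    mahlerOperator b hb r ℓ (seqSeries φ.β H.beta_pos φ.α z) = 0 ↔
      ∀ i : ℤ, rowForm (rmat b (fun k j => (ℓ k).coeff j) φ ts i) (i + 1).toNat z = 0 := by
  obtain ⟨a, ha⟩ : ∃ a : ℕ → ℕ → K, a = fun k j => (ℓ k).coeff j := ⟨_, rfl⟩
  have hβ : (φ.β : ℚ) ≠ 0 := by exact_mod_cast H.beta_pos.ne'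
  have hpow : ∀ k, ((b : ℚ) ^ k) ≠ 0 := fun k =>
    pow_ne_zero k (by exact_mod_cast (by omega : b ≠ 0))
  obtain ⟨Y, hY⟩ : ∃ Y, Y = seqSeries φ.β H.beta_pos φ.α z := ⟨_, rfl⟩
  have hcoeff : ∀ q, (mahlerOperator b hb r ℓ Y).coeff q = (ts.map fun T =>
      ∑ j ∈ Finset.range (T.deg + 1), a T.k j *
        Y.coeff ((q - j) / (b : ℚ) ^ T.k)).sum := fun q => by
    rw [coeff_mahlerOperator hb hdeg, ha,
      ← H.terms.sum_eq fun k j => Y.coeff ((q - j) / (b : ℚ) ^ k)]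
  -- the exponents that contribute to a given coefficient of the image
  have hexp : ∀ (q : ℚ) (T : MahlerTerm) (j n : ℕ),
      (q - j) / (b : ℚ) ^ T.k = ((φ.α : ℚ) + n) / φ.β ↔
        φ.α * (b : ℚ) ^ T.k + φ.β * j + n * (b : ℚ) ^ T.k = q * φ.β := by
    intro q T j n
    rw [div_eq_div_iff (hpow _) hβ]
    constructor <;> intro h <;> linarith
  have hrow : ∀ i : ℤ, (mahlerOperator b hb r ℓ Y).coeff (((i : ℚ) + φ.γ) / φ.β) =
      rowForm (rmat b a φ ts i) (i + 1).toNat z := by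
    intro i
    rw [hcoeff, rowForm_apply, sum_rmat_mul]
    congr 1
    refine List.map_congr_left fun T hT => Finset.sum_congr rfl fun j hj => ?_
    have hj' := Nat.lt_succ_iff.mp (Finset.mem_range.mp hj)
    by_cases h0 : a T.k j = 0
    · simp [h0]
    have hnn := H.exponent_nonneg hT hj' (by rw [ha] at h0; exact h0)
    have hexp' : ∀ n : ℕ, (((i : ℚ) + φ.γ) / φ.β - j) / (b : ℚ) ^ T.k = ((φ.α : ℚ) + n) / φ.β ↔
        φ.α * (b : ℤ) ^ T.k + φ.β * j - φ.γ + n * (b : ℤ) ^ T.k = i := fun n => by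
      rw [hexp, div_mul_cancel₀ _ hβ]
      rw [← Int.cast_inj (α := ℚ)]
      push_cast
      constructor <;> intro h <;> linarith
    have hpow' := H.pow_pos T.k
    by_cases hex : ∃ n : ℕ,
        (((i : ℚ) + φ.γ) / φ.β - j) / (b : ℚ) ^ T.k = ((φ.α : ℚ) + n) / φ.β
    · obtain ⟨n, hn⟩ := hex
      have hn' := (hexp' n).mp hn
      rw [hn, hY, coeff_seqSeries, Finset.sum_eq_single n, if_pos hn']
      · intro m _ hne
        refine if_neg fun hm => hne ?_
        have h1 : (m : ℤ) * (b : ℤ) ^ T.k = n * (b : ℤ) ^ T.k := by linarith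
        exact_mod_cast mul_right_cancel₀ (by omega : (b : ℤ) ^ T.k ≠ 0) h1
      · intro hmem
        exfalso
        refine hmem (Finset.mem_range.mpr ?_)
        have h1 : (n : ℤ) * 1 ≤ n * (b : ℤ) ^ T.k :=
          mul_le_mul_of_nonneg_left hpow' (Int.natCast_nonneg n)
        omega
    · push Not at hex
      rw [hY, coeff_seqSeries_of_ne H.beta_pos φ.α z hex, mul_zero]
      symm
      exact Finset.sum_eq_zero fun n _ => if_neg fun h => hex n ((hexp' n).mpr h)
  rw [← hY, ← ha]
  constructor
  · intro h i
    rw [← hrow i, h, HahnSeries.coeff_zero]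
  · intro h
    ext q
    rw [HahnSeries.coeff_zero]
    by_cases hq : ∃ i : ℤ, q = ((i : ℚ) + φ.γ) / φ.β
    · obtain ⟨i, rfl⟩ := hq
      rw [hrow i, h i]
    · rw [hcoeff]
      refine List.sum_eq_zero fun x hx => ?_
      obtain ⟨T, -, rfl⟩ := List.mem_map.mp hx
      refine Finset.sum_eq_zero fun j _ => ?_
      rw [hY, coeff_seqSeries_of_ne H.beta_pos φ.α z fun n hn => hq ?_, mul_zero]
      refine ⟨φ.α * (b : ℤ) ^ T.k + φ.β * j + n * (b : ℤ) ^ T.k - φ.γ, ?_⟩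
      rw [eq_div_iff hβ, ← (hexp q T j n).mp hn]
      push_cast
      ring

/-! ### Solutions and approximate solutions -/

/-- Prolongation of a sequence by forward substitution, as a linear map. -/
def prolongHom (R : ℤ → ℕ → K) (m : ℤ) (w : ℕ) : (ℕ → K) →ₗ[K] (ℕ → K) where
  toFun f := prolongSeq R m w f
  map_add' f g := by
    funext n
    induction n using Nat.strong_induction_on with
    | _ n ih =>
      rw [Pi.add_apply]
      rcases lt_or_ge n w with hn | hn
      · simp only [prolongSeq_of_lt R m _ hn, Pi.add_apply]
      · simp only [prolongSeq_of_le R m _ hn]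
        rw [Finset.sum_congr rfl fun j hj => by rw [ih j (Finset.mem_range.mp hj)]]
        simp only [Pi.add_apply, mul_add, Finset.sum_add_distrib]
        ring
  map_smul' c f := by
    funext n
    induction n using Nat.strong_induction_on with
    | _ n ih =>
      rw [Pi.smul_apply]
      rcases lt_or_ge n w with hn | hn
      · simp only [prolongSeq_of_lt R m _ hn, Pi.smul_apply, RingHom.id_apply]
      · simp only [prolongSeq_of_le R m _ hn]
        rw [Finset.sum_congr rfl fun j hj => by rw [ih j (Finset.mem_range.mp hj)]]
        simp only [Pi.smul_apply, smul_eq_mul, RingHom.id_apply, mul_left_comm _ c,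
          ← Finset.mul_sum]
        ring

theorem prolongHom_apply (R : ℤ → ℕ → K) (m : ℤ) (w : ℕ) (f : ℕ → K) :
    prolongHom R m w f = prolongSeq R m w f := rfl

theorem rowForm_eq_of_le {ρ : ℕ → K} {m n : ℕ} (hmn : m ≤ n) (hρ : ∀ j, m ≤ j → ρ j = 0)
    (f : ℕ → K) : rowForm ρ m f = rowForm ρ n f := by
  rw [rowForm_apply, rowForm_apply]
  refine Finset.sum_subset (Finset.range_mono hmn) fun j _ hj => ?_
  rw [hρ j (by simpa using hj), zero_mul]

theorem rowForm_congr (ρ : ℕ → K) {n : ℕ} {f g : ℕ → K} (h : ∀ j < n, f j = g j) :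
    rowForm ρ n f = rowForm ρ n g := by
  rw [rowForm_apply, rowForm_apply]
  exact Finset.sum_congr rfl fun j hj => by rw [h j (Finset.mem_range.mp hj)]

/-- If no solution has an exponent less than `α / β`, the opposite of the slope of the chosen edge,
then the solutions are the series given by the prolongations of the vectors of length `w`
annihilated by the first `h` rows. -/
theorem solutionSpace_eq_map {b r d : ℕ} (hb : 2 ≤ b) {ℓ : ℕ → K[X]}
    (hdeg : ∀ k ≤ r, (ℓ k).natDegree ≤ d) {φ : ChangeVar} {ts : List MahlerTerm}
    (H : IsEdgeChange b r d (fun k j => (ℓ k).coeff j) φ ts)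
    (hval : ∀ y ∈ solutionSpace b hb r φ.β ℓ, ∀ q, y.coeff q ≠ 0 → (φ.α : ℚ) / φ.β ≤ q)
    {h w : ℕ} (hw : w = ⌊nuT b φ ts⌋.toNat + 1) (hh : (h : ℤ) = tval₀ b φ ts + w) :
    solutionSpace b hb r φ.β ℓ = (truncatedKernel (rmat b (fun k j => (ℓ k).coeff j) φ ts) h w).map
      ((seqSeries φ.β H.beta_pos φ.α) ∘ₗ
        (prolongHom (rmat b (fun k j => (ℓ k).coeff j) φ ts) (tval₀ b φ ts) w)) := by
  obtain ⟨R, hR⟩ : ∃ R, R = rmat b (fun k j => (ℓ k).coeff j) φ ts := ⟨_, rfl⟩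
  obtain ⟨v₀, hv₀⟩ : ∃ v₀, v₀ = tval₀ b φ ts := ⟨_, rfl⟩
  have hv0 : 0 ≤ v₀ := hv₀ ▸ H.tval₀_nonneg
  have hiff := fun z => mahlerOperator_seqSeries_eq_zero_iff hb hdeg H z
  rw [← hR] at hiff ⊢
  rw [← hv₀] at hh ⊢
  have hfin : ∀ i : ℤ, ∀ j : ℕ, (i + 1).toNat ≤ j → R i j = 0 := fun i j hj => by
    rw [hR]; exact H.rmat_eq_zero_of_row_lt (by omega)
  have hhigh : ∀ i : ℤ, ∀ j : ℕ, w ≤ j → i < v₀ + j → R i j = 0 := fun i j hj hi => by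
    rw [hR]; exact H.rmat_eq_zero_of_tval₀_lt (by omega) (hv₀ ▸ hi)
  have hdiag : ∀ n : ℕ, w ≤ n → R (v₀ + n) n ≠ 0 := fun n hn => by
    rw [hR, hv₀]; exact H.rmat_diag_ne_zero (by omega)
  -- rows of small index involve the first `w` coefficients only
  have hlow : ∀ i : ℕ, i < h → ∀ z : ℕ → K, rowForm (R i) ((i : ℤ) + 1).toNat z =
      rowForm (R i) w z := by
    intro i hi z
    rw [rowForm_eq_of_le (le_max_left _ w) (hfin i),
      ← rowForm_eq_of_le (le_max_right ((i : ℤ) + 1).toNat w) fun j hj => hhigh i j hj (by omega)]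
  -- each row of large index determines one more coefficient
  have hnext : ∀ n : ℕ, w ≤ n → ∀ z : ℕ → K, rowForm (R (v₀ + n)) ((v₀ + n) + 1).toNat z =
      ∑ j ∈ Finset.range n, R (v₀ + n) j * z j + R (v₀ + n) n * z n := by
    intro n hn z
    rw [← rowForm_eq_of_le (m := n + 1) (by omega) fun j hj => hhigh _ j (by omega) (by omega),
      rowForm_apply, Finset.sum_range_succ]
  ext y
  rw [Submodule.mem_map]
  constructor
  · intro hy
    obtain ⟨z, hz⟩ : ∃ z : ℕ → K, z = fun n : ℕ => y.coeff (((φ.α : ℚ) + n) / φ.β) :=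
      ⟨_, rfl⟩
    have hyz : seqSeries φ.β H.beta_pos φ.α z = y := by
      rw [hz]; exact eq_seqSeries H.beta_pos φ.α hy.2 (hval y hy)
    have hrows := (hiff z).mp (by rw [hyz]; exact hy.1)
    have hcut : ∀ i : ℕ, rowForm (R i) w (fun n => if n < w then z n else 0) = rowForm (R i) w z :=
      fun i => rowForm_congr _ fun j hj => if_pos hj
    refine ⟨fun n => if n < w then z n else 0, mem_truncatedKernel.mpr ⟨fun i hi =>
      if_neg hi.not_gt, fun i hi => ?_⟩, ?_⟩
    · rw [hcut, ← hlow i hi, hrows]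
    · rw [LinearMap.comp_apply, ← hyz]
      congr 1
      rw [prolongHom_apply]
      funext n
      induction n using Nat.strong_induction_on with
      | _ n ih =>
        rcases lt_or_ge n w with hn | hn
        · rw [prolongSeq_of_lt _ _ _ hn, if_pos hn]
        · rw [prolongSeq_of_le _ _ _ hn,
            Finset.sum_congr rfl fun j hj => by rw [ih j (Finset.mem_range.mp hj)]]
          have h1 := hrows (v₀ + n)
          rw [hnext n hn] at h1
          rw [div_eq_iff (hdiag n hn)]
          linear_combination -h1
  · rintro ⟨f, hf, rfl⟩
    rw [mem_truncatedKernel] at hf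
    refine ⟨(hiff _).mpr fun i => ?_, seqSeries_mem_ramifiedSeries _ _ _⟩
    rw [prolongHom_apply]
    rcases lt_or_ge i 0 with hi | hi
    · have : (i + 1).toNat = 0 := by omega
      rw [this, rowForm_apply, Finset.sum_range_zero]
    lift i to ℕ using hi
    rcases lt_or_ge i h with hi | hi
    · rw [hlow i hi, ← hf.2 i hi]
      exact rowForm_congr _ fun j hj => prolongSeq_of_lt _ _ _ hj
    · obtain ⟨n, hn⟩ := Int.eq_ofNat_of_zero_le (show 0 ≤ (i : ℤ) - v₀ by omega)
      have hin : (i : ℤ) = v₀ + n := by omega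
      rw [hin, hnext n (by omega), prolongSeq_of_le _ _ f (show w ≤ n by omega)]
      have := hdiag n (by omega)
      field_simp
      ring

end Series

/-! ### The algorithm -/

/-- A basis listed by `g` is truncated by `out` if every member is. -/
theorem IsListBasis.isTruncatedBasis {K : Type} [Field K] {S : List (List K)}
    {g : List K → HahnSeries ℚ K} {V : Submodule K (HahnSeries ℚ K)}
    (hb : IsListBasis (S.map g) V) {N : ℕ} {q : ℚ} {α : ℤ}
    (out : List K → List K)
    (h : ∀ f ∈ S, IsTruncation q (toPuiseux N α (out f)) (g f)) :
    IsTruncatedBasis N q V (α, S.map out) := by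
  obtain ⟨B, hB⟩ := hb.exists_basis
  have hlen : (S.map g).length = (S.map out).length := by rw [List.length_map, List.length_map]
  refine ⟨B.reindex (finCongr hlen), fun i => ?_⟩
  rw [Module.Basis.reindex_apply, hB]
  simpa using h _ (List.getElem_mem (by simpa using i.2))

section Main

variable {K : Type} [Field K]

theorem exists_term {r d : ℕ} {ℓ : ℕ → K[X]} (hdeg : ∀ k ≤ r, (ℓ k).natDegree ≤ d)
    {ts : List MahlerTerm} (hts : IsTermList r d (fun k j => (ℓ k).coeff j) ts) {k : ℕ} (hk : k ≤ r)
    (h0 : ℓ k ≠ 0) : ∃ T ∈ ts, T.k = k :=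
  hts.complete k hk _ (hdeg k hk) (Polynomial.leadingCoeff_ne_zero.mpr h0)

/-- The change of variables attached to an edge with slope in `N⁻¹ ℤ`. -/
theorem isEdgeChange_of_mem_newtonEdges {b r d N : ℕ} (hb : 2 ≤ b) (hN : 0 < N)
    (hcop : N.Coprime b) {a : ℕ → ℕ → K} {ts : List MahlerTerm} (hts : IsTermList r d a ts)
    (h0 : ∃ T ∈ ts, T.k = 0) {s c : ℚ} (he : (s, c) ∈ newtonEdges b ts)
    (hden : ((N : ℚ) * s).den = 1) :
    IsEdgeChange b r d a ⟨-((N : ℚ) * s).num, N, ((N : ℚ) * c).num⟩ ts := by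
  obtain ⟨T₁, h1, T₂, h2, hk, hs, hle, hc⟩ := mem_newtonEdges.mp he
  simp only at hs hle hc
  have hN' : (0 : ℚ) < N := by exact_mod_cast hN
  have hNs : ((((N : ℚ) * s).num : ℤ) : ℚ) = N * s := (Rat.den_eq_one_iff _).mp hden
  have hNc : ((((N : ℚ) * c).num : ℤ) : ℚ) = N * c := by
    refine (Rat.den_eq_one_iff _).mp ?_
    have : (N : ℚ) * c = ((N * T₁.v - ((N : ℚ) * s).num * (b : ℤ) ^ T₁.k : ℤ) : ℚ) := by
      push_cast
      rw [hNs, hc, MahlerTerm.intercept]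
      ring
    rw [this, Rat.den_intCast]
  have htval : ∀ T : MahlerTerm,
      ((T.tval b ⟨-((N : ℚ) * s).num, N, ((N : ℚ) * c).num⟩ : ℤ) : ℚ) =
        N * (T.intercept b s - c) := fun T => by
    rw [MahlerTerm.tval, MahlerTerm.intercept]
    push_cast
    rw [hNs, hNc]
    ring
  refine ⟨hts, hb, hN, hcop, fun T hT => ?_, ⟨T₁, h1, T₂, h2, hk, ?_, ?_⟩, h0⟩
  · have h3 := hle T hT
    rw [← hc] at h3
    have h4 := mul_nonneg hN'.le (sub_nonneg.mpr h3)
    rw [← htval] at h4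
    exact_mod_cast h4
  · have h4 := htval T₁
    rw [← hc, sub_self, mul_zero] at h4
    exact_mod_cast h4
  · have hT : T₂.intercept b s = c := by
      have hpos := sub_pos.mpr (pow_lt_pow_rat hb hk)
      rw [eq_div_iff hpos.ne'] at hs
      rw [hc, MahlerTerm.intercept, MahlerTerm.intercept]
      linarith
    have h4 := htval T₂
    rw [hT, sub_self, mul_zero] at h4
    exact_mod_cast h4

variable [DecidableEq K] (M : ℕ → ℕ)

theorem puiseuxSolve_of_none {b r d N T : ℕ} {a : ℕ → ℕ → K} {ts : List MahlerTerm}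
    (hts : ts = (mahlerTerms (fieldArith K M) r d a).val)
    (h : (rightmostAdmissibleEdge (fieldArith K M) b N a ts).val = none) :
    (puiseuxSolve (fieldArith K M) b r d N T a).val = (0, []) ∧
    (puiseuxSolve (fieldArith K M) b r d N T a).ops = (r + 1) * (d + 1) +
      (rightmostAdmissibleEdge (fieldArith K M) b N a ts).ops := by
  subst hts
  simp [puiseuxSolve, h, ops_mahlerTerms]

/-- The approximate solutions from which the algorithm starts when it has found an edge. -/
def approxSolutions (b d : ℕ) (a : ℕ → ℕ → K) (φ : ChangeVar) (ts : List MahlerTerm) :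
    Counted (List (List K)) :=
  solvePrescribed (fieldArith K M) b a φ ts (φ.β * d) (⌊muT b φ ts⌋ + 1).toNat
    (⌊nuT b φ ts⌋.toNat + 1) ((List.range (⌊nuT b φ ts⌋.toNat + 1)).map (profileRow b φ ts))

theorem puiseuxSolve_of_some {b r d N T : ℕ} {a : ℕ → ℕ → K} {ts : List MahlerTerm}
    (hts : ts = (mahlerTerms (fieldArith K M) r d a).val) {s c : ℚ} {φ : ChangeVar}
    (h : (rightmostAdmissibleEdge (fieldArith K M) b N a ts).val = some (s, c))
    (hφ : φ = ⟨-((N : ℚ) * s).num, N, ((N : ℚ) * c).num⟩) :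
    (puiseuxSolve (fieldArith K M) b r d N T a).val = (φ.α,
      (approxSolutions M b d a φ ts).val.map fun f => (prolong (fieldArith K M) b a φ ts
        ⌊nuT b φ ts⌋.toNat ⌊muT b φ ts⌋ (-φ.α + T - 1 - ⌊nuT b φ ts⌋.toNat).toNat f).val.take
          (-φ.α + T).toNat) ∧
    (puiseuxSolve (fieldArith K M) b r d N T a).ops = (r + 1) * (d + 1) +
      (rightmostAdmissibleEdge (fieldArith K M) b N a ts).ops +
      (approxSolutions M b d a φ ts).ops +
      ((approxSolutions M b d a φ ts).val.mapM fun f => prolong (fieldArith K M) b a φ ts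
        ⌊nuT b φ ts⌋.toNat ⌊muT b φ ts⌋ (-φ.α + T - 1 - ⌊nuT b φ ts⌋.toNat).toNat f).ops := by
  subst hts hφ
  simp [puiseuxSolve, h, ops_mahlerTerms, approxSolutions, add_assoc, Function.comp_def]

/-- The specification of the prescribed support solver at the parameters used by the algorithm. -/
theorem approxSolutions_spec {b r d : ℕ} {a : ℕ → ℕ → K} {φ : ChangeVar} {ts : List MahlerTerm}
    (H : IsEdgeChange b r d a φ ts) {w h : ℕ} (hw : w = ⌊nuT b φ ts⌋.toNat + 1)
    (hh : (h : ℤ) = tval₀ b φ ts + w) :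
    (∀ f ∈ (approxSolutions M b d a φ ts).val, f.length = w) ∧
    IsListBasis ((approxSolutions M b d a φ ts).val.map vec)
      (truncatedKernel (rmat b a φ ts) h w) ∧
    (approxSolutions M b d a φ ts).val.length ≤ r + 1 ∧
    (approxSolutions M b d a φ ts).ops ≤
      w * (2 * d + (r + 1)) + (w * ((r + 1) * (2 * (2 * d + (r + 1)) + 2) + 1) +
        (r + 1) * ((r + 1) * (2 * w))) +
      (r + 1) * ((r + 1) * ((h / (φ.β * d + 1) + 1) ^ 2 * (M (φ.β * d) + h) + h)) +
      (r + 1) * ((r + 1) * (1 + 2 * h + 2 * w) + h) + (r + 1) * ((r + 1) * (2 * w)) := by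
  have hmu : (⌊muT b φ ts⌋ + 1).toNat = h := by
    rw [H.floor_muT]
    omega
  obtain ⟨h1, h2, h3⟩ := solvePrescribed_spec M H.two_le a φ H.beta_pos H.coprime ts
    H.terms.sublist H.terms.deg_le (fun T hT j hj ha => H.exponent_nonneg hT hj ha) (φ.β * d) h w
    (profileRow b φ ts) (fun i hi => by
      have := H.profileRow_mem_range i
      omega) (fun i j hij => H.rmat_profileRow_eq_zero hij)
  rw [approxSolutions, hmu, ← hw]
  obtain ⟨h4, h5⟩ := h3 _ _ le_rfl (H.card_zero_diag_le w)
  exact ⟨h1, h2, h4, h5⟩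

/-- The algorithm computes the truncations of a basis of solutions. -/
theorem puiseuxRun_correct {b r d N : ℕ} (T : ℕ) {ℓ : ℕ → K[X]} (hb : 2 ≤ b) (hN : 0 < N)
    (hcop : N.Coprime b) (h0 : ℓ 0 ≠ 0) (hdeg : ∀ k ≤ r, (ℓ k).natDegree ≤ d) :
    IsTruncatedBasis N ((T : ℚ) / N) (solutionSpace b hb r N ℓ) (puiseuxRun M b r d N T ℓ).val := by
  have hN' : (0 : ℚ) < N := by exact_mod_cast hN
  obtain ⟨a, ha⟩ : ∃ a : ℕ → ℕ → K, a = fun k j => (ℓ k).coeff j := ⟨_, rfl⟩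
  obtain ⟨ts, hts⟩ : ∃ ts, ts = (mahlerTerms (fieldArith K M) r d a).val := ⟨_, rfl⟩
  have hterms : IsTermList r d a ts := hts ▸ mahlerTerms_spec M r d a
  have hconst : ∃ T ∈ ts, T.k = 0 :=
    exists_term hdeg (ha ▸ hterms) (Nat.zero_le r) h0
  have hne : ts ≠ [] := by
    obtain ⟨T, hT, -⟩ := hconst
    exact List.ne_nil_of_mem hT
  have hadm := fun y hy hy0 => exists_admissible_edge hb hN hdeg (ha ▸ hterms) hne (y := y) hy hy0
  obtain ⟨hr1, hr2, -⟩ := rightmostAdmissibleEdge_spec M hb N a hterms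
  rw [puiseuxRun, ← ha]
  cases hres : (rightmostAdmissibleEdge (fieldArith K M) b N a ts).val with
  | none =>
    rw [(puiseuxSolve_of_none M hts hres).1]
    have hbot : solutionSpace b hb r N ℓ = ⊥ := by
      rw [eq_bot_iff]
      intro y hy
      by_contra hy0
      obtain ⟨e, he, -, hd, hadm⟩ := hadm y hy hy0
      exact hr1 hres e he hd (ha ▸ hadm)
    rw [hbot]
    obtain ⟨B, -⟩ := (isListBasis_nil (K := K) (E := HahnSeries ℚ K)).exists_basis
    exact ⟨B, fun i => i.elim0⟩
  | some e =>
    obtain ⟨s, c⟩ := e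
    obtain ⟨he, hd, hmax⟩ := hr2 _ hres
    obtain ⟨φ, hφ⟩ : ∃ φ : ChangeVar, φ = ⟨-((N : ℚ) * s).num, N, ((N : ℚ) * c).num⟩ := ⟨_, rfl⟩
    have H : IsEdgeChange b r d a φ ts :=
      hφ ▸ isEdgeChange_of_mem_newtonEdges hb hN hcop hterms hconst he hd
    have hβ : φ.β = N := by rw [hφ]
    have hα : (φ.α : ℚ) / φ.β = -s := by
      rw [hφ]
      push_cast
      rw [(Rat.den_eq_one_iff _).mp hd]
      field_simp
    obtain ⟨w, hw⟩ : ∃ w, w = ⌊nuT b φ ts⌋.toNat + 1 := ⟨_, rfl⟩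
    obtain ⟨h, hh⟩ := Int.eq_ofNat_of_zero_le
      (add_nonneg H.tval₀_nonneg (Int.natCast_nonneg w))
    rw [(puiseuxSolve_of_some M hts hres hφ).1]
    obtain ⟨hF1, hF2, -, -⟩ := approxSolutions_spec M H hw hh.symm
    have hval : ∀ y ∈ solutionSpace b hb r φ.β ℓ, ∀ q, y.coeff q ≠ 0 → (φ.α : ℚ) / φ.β ≤ q := by
      intro y hy q hq
      rw [hβ] at hy
      have hy0 : y ≠ 0 := fun h => hq (by rw [h, HahnSeries.coeff_zero])
      obtain ⟨e, he, heq, hd', hadm'⟩ := hadm y hy hy0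
      have h1 := hmax e he hd' (ha ▸ hadm')
      have h2 := HahnSeries.order_le_of_coeff_ne_zero hq
      rw [hα]
      simp only at h1
      linarith
    have hspace : (truncatedKernel (rmat b a φ ts) h w).map ((seqSeries φ.β H.beta_pos φ.α) ∘ₗ
        (prolongHom (rmat b a φ ts) (tval₀ b φ ts) w)) = solutionSpace b hb r N ℓ := by
      rw [← hβ]
      subst ha
      exact (solutionSpace_eq_map hb hdeg H hval hw hh.symm).symm
    have hbasis := hF2.map ((seqSeries φ.β H.beta_pos φ.α) ∘ₗ
      (prolongHom (rmat b a φ ts) (tval₀ b φ ts) w)) (fun f hf hf0 => by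
        have h1 : prolongHom (rmat b a φ ts) (tval₀ b φ ts) w f = 0 :=
          seqSeries_injective H.beta_pos φ.α (hf0.trans (map_zero _).symm)
        funext n
        rcases lt_or_ge n w with hn | hn
        · rw [← prolongSeq_of_lt (rmat b a φ ts) (tval₀ b φ ts) f hn, ← prolongHom_apply, h1]
        · exact (mem_truncatedKernel.mp hf).1 n hn)
    rw [hspace] at hbasis
    rw [List.map_map] at hbasis
    refine hbasis.isTruncatedBasis (fun f => (prolong (fieldArith K M) b a φ ts
      ⌊nuT b φ ts⌋.toNat ⌊muT b φ ts⌋ (-φ.α + T - 1 - ⌊nuT b φ ts⌋.toNat).toNat f).val.take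
        (-φ.α + T).toNat) fun f hf => ?_
    have hfl : f.length = w := hF1 f hf
    obtain ⟨n', hn'⟩ : ∃ n', n' = (-φ.α + T - 1 - ⌊nuT b φ ts⌋.toNat).toNat := ⟨_, rfl⟩
    obtain ⟨-, hp2, -⟩ := prolong_spec M hb a φ H.coprime ts hterms.sublist
      hterms.deg_le ⌊nuT b φ ts⌋.toNat (tval₀ b φ ts) n' f (by rw [hfl, hw])
    rw [← H.floor_muT, ← hw] at hp2
    rw [← hn', ← hβ, toPuiseux_eq_seqSeries H.beta_pos]
    simp only [Function.comp_apply, LinearMap.comp_apply, prolongHom_apply]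
    intro q
    by_cases hq : ∃ n : ℕ, q = ((φ.α : ℚ) + n) / φ.β
    · obtain ⟨n, rfl⟩ := hq
      rw [coeff_seqSeries, coeff_seqSeries, vec_take]
      have hiff : ((φ.α : ℚ) + n) / φ.β < (T : ℚ) / φ.β ↔ n < (-φ.α + T).toNat := by
        rw [hβ, div_lt_div_iff_of_pos_right hN', ← Int.cast_natCast n, ← Int.cast_natCast T,
          ← Int.cast_add, Int.cast_lt]
        omega
      by_cases hlt : n < (-φ.α + T).toNat
      · rw [if_pos hlt, if_pos (hiff.mpr hlt), hp2 n (by omega)]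
      · rw [if_neg hlt, if_neg (mt hiff.mp hlt)]
    · push Not at hq
      rw [coeff_seqSeries_of_ne H.beta_pos _ _ hq, coeff_seqSeries_of_ne H.beta_pos _ _ hq,
        ite_self]

/-! ### Complexity -/

/-- The cost of the steps of the algorithm, in terms of `P = N d` and `m = M P`, for matrices with
`w` columns, `h` truncated coefficients and `n'` coefficients to compute. -/
theorem cost_bound {r d N n P m w h n' : ℕ} (hr : 1 ≤ r) (hd : 1 ≤ d) (hP : P = N * d)
    (hN : 1 ≤ N) (hm : P ≤ m) (hw : w ≤ 2 * P + 1) (hh : h ≤ 3 * P + 1)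
    (hn' : n' ≤ N * (n + 1) + P) :
    (r + 1) * (d + 1) + (r + 1) * (r + 2) +
      (w * (2 * d + (r + 1)) + (w * ((r + 1) * (2 * (2 * d + (r + 1)) + 2) + 1) +
        (r + 1) * ((r + 1) * (2 * w))) +
      (r + 1) * ((r + 1) * ((h / (P + 1) + 1) ^ 2 * (m + h) + h)) +
      (r + 1) * ((r + 1) * (1 + 2 * h + 2 * w) + h) + (r + 1) * ((r + 1) * (2 * w))) +
      (r + 1) * (n' * (3 * (2 * d + (r + 1)) + 2)) ≤
    500 * (r ^ 2 * m + r * N * (d ^ 2 + (r + d) * n)) := by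
  have hdP : d ≤ P := hP ▸ Nat.le_mul_of_pos_left d hN
  have hNP : N ≤ P := hP ▸ Nat.le_mul_of_pos_right N hd
  have hP1 : 1 ≤ P := hd.trans hdP
  -- a truncated product consists of at most three by three blocks
  have hdiv : h / (P + 1) + 1 ≤ 3 := by
    have : h / (P + 1) < 3 := by
      rw [Nat.div_lt_iff_lt_mul (Nat.succ_pos P)]
      omega
    omega
  have hr' : r + 1 ≤ 2 * r := by omega
  have hs : 2 * d + (r + 1) ≤ 2 * (d + r) := by omega
  have hw' : w ≤ 3 * P := by omega
  have hh' : h ≤ 4 * P := by omega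
  have hn'' : n' ≤ N * n + 2 * P := by
    rw [Nat.mul_succ] at hn'
    omega
  have e1 : (r + 1) * (d + 1) ≤ 2 * r * (2 * d) := Nat.mul_le_mul hr' (by omega)
  have e2 : (r + 1) * (r + 2) ≤ 2 * r * (3 * r) := Nat.mul_le_mul hr' (by omega)
  have e3 : w * (2 * d + (r + 1)) ≤ 3 * P * (2 * (d + r)) := Nat.mul_le_mul hw' hs
  have e4 : w * ((r + 1) * (2 * (2 * d + (r + 1)) + 2) + 1) ≤
      3 * P * (2 * r * (6 * (d + r)) + r) :=
    Nat.mul_le_mul hw' (Nat.add_le_add (Nat.mul_le_mul hr' (by omega)) hr)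
  have e5 : (r + 1) * ((r + 1) * (2 * w)) ≤ 2 * r * (2 * r * (6 * P)) :=
    Nat.mul_le_mul hr' (Nat.mul_le_mul hr' (by omega))
  have e6 : (r + 1) * ((r + 1) * ((h / (P + 1) + 1) ^ 2 * (m + h) + h)) ≤
      2 * r * (2 * r * (3 ^ 2 * (m + 4 * P) + 4 * P)) := by gcongr
  have e7 : (r + 1) * ((r + 1) * (1 + 2 * h + 2 * w) + h) ≤
      2 * r * (2 * r * (15 * P) + 4 * P) :=
    Nat.mul_le_mul hr' (Nat.add_le_add (Nat.mul_le_mul hr' (by omega)) hh')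
  have e8 : (r + 1) * (n' * (3 * (2 * d + (r + 1)) + 2)) ≤
      2 * r * ((N * n + 2 * P) * (7 * (d + r))) :=
    Nat.mul_le_mul hr' (Nat.mul_le_mul hn'' (by omega))
  have hrr : r ≤ r ^ 2 := Nat.le_self_pow (by norm_num) r
  have f1 : r ^ 2 * P ≤ r ^ 2 * m := Nat.mul_le_mul_left _ hm
  have f2 : r * d ≤ r ^ 2 * P := Nat.mul_le_mul hrr hdP
  have f3 : r ^ 2 * 1 ≤ r ^ 2 * P := Nat.mul_le_mul_left _ hP1
  have f4 : r * P ≤ r ^ 2 * P := Nat.mul_le_mul_right _ hrr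
  have f5 : P * d ≤ r * (P * d) := Nat.le_mul_of_pos_left _ hr
  have f6 : r * (P * d) = r * N * d ^ 2 := by rw [hP]; ring
  nlinarith [Nat.zero_le (r * N * (r * n)), Nat.zero_le (r * N * (d * n))]

theorem mul_le_of_isMulCost {M : ℕ → ℕ} (hM : IsMulCost M) {i : ℕ} (hi : 1 ≤ i) : i ≤ M i := by
  have h1 := hM.2 1 i le_rfl hi
  have h2 := Nat.mul_le_mul_right i hM.1
  omega

/-- The operation count of the algorithm. -/
theorem ops_puiseuxRun_le {M : ℕ → ℕ} (hM : IsMulCost M) {b r d N n T : ℕ} {ℓ : ℕ → K[X]}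
    (hb : 2 ≤ b) (hr : 1 ≤ r) (hd : 1 ≤ d) (hN : 0 < N) (hcop : N.Coprime b) (h0 : ℓ 0 ≠ 0)
    (hdeg : ∀ k ≤ r, (ℓ k).natDegree ≤ d) (hT : T ≤ N * (n + 1)) :
    (puiseuxRun M b r d N T ℓ).ops ≤
      500 * (r ^ 2 * M (N * d) + r * N * (d ^ 2 + (r + d) * n)) := by
  have hm : N * d ≤ M (N * d) := mul_le_of_isMulCost hM (Nat.mul_pos hN hd)
  obtain ⟨a, ha⟩ : ∃ a : ℕ → ℕ → K, a = fun k j => (ℓ k).coeff j := ⟨_, rfl⟩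
  obtain ⟨ts, hts⟩ : ∃ ts, ts = (mahlerTerms (fieldArith K M) r d a).val := ⟨_, rfl⟩
  have hterms : IsTermList r d a ts := hts ▸ mahlerTerms_spec M r d a
  have hconst : ∃ T ∈ ts, T.k = 0 :=
    exists_term hdeg (ha ▸ hterms) (Nat.zero_le r) h0
  obtain ⟨-, hr2, hr3⟩ := rightmostAdmissibleEdge_spec M hb N a hterms
  rw [puiseuxRun, ← ha]
  cases hres : (rightmostAdmissibleEdge (fieldArith K M) b N a ts).val with
  | none =>
    rw [(puiseuxSolve_of_none M hts hres).2]
    refine le_trans ?_ (cost_bound (w := 0) (h := 0) (n' := 0) hr hd rfl hN hm (Nat.zero_le _)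
      (Nat.zero_le _) (Nat.zero_le _))
    omega
  | some e =>
    obtain ⟨s, c⟩ := e
    obtain ⟨he, hd', -⟩ := hr2 _ hres
    obtain ⟨φ, hφ⟩ : ∃ φ : ChangeVar, φ = ⟨-((N : ℚ) * s).num, N, ((N : ℚ) * c).num⟩ := ⟨_, rfl⟩
    have H : IsEdgeChange b r d a φ ts :=
      hφ ▸ isEdgeChange_of_mem_newtonEdges hb hN hcop hterms hconst he hd'
    have hβ : φ.β = N := by rw [hφ]
    obtain ⟨w, hw⟩ : ∃ w, w = ⌊nuT b φ ts⌋.toNat + 1 := ⟨_, rfl⟩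
    obtain ⟨h, hh⟩ := Int.eq_ofNat_of_zero_le
      (add_nonneg H.tval₀_nonneg (Int.natCast_nonneg w))
    rw [(puiseuxSolve_of_some M hts hres hφ).2]
    obtain ⟨hF1, -, hF3, hF4⟩ := approxSolutions_spec M H hw hh.symm
    obtain ⟨n', hn'⟩ : ∃ n', n' = (-φ.α + T - 1 - ⌊nuT b φ ts⌋.toNat).toNat := ⟨_, rfl⟩
    have hprol : ((approxSolutions M b d a φ ts).val.mapM fun f => prolong (fieldArith K M) b a φ ts
        ⌊nuT b φ ts⌋.toNat ⌊muT b φ ts⌋ n' f).ops ≤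
        (r + 1) * (n' * (3 * (2 * d + (r + 1)) + 2)) := by
      refine (Counted.ops_mapM_le _ _ (n' * (3 * (2 * d + (r + 1)) + 2)) fun f hf => ?_).trans
        (Nat.mul_le_mul_right _ hF3)
      obtain ⟨-, -, h1⟩ := prolong_spec M hb a φ H.coprime ts hterms.sublist hterms.deg_le
        ⌊nuT b φ ts⌋.toNat (tval₀ b φ ts) n' f ((hF1 f hf).trans hw)
      rwa [← H.floor_muT] at h1
    rw [hβ] at hF4
    rw [← hn']
    have b1 := H.floor_nuT_le
    have b2 := H.floor_muT_le
    have b3 := H.le_floor_nuT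
    rw [hβ] at b1 b2 b3
    have hmul : ((N * d : ℕ) : ℤ) = (N : ℤ) * d := Nat.cast_mul N d
    have hh3 : h ≤ 3 * (N * d) + 1 := by
      rw [H.floor_muT] at b2
      omega
    have hn3 : n' ≤ N * (n + 1) + N * d := by omega
    refine le_trans ?_ (cost_bound hr hd rfl hN hm (by omega : w ≤ 2 * (N * d) + 1) hh3 hn3)
    exact Nat.add_le_add (Nat.add_le_add (Nat.add_le_add_left hr3 _) hF4) hprol

/-- The bound for a softly linear multiplication: every term is at most `G` times a power of
`log (G + 2)`, where `G = r ^ 2 N d (d + n)`. -/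
theorem soft_bound {c : ℝ} {e r d N n m : ℕ} (hc : 0 ≤ c) (hr : 1 ≤ r) (hd : 1 ≤ d) (hN : 0 < N)
    (hm : (m : ℝ) ≤ c * (N * d : ℕ) * Real.log ((N * d : ℕ) + 2) ^ e) :
    (r ^ 2 * m + r * N * (d ^ 2 + (r + d) * n) : ℝ) ≤
      (c + 3) * (r ^ 2 * N * d * (d + n)) * Real.log (r ^ 2 * N * d * (d + n) + 2) ^ e := by
  have hr' : (1 : ℝ) ≤ r := by exact_mod_cast hr
  have hd' : (1 : ℝ) ≤ d := by exact_mod_cast hd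
  have hN' : (1 : ℝ) ≤ N := by exact_mod_cast hN
  have hn' : (0 : ℝ) ≤ n := Nat.cast_nonneg n
  obtain ⟨G, hG⟩ : ∃ G : ℝ, G = r ^ 2 * N * d * (d + n) := ⟨_, rfl⟩
  rw [← hG]
  have hrr : (r : ℝ) ≤ r ^ 2 := by nlinarith
  have hr2 : (1 : ℝ) ≤ r ^ 2 := hr'.trans hrr
  have hNd : (1 : ℝ) ≤ N * d := by nlinarith
  have g1 : (r : ℝ) ^ 2 * (N * d) ≤ G := by
    have h1 : (r : ℝ) ^ 2 * (N * d * 1) ≤ r ^ 2 * (N * d * (d + n)) := by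
      gcongr
      linarith
    rw [hG]
    linarith
  have g0 : (N : ℝ) * d ≤ G := by nlinarith
  have g2 : (r : ℝ) * N * d ^ 2 ≤ G := by
    have h1 : (r : ℝ) * (N * d * d) ≤ r ^ 2 * (N * d * (d + n)) := by
      gcongr
      linarith
    rw [hG]
    linarith
  have g3 : (r : ℝ) * N * (r * n) ≤ G := by
    have h1 : (r : ℝ) ^ 2 * N * (1 * n) ≤ r ^ 2 * N * (d * (d + n)) := by
      gcongr
      nlinarith
    rw [hG]
    linarith
  have g4 : (r : ℝ) * N * (d * n) ≤ G := by
    have h1 : (r : ℝ) * (N * d * n) ≤ r ^ 2 * (N * d * (d + n)) := by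
      gcongr
      linarith
    rw [hG]
    linarith
  obtain ⟨L, hL⟩ : ∃ L : ℝ, L = Real.log (G + 2) ^ e := ⟨_, rfl⟩
  have hG1 : 1 ≤ G := hNd.trans g0
  have hlog : 1 ≤ Real.log (G + 2) := by
    rw [Real.le_log_iff_exp_le (by linarith)]
    linarith [Real.exp_one_lt_d9]
  have hL1 : 1 ≤ L := hL ▸ one_le_pow₀ hlog
  have hmL : (m : ℝ) ≤ c * (N * d) * L := by
    push_cast at hm
    refine hm.trans ?_
    rw [hL]
    gcongr
    exact Real.log_nonneg (by linarith)
  have h1 : (r : ℝ) ^ 2 * m ≤ c * G * L := by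
    calc (r : ℝ) ^ 2 * m ≤ r ^ 2 * (c * (N * d) * L) := by gcongr
      _ = c * (r ^ 2 * (N * d)) * L := by ring
      _ ≤ c * G * L := by gcongr
  have h2 : G ≤ G * L := le_mul_of_one_le_right (by linarith) hL1
  rw [← hL]
  linarith

end Main

theorem mainTheorem2 :
    -- correctness
    (∀ (K : Type) [Field K] [DecidableEq K] (M : ℕ → ℕ) (b r d N T : ℕ) (ℓ : ℕ → K[X])
        (hb : 2 ≤ b), 0 < N → N.Coprime b → ℓ 0 ≠ 0 → ℓ r ≠ 0 →
        (∀ k ≤ r, (ℓ k).natDegree ≤ d) →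
        IsTruncatedBasis N ((T : ℚ) / N) (solutionSpace b hb r N ℓ)
          (puiseuxRun M b r d N T ℓ).val) ∧
    -- number of operations
    (∃ C : ℕ, ∀ (K : Type) [Field K] [DecidableEq K] (M : ℕ → ℕ) (b r d N n T : ℕ)
        (ℓ : ℕ → K[X]), IsMulCost M → 2 ≤ b → 1 ≤ r → 1 ≤ d → 0 < N → N.Coprime b →
        ℓ 0 ≠ 0 → ℓ r ≠ 0 → (∀ k ≤ r, (ℓ k).natDegree ≤ d) → T ≤ N * (n + 1) →
        (puiseuxRun M b r d N T ℓ).ops ≤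
          C * (r ^ 2 * M (N * d) + r * N * (d ^ 2 + (r + d) * n))) ∧
    -- number of operations when polynomials are multiplied in softly linear time
    (∀ (c : ℝ) (e : ℕ), ∃ (C : ℝ) (e' : ℕ), ∀ (K : Type) [Field K] [DecidableEq K]
        (M : ℕ → ℕ) (b r d N n T : ℕ) (ℓ : ℕ → K[X]), IsMulCost M →
        (∀ i : ℕ, 1 ≤ i → (M i : ℝ) ≤ c * i * Real.log (i + 2) ^ e) →
        2 ≤ b → 1 ≤ r → 1 ≤ d → 0 < N → N.Coprime b →
        ℓ 0 ≠ 0 → ℓ r ≠ 0 → (∀ k ≤ r, (ℓ k).natDegree ≤ d) → T ≤ N * (n + 1) →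
        ((puiseuxRun M b r d N T ℓ).ops : ℝ) ≤
          C * (r ^ 2 * N * d * (d + n)) * Real.log (r ^ 2 * N * d * (d + n) + 2) ^ e') := by
  refine ⟨?_, ⟨500, ?_⟩, fun c e => ⟨500 * (c + 3), e, ?_⟩⟩
  · intro K _ _ M b r d N T ℓ hb hN hcop h0 _ hdeg
    exact puiseuxRun_correct M T hb hN hcop h0 hdeg
  · intro K _ _ M b r d N n T ℓ hM hb hr hd hN hcop h0 _ hdeg hT
    exact ops_puiseuxRun_le hM hb hr hd hN hcop h0 hdeg hT
  · intro K _ _ M b r d N n T ℓ hM hsoft hb hr hd hN hcop h0 _ hdeg hT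
    have h1 : ((puiseuxRun M b r d N T ℓ).ops : ℝ) ≤
        500 * (r ^ 2 * (M (N * d) : ℕ) + r * N * (d ^ 2 + (r + d) * n)) := by
      exact_mod_cast ops_puiseuxRun_le hM hb hr hd hN hcop h0 hdeg hT
    -- the hypotheses on `M 1` force `c` to be positive
    have hc : 0 ≤ c := by
      by_contra hneg
      have h2 := hsoft 1 le_rfl
      have h3 : (1 : ℝ) ≤ (M 1 : ℝ) := by exact_mod_cast hM.1
      have h4 : 0 ≤ Real.log (((1 : ℕ) : ℝ) + 2) ^ e :=
        pow_nonneg (Real.log_nonneg (by norm_num)) e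
      have h5 : c * ((1 : ℕ) : ℝ) ≤ 0 := by
        rw [Nat.cast_one, mul_one]
        exact (not_le.mp hneg).le
      linarith [mul_nonpos_of_nonpos_of_nonneg h5 h4]
    have h2 := soft_bound (n := n) hc hr hd hN (hsoft (N * d) (Nat.mul_pos hN hd))
    linarith
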